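/- Let $\mathbb K\in\{\mathbb R,\mathbb C\}$, let $\Omega\subset\mathbb R$ be open and non-empty, let $\mathcal D(\Omega)$ be the space of $\mathbb K$-valued test functions on $\Omega$ and $\mathcal D'(\Omega)$ its strong dual. Write $\mathbb R_*=\mathbb R\setminus\{0\}$ and $\theta=x\frac{d}{dx}$. A Hadamard operator on $\mathcal D'(\Omega)$ is a continuous linear operator $L:\mathcal D'(\Omega)\to\mathcal D'(\Omega)$ which admits all monomials as eigenvectors, i.e. for every $n\in\mathbb N_0$ there is $m_n\in\mathbb K$ with $L(x^n)=m_nx^n$; the set of these operators is denoted $\mathcal M(\Omega)$. $\mathcal O'_H(\mathbb R)$ is the set of all $T\in\mathcal D'(\mathbb R)$ such that for every $k\in\mathbb N_0$ there are finitely many functions $t_0,\dots,t_{N}$ with $(1+|x|^2)^{k/2}t_j\in L_\infty(\mathbb R)$ and $T=\sum_{j=0}^{N}\theta^jt_j$. $\mathcal D'_H(\mathbb R)$ is the set of all $T\in\mathcal O'_H(\mathbb R)$ whose support has positive distance to $0$, and $\mathcal E'(\mathbb R_*)$ is the set of distributions on $\mathbb R_*$ with compact support in $\mathbb R_*$. For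 $M\subset\mathbb R_*$ put $1/M=\{1/x: x\in M\}$, for $K\subset\mathbb R$ put $(1/M)K=\{y/x: x\in M,\ y\in K\}$, and put $V_*(\Omega)=\{\eta\in\mathbb R_*:\eta\,\Omega\subset\Omega\}$. We write $A\subset\subset\Omega$ if $\overline A$ is compact and contained in $\Omega$. For $S\in\mathcal D'(\Omega)$ and a distribution $T$ on $\mathbb R$ or on $\mathbb R_*$, the multiplicative convolution is defined by $(S\star T)\varphi=S_y\big(T_x\varphi(xy)\big)$ for $\varphi\in\mathcal D(\Omega)$. It is said to be defined if, for every $\varphi\in\mathcal D(\Omega)$, $y\mapsto T_x\varphi(xy)$, $y\ne0$, is the restriction to $\mathbb R_*$ of a (then unique) function in $\mathcal D(\Omega)$ (test functions being extended by $0$), to which $S$ is applied, and the resulting functional on $\mathcal D(\Omega)$ is a distribution on $\Omega$. **Theorem.** (1) Suppose $0\in\Omega$. If $T\in\mathcal D'_H(\mathbb R)$ satisfies $(1/\operatorname{supp}T)K\subset\subset\Omega$ for every compact $K\subset\Omega$, then $S\star T\in\mathcal D'(\Omega)$ is defined for all $S\in\mathcal D'(\Omega)$. A map $L:\mathcal D'(\Omega)\to\mathcal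 D'(\Omega)$ belongs to $\mathcal M(\Omega)$ if and only if there is such a $T$ with $L(S)=S\star T$ for all $S\in\mathcal D'(\Omega)$. (2) Suppose $\Omega\subset\mathbb R_*$. If $T\in\mathcal E'(\mathbb R_*)$ satisfies $1/\operatorname{supp}T\subset V_*(\Omega)$, then $S\star T\in\mathcal D'(\Omega)$ is defined for all $S\in\mathcal D'(\Omega)$. A map $L:\mathcal D'(\Omega)\to\mathcal D'(\Omega)$ belongs to $\mathcal M(\Omega)$ if and only if there is such a $T$ with $L(S)=S\star T$ for all $S\in\mathcal D'(\Omega)$. -/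

import Mathlib

open MeasureTheory TopologicalSpace
open scoped Distributions CompactConvergenceCLM Pointwise

namespace HadamardOp

/-- `𝓓'(Ω)` for an open set `Ω ⊆ ℝ` and `𝕜 = ℝ` or `ℂ`: the continuous `𝕜`-linear functionals on
the `LF`-space `𝓓(Ω, 𝕜)` of `𝕜`-valued test functions, with the topology of uniform convergence on
compact sets. Since `𝓓(Ω, 𝕜)` is a Montel space this is the strong dual topology. -/
abbrev Dist (𝕜 : Type*) [RCLike 𝕜] (Ω : Opens ℝ) : Type _ := 𝓓(Ω, 𝕜) →L_c[𝕜] 𝕜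

/-- The punctured line `ℝ ∖ {0}`. -/
def puncturedLine : Opens ℝ := ⟨{0}ᶜ, isOpen_compl_singleton⟩

variable {𝕜 : Type*} [RCLike 𝕜]

variable (𝕜) in
/-- The monomial `x ^ n` as a distribution on `Ω`: `φ ↦ ∫ φ(x) x ^ n dx`. -/
noncomputable def monomial (Ω : Opens ℝ) (n : ℕ) : Dist 𝕜 Ω :=
  TestFunction.integralAgainstBilinCLM (ContinuousLinearMap.mul 𝕜 𝕜) volume
    (fun x : ℝ => (x : 𝕜) ^ n)

/-- The value of the distribution `x ^ n` on a test function (no junk value occurs). -/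
theorem monomial_apply (Ω : Opens ℝ) (n : ℕ) (φ : 𝓓(Ω, 𝕜)) :
    monomial 𝕜 Ω n φ = ∫ x : ℝ, φ x * (x : 𝕜) ^ n := by
  have h : LocallyIntegrableOn (fun x : ℝ => (x : 𝕜) ^ n) (Ω : Set ℝ) volume :=
    ((RCLike.continuous_ofReal.pow n).locallyIntegrable).locallyIntegrableOn _
  exact TestFunction.integralAgainstBilinCLM_eq_integral h

variable (𝕜) in
/-- The set of Hadamard operators on `𝓓'(Ω)`: the continuous linear operators on `𝓓'(Ω)` which
admit all monomials as eigenvectors. -/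
def hadamardOperators (Ω : Opens ℝ) : Set (Dist 𝕜 Ω →L[𝕜] Dist 𝕜 Ω) :=
  {A | ∀ n : ℕ, ∃ m : 𝕜,
    Module.End.HasEigenvector (A : Dist 𝕜 Ω →ₗ[𝕜] Dist 𝕜 Ω) m (monomial 𝕜 Ω n)}

/-- The support of a distribution on `Ω`, as a closed subset of `ℝ`. -/
def supp {Ω : Opens ℝ} (T : Dist 𝕜 Ω) : Set ℝ :=
  Distribution.dsupport (T : 𝓓(Ω, 𝕜) → 𝕜)

/-- `ψ(y) = T_x φ(x y)` for all `y ≠ 0`, where `φ` and `ψ` are test functions on `Ω` and `T` is a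
distribution on `U`; this includes that each dilate `x ↦ φ(x y)`, `y ≠ 0`, is a test function on
`U`. By continuity there is at most one such `ψ`. -/
def IsDualDilation {Ω U : Opens ℝ} (T : Dist 𝕜 U) (φ ψ : 𝓓(Ω, 𝕜)) : Prop :=
  ∀ y : ℝ, y ≠ 0 → ∃ χ : 𝓓(U, 𝕜), (∀ x : ℝ, χ x = φ (x * y)) ∧ ψ y = T χ

/-- `R = S ⋆ T`, the multiplicative convolution on `𝓓'(Ω)`: for every test function `φ` on `Ω`
the function `y ↦ T_x φ(x y)` is a test function on `Ω` and `R φ = S_y (T_x φ(x y))`. -/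
def IsMulConv {Ω U : Opens ℝ} (S : Dist 𝕜 Ω) (T : Dist 𝕜 U) (R : Dist 𝕜 Ω) : Prop :=
  ∀ φ : 𝓓(Ω, 𝕜), ∃ ψ : 𝓓(Ω, 𝕜), IsDualDilation T φ ψ ∧ R φ = S ψ

/-- The formal transpose `f ↦ - (x f)'` of the Euler derivative `θ = x d/dx`. -/
noncomputable def eulerTranspose (f : ℝ → 𝕜) : ℝ → 𝕜 :=
  fun x => -deriv (fun y : ℝ => (y : 𝕜) * f y) x

/-- The class `𝒪'_H(ℝ)`: for every `k` there are finitely many functions `t_j` such that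
`(1 + |x|²)^(k/2) t_j ∈ L_∞(ℝ)` and `T = ∑ θ^j t_j` in the sense of distributions, that is,
`T φ = ∑ ∫ t_j(x) ((θ*)^j φ)(x) dx`, where `θ*` is the transpose of `θ = x d/dx`. -/
def IsOH (T : Dist 𝕜 ⊤) : Prop :=
  ∀ k : ℕ, ∃ (N : ℕ) (t : ℕ → ℝ → 𝕜),
    (∀ j < N, MemLp (fun x : ℝ => (((1 + |x| ^ 2) ^ ((k : ℝ) / 2) : ℝ) : 𝕜) * t j x) ⊤ volume) ∧
    ∀ φ : 𝓓((⊤ : Opens ℝ), 𝕜),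
      T φ = ∑ j ∈ Finset.range N, ∫ x : ℝ, t j x * (eulerTranspose^[j] φ) x

/-- The class `𝓓'_H(ℝ)`: the elements of `𝒪'_H(ℝ)` whose support has positive distance to `0`. -/
def IsDH (T : Dist 𝕜 ⊤) : Prop :=
  IsOH T ∧ ∃ ε : ℝ, 0 < ε ∧ ∀ x ∈ supp T, ε ≤ |x|

/-- `T ∈ ℰ'(U)`: the distribution `T` on `U` has compact support contained in `U`. -/
def HasCompactSupp {U : Opens ℝ} (T : Dist 𝕜 U) : Prop :=
  IsCompact (supp T) ∧ supp T ⊆ U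

/-- `A` is relatively compact in the open set `Ω`. -/
def IsRelCompactIn (A : Set ℝ) (Ω : Opens ℝ) : Prop :=
  IsCompact (closure A) ∧ closure A ⊆ Ω

/-- The condition `(1 / supp T) K ⋐ Ω` for every compact `K ⊆ Ω`. -/
def SuppCondition {U : Opens ℝ} (T : Dist 𝕜 U) (Ω : Opens ℝ) : Prop :=
  ∀ K : Set ℝ, IsCompact K → K ⊆ Ω → IsRelCompactIn ((supp T)⁻¹ * K) Ω

/-- `V_*(Ω) = {η ≠ 0 : η Ω ⊆ Ω}`. -/
def dilationSet (Ω : Opens ℝ) : Set ℝ :=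
  {η | η ≠ 0 ∧ ∀ x ∈ Ω, η * x ∈ Ω}

end HadamardOp

namespace HadamardOp

open Set Filter Topology
open scoped ContDiff

variable {𝕜 : Type*} [RCLike 𝕜]

/-! A continuous operator on `𝓓'(Ω)` is the transpose of an operator `M` on test functions, because
`𝓓(Ω)` is reflexive (`exists_transpose`), and `M` maps functions supported in one compact set
boundedly to functions supported in another (`isLocallyBounded_of_transpose`). That the monomials
are eigenvectors says that `M` multiplies the `n`-th moment of a test function by a constant `m_n`.
A compactly supported continuous function is determined by its moments, so `M` commutes with every
operation acting diagonally on moments, in particular with dilations and with `θ`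
(`PreservesMoments.eq_of_moments`). Commuting with dilations means that `(M φ)(y)` depends only on
the function `x ↦ φ(xy)`, so that `(M φ)(y) = T_x φ(xy)` for some distribution `T`.

If `0 ∈ Ω`, every test function on the line can be shrunk into `Ω`, which defines `T` on `ℝ`. The
support condition and the vanishing of `T` near `0` follow from the local boundedness of `M`. The
decay of `T` at infinity is dual to flatness at `0`: if `φ` vanishes near `0`, then all derivatives
of `M φ` vanish at `0` (`iteratedDeriv_apply_zero`). Small values `(M φ)(y)` for small `y` are small
values of `T` on far dyadic annuli, and summing over the annuli gives `𝒪'_H`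
(`isDH_of_dualDilation`). If `0 ∉ Ω`, shrinking is impossible and `T` is assembled from dilates of
one bump function forming a multiplicative partition of unity (`exists_dist_of_punctured`).

Conversely, an admissible `T` can be written `T φ = ∑ ∫ τᵢ xⁱ φ⁽ⁱ⁾` with `τᵢ` vanishing near `0` and
having as many integrable moments as desired (`IsRep`). The operators `xⁱ (d/dx)ⁱ` commute with
dilations, so `y ↦ T_x φ(xy)` may be differentiated under the integral; the support condition puts
its support into a compact subset of `Ω`, and Fubini shows that moments are multiplied by constants
(`exists_operator`). Then `S ⋆ T = S ∘ M`. -/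

/-- All derivatives of `f` of order at most `m` are bounded by `B`. -/
def DerivBound (m : ℕ) (B : ℝ) (f : ℝ → 𝕜) : Prop :=
  ∀ j ≤ m, ∀ x, ‖iteratedDeriv j f x‖ ≤ B

theorem DerivBound.nonneg {m : ℕ} {B : ℝ} {f : ℝ → 𝕜} (h : DerivBound m B f) : 0 ≤ B :=
  (norm_nonneg _).trans (h 0 (Nat.zero_le _) 0)

theorem DerivBound.mono {m n : ℕ} {B C : ℝ} {f : ℝ → 𝕜} (h : DerivBound m B f) (hn : n ≤ m)
    (hB : B ≤ C) : DerivBound n C f :=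
  fun j hj x => (h j (hj.trans hn) x).trans hB

/-! ### Continuity on the LF-space of test functions, expressed by estimates on compact sets. -/

section Bounds

variable {U : Opens ℝ}

theorem TestFunction.contDiff_infty (φ : 𝓓(U, 𝕜)) : ContDiff ℝ ∞ φ := φ.contDiff

/-- A test function supported in `K`, as an element of the Fréchet space of functions supported
in `K`. -/
noncomputable def restrictTo (φ : 𝓓(U, 𝕜)) (K : Compacts ℝ) (h : Function.support φ ⊆ K) :
    𝓓^{⊤}_{K}(ℝ, 𝕜) :=
  ContDiffMapSupportedIn.of_support_subset φ.contDiff h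

theorem ofSupportedIn_restrictTo (φ : 𝓓(U, 𝕜)) (K : Compacts ℝ) (hKU : (K : Set ℝ) ⊆ U)
    (h : Function.support φ ⊆ K) :
    TestFunction.ofSupportedIn hKU (restrictTo φ K h) = φ := by
  ext x; rfl

theorem seminorm_restrictTo_le {φ : 𝓓(U, 𝕜)} {K : Compacts ℝ} {h : Function.support φ ⊆ K}
    {m : ℕ} {B : ℝ} (hB : DerivBound m B φ) {i : ℕ} (hi : i ≤ m) :
    ContDiffMapSupportedIn.seminorm 𝕜 ℝ 𝕜 ⊤ K i (restrictTo φ K h) ≤ B := by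
  rw [ContDiffMapSupportedIn.seminorm_top_le_iff 𝕜 hB.nonneg]
  intro x _
  rw [norm_iteratedFDeriv_eq_norm_iteratedDeriv]
  exact hB i hi x

theorem derivBound_of_seminorm {K : Compacts ℝ} (f : 𝓓^{⊤}_{K}(ℝ, 𝕜)) (m : ℕ) :
    DerivBound m ((Finset.Iic m).sup (ContDiffMapSupportedIn.seminorm 𝕜 ℝ 𝕜 ⊤ K) f) f := by
  intro j hj x
  rw [← norm_iteratedFDeriv_eq_norm_iteratedDeriv]
  exact (ContDiffMapSupportedIn.norm_iteratedFDeriv_apply_le_seminorm_top 𝕜).trans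
    (Seminorm.le_finset_sup_apply (Finset.mem_Iic.2 hj))

/-- On the Fréchet space of functions supported in `K`, a continuous seminorm is dominated by
finitely many of the defining ones; `m` is the largest index among them. -/
theorem exists_bound_of_continuous {V : Type*} [NormedAddCommGroup V] [NormedSpace 𝕜 V]
    {T : 𝓓(U, 𝕜) →ₗ[𝕜] V} (hT : Continuous T) {K : Set ℝ} (hK : IsCompact K) (hKU : K ⊆ U) :
    ∃ (m : ℕ) (C : ℝ), 0 ≤ C ∧ ∀ φ : 𝓓(U, 𝕜), Function.support φ ⊆ K → ∀ B : ℝ,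
      DerivBound m B φ → ‖T φ‖ ≤ C * B := by
  let K' : Compacts ℝ := ⟨K, hK⟩
  have hKU' : (K' : Set ℝ) ⊆ U := hKU
  let q : Seminorm 𝕜 (𝓓^{⊤}_{K'}(ℝ, 𝕜)) :=
    (normSeminorm 𝕜 V).comp (T ∘ₗ (TestFunction.ofSupportedInCLM 𝕜 hKU').toLinearMap)
  have hq : Continuous q :=
    continuous_norm.comp (hT.comp (TestFunction.continuous_ofSupportedIn hKU'))
  obtain ⟨s, C, -, hC⟩ := Seminorm.bound_of_continuous
    (ContDiffMapSupportedIn.withSeminorms 𝕜 ℝ 𝕜 ⊤ K') q hq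
  refine ⟨s.sup id, C, C.2, fun φ hφ B hB => ?_⟩
  have h1 : q (restrictTo φ K' hφ) = ‖T φ‖ := by
    change ‖T (TestFunction.ofSupportedIn hKU' (restrictTo φ K' hφ))‖ = _
    rw [ofSupportedIn_restrictTo]
  rw [← h1]
  refine (hC _).trans ?_
  rw [smul_apply, NNReal.smul_def, smul_eq_mul]
  refine mul_le_mul_of_nonneg_left ?_ C.2
  refine Seminorm.finset_sup_apply_le hB.nonneg fun i hi => ?_
  exact seminorm_restrictTo_le hB (Finset.le_sup (f := id) hi)

theorem Dist.exists_bound (T : Dist 𝕜 U) {K : Set ℝ} (hK : IsCompact K) (hKU : K ⊆ U) :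
    ∃ (m : ℕ) (C : ℝ), 0 ≤ C ∧ ∀ φ : 𝓓(U, 𝕜), Function.support φ ⊆ K → ∀ B : ℝ,
      DerivBound m B φ → ‖T φ‖ ≤ C * B :=
  exists_bound_of_continuous
    (T := ((ContinuousLinearMap.toUniformConvergenceCLM _ _ _).symm T).toLinearMap)
    ((ContinuousLinearMap.toUniformConvergenceCLM _ _ _).symm T).continuous hK hKU

/-- The topology is an inductive limit, so continuity is tested on each space of functions supported
in a fixed compact set. With `exists_bound_of_continuous` this reduces the LF topology to elementary
estimates. -/
theorem continuous_of_bounds {V : Type*} [NormedAddCommGroup V] [NormedSpace 𝕜 V]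
    [NormedSpace ℝ V] [IsScalarTower ℝ 𝕜 V] (T : 𝓓(U, 𝕜) →ₗ[𝕜] V)
    (h : ∀ K : Set ℝ, IsCompact K → K ⊆ U → ∃ (m : ℕ) (C : ℝ), ∀ φ : 𝓓(U, 𝕜),
      Function.support φ ⊆ K → ∀ B : ℝ, DerivBound m B φ → ‖T φ‖ ≤ C * B) :
    Continuous T := by
  rw [TestFunction.continuous_iff_continuous_comp]
  intro K hKU
  obtain ⟨m, C, hC⟩ := h K K.isCompact hKU
  let Φ : 𝓓^{⊤}_{K}(ℝ, 𝕜) →ₗ[𝕜] V := T ∘ₗ (TestFunction.ofSupportedInCLM 𝕜 hKU).toLinearMap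
  refine (ContDiffMapSupportedIn.mkCLMtoNormedSpace 𝕜 (n := ⊤) (K := K) (F := 𝕜) Φ
    Φ.map_add Φ.map_smul ⟨Finset.Iic m, |C|, abs_nonneg _, fun f => ?_⟩).continuous
  have h1 := derivBound_of_seminorm f m
  exact (hC (TestFunction.ofSupportedIn hKU f) f.support_subset _ h1).trans
    (mul_le_mul_of_nonneg_right (le_abs_self C) h1.nonneg)

/-- A distribution from a linear functional satisfying the usual bounds. -/
noncomputable def mkDist (T : 𝓓(U, 𝕜) →ₗ[𝕜] 𝕜)
    (h : ∀ K : Set ℝ, IsCompact K → K ⊆ U → ∃ (m : ℕ) (C : ℝ), ∀ φ : 𝓓(U, 𝕜),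
      Function.support φ ⊆ K → ∀ B : ℝ, DerivBound m B φ → ‖T φ‖ ≤ C * B) : Dist 𝕜 U :=
  ContinuousLinearMap.toUniformConvergenceCLM _ _ _ ⟨T, continuous_of_bounds T h⟩

/-- A linear operator on test functions which maps functions supported in a compact set to functions
supported in a compact set, boundedly, is continuous. -/
theorem continuous_operator_of_bounds (M : 𝓓(U, 𝕜) →ₗ[𝕜] 𝓓(U, 𝕜))
    (h : ∀ K : Set ℝ, IsCompact K → K ⊆ U → ∃ L : Set ℝ, IsCompact L ∧ L ⊆ U ∧
      (∀ φ : 𝓓(U, 𝕜), Function.support φ ⊆ K → Function.support (M φ) ⊆ L) ∧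
      ∀ j : ℕ, ∃ (m : ℕ) (C : ℝ), ∀ φ : 𝓓(U, 𝕜), Function.support φ ⊆ K → ∀ B : ℝ,
        DerivBound m B φ → ∀ x, ‖iteratedDeriv j (M φ) x‖ ≤ C * B) :
    Continuous M := by
  rw [TestFunction.continuous_iff_continuous_comp]
  intro K hKU
  obtain ⟨L, hL, hLU, hsupp, hb⟩ := h K K.isCompact hKU
  let L' : Compacts ℝ := ⟨L, hL⟩
  have hLU' : (L' : Set ℝ) ⊆ U := hLU
  let Φ : 𝓓^{⊤}_{K}(ℝ, 𝕜) →L[𝕜] 𝓓^{⊤}_{L'}(ℝ, 𝕜) := ContDiffMapSupportedIn.mkCLM 𝕜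
    (fun f => M (TestFunction.ofSupportedIn hKU f))
    (fun f g x => by
      have : TestFunction.ofSupportedIn hKU (f + g) =
        TestFunction.ofSupportedIn hKU f + TestFunction.ofSupportedIn hKU g := rfl
      rw [this, map_add]; rfl)
    (fun c f x => by
      have : TestFunction.ofSupportedIn hKU (c • f) = c • TestFunction.ofSupportedIn hKU f := rfl
      rw [this, map_smul]; rfl)
    (fun f => (M _).contDiff)
    (fun f => Function.support_subset_iff'.1 (hsupp (TestFunction.ofSupportedIn hKU f)
      f.support_subset))
    (fun i _ => by
      obtain ⟨m, C, hC⟩ := hb i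
      refine ⟨Finset.Iic m, |C|, abs_nonneg _, fun f x _ => ?_⟩
      have h1 := derivBound_of_seminorm f m
      rw [norm_iteratedFDeriv_eq_norm_iteratedDeriv]
      exact (hC (TestFunction.ofSupportedIn hKU f) f.support_subset _ h1 x).trans
        (mul_le_mul_of_nonneg_right (le_abs_self C) h1.nonneg))
  have : M ∘ TestFunction.ofSupportedIn hKU = TestFunction.ofSupportedIn hLU' ∘ Φ := by
    ext f x; rfl
  rw [this]
  exact (TestFunction.continuous_ofSupportedIn hLU').comp Φ.continuous

end Bounds

/-! ### Null sequences and compact sets of test functions. -/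

section Sequences

variable {U : Opens ℝ}

/-- A sequence of test functions supported in `K` all of whose derivatives tend to zero uniformly
tends to zero. -/
theorem tendsto_zero_of_derivBound {K : Set ℝ} (hK : IsCompact K) (hKU : K ⊆ U)
    (φ : ℕ → 𝓓(U, 𝕜)) (hφ : ∀ n, Function.support (φ n) ⊆ K) {b : ℕ → ℝ}
    (hb : Tendsto b atTop (𝓝 0)) (h : ∀ n, DerivBound n (b n) (φ n)) :
    Tendsto φ atTop (𝓝 0) := by
  let K' : Compacts ℝ := ⟨K, hK⟩
  have hKU' : (K' : Set ℝ) ⊆ U := hKU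
  have h0 : Tendsto (fun n => restrictTo (φ n) K' (hφ n)) atTop (𝓝 0) := by
    rw [(ContDiffMapSupportedIn.withSeminorms 𝕜 ℝ 𝕜 ⊤ K').tendsto_nhds]
    intro i ε hε
    filter_upwards [hb.eventually_lt_const hε, eventually_ge_atTop i] with n h1 h2
    rw [sub_zero]
    exact (seminorm_restrictTo_le (h n) h2).trans_lt h1
  have h1 := ((TestFunction.ofSupportedInCLM 𝕜 hKU').continuous.tendsto 0).comp h0
  rw [map_zero] at h1
  refine h1.congr fun n => ?_
  exact ofSupportedIn_restrictTo (φ n) K' hKU' (hφ n)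

theorem exists_derivBound (φ : 𝓓(U, 𝕜)) (m : ℕ) : ∃ B : ℝ, 0 < B ∧ DerivBound m B φ := by
  let K' : Compacts ℝ := ⟨tsupport φ, φ.hasCompactSupport⟩
  have h := derivBound_of_seminorm (restrictTo φ K' (subset_tsupport _)) m
  exact ⟨_, by have := h.nonneg; positivity, h.mono le_rfl (le_add_of_nonneg_right zero_le_one)⟩

/-- The functional `φ ↦ φ⁽ʲ⁾(y)`. -/
noncomputable def derivEval (U : Opens ℝ) (j : ℕ) (y : ℝ) : Dist 𝕜 U :=
  mkDist
    { toFun := fun φ => iteratedDeriv j φ y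
      map_add' := fun φ ψ => by
        have := iteratedDeriv_add (n := j) (x := y)
          ((TestFunction.contDiff_infty φ).of_le (mod_cast le_top)).contDiffAt
          ((TestFunction.contDiff_infty ψ).of_le (mod_cast le_top)).contDiffAt
        exact this
      map_smul' := fun c φ => by
        have := iteratedDeriv_const_smul (n := j) (x := y)
          ((TestFunction.contDiff_infty φ).of_le (mod_cast le_top)).contDiffAt c
        exact this }
    (fun _ _ _ => ⟨j, 1, fun φ _ B hB => by simpa using hB j le_rfl y⟩)

@[simp]
theorem derivEval_apply (j : ℕ) (y : ℝ) (φ : 𝓓(U, 𝕜)) :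
    derivEval U j y φ = iteratedDeriv j φ y := rfl

/-- Compact exhaustion of an open set. -/
theorem exists_exhaustion (U : Opens ℝ) : ∃ L : ℕ → Set ℝ, (∀ n, IsCompact (L n)) ∧
    (∀ n, L n ⊆ U) ∧ Monotone L ∧ ∀ K : Set ℝ, IsCompact K → K ⊆ U → ∃ n, K ⊆ L n := by
  let L : ℕ → Set ℝ := fun n => Metric.closedBall 0 n ∩
    {x | ((n : ENNReal) + 1)⁻¹ ≤ Metric.infEDist x (U : Set ℝ)ᶜ}
  have hmono : Monotone L := by
    intro m n hmn
    refine inter_subset_inter (Metric.closedBall_subset_closedBall (by exact_mod_cast hmn)) ?_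
    intro x hx
    rw [mem_ofPred_eq] at hx ⊢
    refine le_trans ?_ hx
    rw [ENNReal.inv_le_inv]
    gcongr
  refine ⟨L, fun n => ?_, fun n x hx => ?_, hmono, fun K hK hKU => ?_⟩
  · exact (isCompact_closedBall _ _).inter_right
      (isClosed_le continuous_const Metric.continuous_infEDist)
  · by_contra hxU
    have h1 : Metric.infEDist x (U : Set ℝ)ᶜ = 0 := Metric.infEDist_zero_of_mem hxU
    have h2 : ((n : ENNReal) + 1)⁻¹ ≤ Metric.infEDist x (U : Set ℝ)ᶜ := hx.2
    rw [h1] at h2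
    simp at h2
  · obtain ⟨r, hr⟩ := hK.isBounded.subset_closedBall 0
    obtain ⟨δ, hδ, hd⟩ := hK.exists_cthickening_subset_open U.isOpen hKU
    obtain ⟨n1, hn1⟩ := exists_nat_ge r
    obtain ⟨n2, hn2⟩ := exists_nat_ge δ⁻¹
    refine ⟨max n1 n2, fun x hx => ⟨?_, ?_⟩⟩
    · exact Metric.closedBall_subset_closedBall (hn1.trans (by simp)) (hr hx)
    · rw [mem_ofPred_eq]
      have h1 : ENNReal.ofReal δ ≤ Metric.infEDist x (U : Set ℝ)ᶜ := by
        refine Metric.le_infEDist.2 fun y hy => ?_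
        by_contra hlt
        push Not at hlt
        refine hy (hd ?_)
        rw [Metric.mem_cthickening_iff]
        refine (Metric.infEDist_le_edist_of_mem hx).trans ?_
        rw [edist_comm]; exact hlt.le
      refine le_trans ?_ h1
      have h2 : δ⁻¹ ≤ ((max n1 n2 : ℕ) : ℝ) + 1 := by
        refine hn2.trans ?_
        have : (n2 : ℝ) ≤ ((max n1 n2 : ℕ) : ℝ) := by exact_mod_cast le_max_right _ _
        linarith
      have h3 : (((max n1 n2 : ℕ) : ENNReal) + 1)⁻¹ =
          ENNReal.ofReal ((((max n1 n2 : ℕ) : ℝ) + 1)⁻¹) := by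
        rw [ENNReal.ofReal_inv_of_pos (by positivity), ENNReal.ofReal_add (by positivity) zero_le_one,
          ENNReal.ofReal_natCast, ENNReal.ofReal_one]
      rw [h3]
      refine ENNReal.ofReal_le_ofReal ?_
      exact inv_le_of_inv_le₀ hδ h2

/-- The elements of a compact set of test functions have a common compact support. -/
theorem exists_support_subset_of_isCompact {C : Set 𝓓(U, 𝕜)} (hC : IsCompact C) :
    ∃ L : Set ℝ, IsCompact L ∧ L ⊆ U ∧ ∀ φ ∈ C, Function.support φ ⊆ L := by
  obtain ⟨L, hL, hLU, hmono, hex⟩ := exists_exhaustion U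
  by_contra hcon
  have h1 : ∀ n, ∃ φ ∈ C, ∃ x, φ x ≠ 0 ∧ x ∉ L n := by
    intro n
    by_contra h
    push Not at h
    exact hcon ⟨L n, hL n, hLU n, fun φ hφ x hx => h φ hφ x hx⟩
  choose φ hφC x hx hxL using h1
  have hfin : ∀ ψ : 𝓓(U, 𝕜), ∀ N, tsupport ψ ⊆ L N → ∀ n ≥ N, ψ (x n) = 0 := by
    intro ψ N hN n hn
    by_contra h
    exact hxL n (hmono hn (hN (subset_tsupport _ h)))
  -- The weights make the `n`-th coordinate of `φ n` equal to `n`, so `ψ ↦ (a n * ψ (x n))ₙ` is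
  -- unbounded on `C`. It is nevertheless a continuous map into bounded sequences, since only
  -- finitely many `x n` lie in a given compact subset of `U`.
  let a : ℕ → 𝕜 := fun n => (n : 𝕜) * (φ n (x n))⁻¹
  have hbd : ∀ (N n : ℕ) (ψ : 𝓓(U, 𝕜)) (B : ℝ), tsupport ψ ⊆ L N → (∀ y, ‖ψ y‖ ≤ B) →
      ‖a n * ψ (x n)‖ ≤ (∑ k ∈ Finset.range N, ‖a k‖) * B := by
    intro N n ψ B hN hB
    have hB0 : 0 ≤ B := (norm_nonneg _).trans (hB 0)
    rcases lt_or_ge n N with h | h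
    · rw [norm_mul]
      refine mul_le_mul ?_ (hB _) (norm_nonneg _) (Finset.sum_nonneg fun _ _ => norm_nonneg _)
      exact Finset.single_le_sum (f := fun k => ‖a k‖) (fun _ _ => norm_nonneg _)
        (Finset.mem_range.2 h)
    · rw [hfin ψ N hN n h, mul_zero, norm_zero]
      exact mul_nonneg (Finset.sum_nonneg fun _ _ => norm_nonneg _) hB0
  have hbd' : ∀ ψ : 𝓓(U, 𝕜), ∃ D, ∀ n, ‖a n * ψ (x n)‖ ≤ D := by
    intro ψ
    obtain ⟨N, hN⟩ := hex (tsupport ψ) ψ.hasCompactSupport ψ.tsupport_subset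
    obtain ⟨B, -, hB⟩ := exists_derivBound ψ 0
    exact ⟨_, fun n => hbd N n ψ B hN fun y => by simpa using hB 0 le_rfl y⟩
  let Q : 𝓓(U, 𝕜) →ₗ[𝕜] (BoundedContinuousFunction ℕ 𝕜) :=
    { toFun := fun ψ => BoundedContinuousFunction.ofNormedAddCommGroupDiscrete
        (fun n => a n * ψ (x n)) (hbd' ψ).choose (hbd' ψ).choose_spec
      map_add' := fun ψ χ => by
        ext n
        exact mul_add _ _ _
      map_smul' := fun c ψ => by
        ext n
        exact mul_left_comm _ _ _ }
  have hQ : Continuous Q := by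
    refine continuous_of_bounds Q fun K hK hKU => ?_
    obtain ⟨N, hN⟩ := hex K hK hKU
    refine ⟨0, ∑ k ∈ Finset.range N, ‖a k‖, fun ψ hψ B hB => ?_⟩
    refine (BoundedContinuousFunction.norm_le
      (mul_nonneg (Finset.sum_nonneg fun _ _ => norm_nonneg _) hB.nonneg)).2 fun n => ?_
    exact hbd N n ψ B ((closure_minimal hψ hK.isClosed).trans hN)
      fun y => by simpa using hB 0 le_rfl y
  obtain ⟨D, hD⟩ := ((hC.image hQ).isBounded).exists_norm_le
  obtain ⟨n, hn⟩ := exists_nat_gt D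
  have h2 := hD _ ⟨φ n, hφC n, rfl⟩
  have h3 : ‖a n * φ n (x n)‖ ≤ ‖Q (φ n)‖ := BoundedContinuousFunction.norm_coe_le_norm (Q (φ n)) n
  have h4 : a n * φ n (x n) = n := by simp [a, hx n]
  rw [h4, RCLike.norm_natCast] at h3
  linarith

/-- Derivatives of a fixed order are uniformly bounded on a compact set of test functions. -/
theorem exists_bound_of_isCompact {C : Set 𝓓(U, 𝕜)} (hC : IsCompact C) (j : ℕ) :
    ∃ B : ℝ, 0 ≤ B ∧ ∀ φ ∈ C, ∀ x, ‖iteratedDeriv j φ x‖ ≤ B := by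
  have hbd : ∀ ψ : 𝓓(U, 𝕜), ∃ D, ∀ y, ‖iteratedDeriv j ψ y‖ ≤ D := fun ψ => by
    obtain ⟨B, -, hB⟩ := exists_derivBound ψ j
    exact ⟨B, hB j le_rfl⟩
  let Q : 𝓓(U, 𝕜) →ₗ[𝕜] (BoundedContinuousFunction ℝ 𝕜) :=
    { toFun := fun ψ => BoundedContinuousFunction.ofNormedAddCommGroup
        (iteratedDeriv j ψ) ((TestFunction.contDiff_infty ψ).continuous_iteratedDeriv j
          (mod_cast le_top)) (hbd ψ).choose (hbd ψ).choose_spec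
      map_add' := fun ψ χ => by
        ext n
        exact (derivEval (𝕜 := 𝕜) U j n).map_add ψ χ
      map_smul' := fun c ψ => by
        ext n
        exact (derivEval (𝕜 := 𝕜) U j n).map_smul c ψ }
  have hQ : Continuous Q := by
    refine continuous_of_bounds Q fun K hK hKU => ⟨j, 1, fun ψ hψ B hB => ?_⟩
    rw [one_mul]
    exact (BoundedContinuousFunction.norm_le hB.nonneg).2 fun n => hB j le_rfl n
  obtain ⟨D, hD⟩ := ((hC.image hQ).isBounded).exists_norm_le
  refine ⟨|D|, abs_nonneg _, fun φ hφ x => ?_⟩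
  exact (BoundedContinuousFunction.norm_coe_le_norm (Q φ) x).trans
    ((hD _ ⟨φ, hφ, rfl⟩).trans (le_abs_self D))

end Sequences

end HadamardOp

namespace HadamardOp

open Set Filter Topology
open scoped ContDiff

variable {𝕜 : Type*} [RCLike 𝕜]

/-- A linear functional dominated by the norm of a linear map factors continuously through it. -/
theorem exists_factorization_of_le {V B : Type*} [AddCommGroup V] [Module 𝕜 V]
    [NormedAddCommGroup B] [NormedSpace 𝕜 B] (r : V →ₗ[𝕜] B) (f : V →ₗ[𝕜] 𝕜) (C : ℝ)
    (h : ∀ v, ‖f v‖ ≤ C * ‖r v‖) : ∃ F : B →L[𝕜] 𝕜, ∀ v, F (r v) = f v := by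
  have hk : LinearMap.ker r ≤ LinearMap.ker f := by
    intro v hv
    rw [LinearMap.mem_ker] at hv ⊢
    have := h v
    rw [hv, norm_zero, mul_zero] at this
    exact norm_le_zero_iff.1 this
  let g : LinearMap.range r →ₗ[𝕜] 𝕜 :=
    ((LinearMap.ker r).liftQ f hk) ∘ₗ r.quotKerEquivRange.symm.toLinearMap
  have hg : ∀ v (hv : r v ∈ LinearMap.range r), g ⟨r v, hv⟩ = f v := by
    intro v hv
    simp only [g, LinearMap.comp_apply, LinearEquiv.coe_coe]
    rw [LinearMap.quotKerEquivRange_symm_apply_image, Submodule.mkQ_apply, Submodule.liftQ_apply]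
  obtain ⟨F, hF, -⟩ := exists_extension_norm_eq (LinearMap.range r) (g.mkContinuous C (by
    rintro ⟨w, hw⟩
    obtain ⟨v, rfl⟩ := LinearMap.mem_range.1 hw
    exact (congrArg norm (hg v hw)).le.trans (h v)))
  exact ⟨F, fun v => (hF ⟨r v, LinearMap.mem_range_self r v⟩).trans (hg v _)⟩

/-! ### Representing functionals dominated by `L¹` norms. -/

section Duality

variable {μ : Measure ℝ} [IsFiniteMeasure μ]

/-- Continuous functionals on `L¹` of a finite measure are given by bounded functions. -/
theorem exists_density_of_functional (F : Lp 𝕜 1 μ →L[𝕜] 𝕜) :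
    ∃ s : ℝ → 𝕜, StronglyMeasurable s ∧ (∀ x, ‖s x‖ ≤ ‖F‖) ∧
      ∀ f : ℝ → 𝕜, ∀ hf : MemLp f ⊤ μ,
        F ((hf.integrable le_top).toL1 f) = ∫ x, s x * f x ∂μ := by
  have hint : ∀ f : Lp 𝕜 2 μ, Integrable f μ := fun f => (Lp.memLp f).integrable one_le_two
  let G₀ : Lp 𝕜 2 μ →ₗ[𝕜] 𝕜 :=
    { toFun := fun f => F ((hint f).toL1 f)
      map_add' := fun f g => by
        rw [← map_add, ← Integrable.toL1_add]
        congr 1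
        exact Integrable.toL1_eq_toL1_iff _ _ _ _ |>.2 (Lp.coeFn_add f g)
      map_smul' := fun c f => by
        rw [RingHom.id_apply, ← map_smul, ← Integrable.toL1_smul']
        congr 1
        exact Integrable.toL1_eq_toL1_iff _ _ _ _ |>.2 (Lp.coeFn_smul c f) }
  -- The norm of the inclusion of `L²` into `L¹` for a finite measure.
  let D : ℝ := (μ univ ^ (1 / (1 : ENNReal).toReal - 1 / (2 : ENNReal).toReal)).toReal
  have hG₀ : ∀ f, ‖G₀ f‖ ≤ (‖F‖ * D) * ‖f‖ := by
    intro f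
    refine (F.le_opNorm _).trans ?_
    rw [mul_assoc]
    refine mul_le_mul_of_nonneg_left ?_ (norm_nonneg _)
    have h1 := eLpNorm_le_eLpNorm_mul_rpow_measure_univ (μ := μ) one_le_two
      (Lp.aestronglyMeasurable f)
    have h2 : ‖(hint f).toL1 f‖ = (eLpNorm f 1 μ).toReal := by
      rw [Integrable.norm_toL1_eq_lintegral_enorm, eLpNorm_one_eq_lintegral_enorm]
    rw [h2, mul_comm D, Lp.norm_def, ← ENNReal.toReal_mul]
    refine ENNReal.toReal_mono (ENNReal.mul_ne_top (Lp.eLpNorm_ne_top f) ?_) h1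
    exact ENNReal.rpow_ne_top_of_nonneg (by norm_num) (measure_ne_top _ _)
  let G : Lp 𝕜 2 μ →L[𝕜] 𝕜 := G₀.mkContinuous _ hG₀
  -- Riesz representation in `L²`; the inner product is conjugate linear in `g`, whence the
  -- conjugate in `s₀`.
  let g : Lp 𝕜 2 μ := (InnerProductSpace.toDual 𝕜 (Lp 𝕜 2 μ)).symm G
  let s₀ : ℝ → 𝕜 := fun x => (starRingEnd 𝕜) (g x)
  have hs₀ : StronglyMeasurable s₀ :=
    RCLike.continuous_conj.comp_stronglyMeasurable (Lp.stronglyMeasurable g)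
  have hrep : ∀ f : ℝ → 𝕜, ∀ hf : MemLp f ⊤ μ,
      F ((hf.integrable le_top).toL1 f) = ∫ x, s₀ x * f x ∂μ := by
    intro f hf
    have hf2 : MemLp f 2 μ := hf.mono_exponent le_top
    have h1 : G (hf2.toLp f) = F ((hf.integrable le_top).toL1 f) := by
      change F ((hint (hf2.toLp f)).toL1 _) = _
      congr 1
      exact Integrable.toL1_eq_toL1_iff _ _ _ _ |>.2 hf2.coeFn_toLp
    have h2 : inner 𝕜 g (hf2.toLp f) = G (hf2.toLp f) :=
      InnerProductSpace.toDual_symm_apply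
    rw [← h1, ← h2, L2.inner_def]
    refine integral_congr_ae ?_
    filter_upwards [hf2.coeFn_toLp] with x hx
    rw [hx, RCLike.inner_apply, mul_comm]
  -- Testing `F` against the conjugate phase of `s₀` on `A` gives `∫_A ‖s₀‖ ≤ ‖F‖ μ(A)`, although
  -- `‖s₀‖ > ‖F‖` on `A`. Hence `A` is a null set and the density may be replaced by zero there.
  let A : Set ℝ := {x | ‖F‖ < ‖s₀ x‖}
  have hA : MeasurableSet A := measurableSet_lt measurable_const hs₀.norm.measurable
  have hs₀i : Integrable s₀ μ := by
    have : Integrable (fun x => g x) μ := hint g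
    exact this.norm.mono' hs₀.aestronglyMeasurable (ae_of_all _ fun x => by simp [s₀])
  have hμA : μ A = 0 := by
    let f : ℝ → 𝕜 := A.indicator fun x => (starRingEnd 𝕜) (s₀ x) / (‖s₀ x‖ : 𝕜)
    have hfb : ∀ x, ‖f x‖ ≤ A.indicator 1 x := by
      intro x
      by_cases hx : x ∈ A
      · simp only [f, indicator_of_mem hx, norm_div, RCLike.norm_conj, RCLike.norm_ofReal, abs_norm,
          Pi.one_apply]
        exact div_self_le_one _
      · simp [f, indicator_of_notMem hx]
    have hfm : AEStronglyMeasurable f μ := by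
      refine StronglyMeasurable.aestronglyMeasurable (StronglyMeasurable.indicator ?_ hA)
      exact (RCLike.continuous_conj.comp_stronglyMeasurable hs₀).div
        (RCLike.continuous_ofReal.comp_stronglyMeasurable hs₀.norm)
    have hf : MemLp f ⊤ μ := memLp_top_of_bound hfm 1 (ae_of_all _ fun x => (hfb x).trans
      (indicator_le_self' (fun _ _ => zero_le_one) x))
    have h1 := hrep f hf
    have h2 : ∀ x, s₀ x * f x = ((A.indicator (fun x => ‖s₀ x‖) x : ℝ) : 𝕜) := by
      intro x
      by_cases hx : x ∈ A
      · have hne : ((‖s₀ x‖ : ℝ) : 𝕜) ≠ 0 := by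
          rw [Ne, RCLike.ofReal_eq_zero]
          exact (lt_of_le_of_lt (norm_nonneg _) (show ‖F‖ < ‖s₀ x‖ from hx)).ne'
        simp only [f, indicator_of_mem hx]
        rw [← mul_div_assoc, RCLike.mul_conj, sq, mul_div_assoc, div_self hne, mul_one]
      · simp [f, indicator_of_notMem hx]
    simp_rw [h2] at h1
    rw [integral_ofReal, integral_indicator hA] at h1
    have h3 : ‖F ((hf.integrable le_top).toL1 f)‖ ≤ ∫ x in A, ‖F‖ ∂μ := by
      refine (F.le_opNorm _).trans ?_
      rw [L1.norm_of_fun_eq_integral_norm, setIntegral_const, smul_eq_mul, mul_comm]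
      refine mul_le_mul_of_nonneg_right ?_ (norm_nonneg _)
      calc ∫ x, ‖f x‖ ∂μ ≤ ∫ x, A.indicator 1 x ∂μ :=
            integral_mono (hf.integrable le_top).norm
              ((integrable_const (1 : ℝ)).indicator hA) hfb
        _ = μ.real A := by rw [integral_indicator_one hA]
    rw [h1, RCLike.norm_ofReal, abs_of_nonneg (integral_nonneg fun _ => norm_nonneg _)] at h3
    have h4 : ∫ x in A, (‖s₀ x‖ - ‖F‖) ∂μ = 0 := by
      refine le_antisymm ?_ (setIntegral_nonneg hA fun x hx => sub_nonneg.2 (le_of_lt hx))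
      rw [integral_sub hs₀i.norm.integrableOn (integrable_const _)]
      linarith
    have h5 := (setIntegral_eq_zero_iff_of_nonneg_ae (s := A) (f := fun x => ‖s₀ x‖ - ‖F‖)
      ((ae_restrict_iff' hA).2 (ae_of_all _ fun x hx => sub_nonneg.2 (le_of_lt hx)))
      (hs₀i.norm.sub (integrable_const _)).integrableOn).1 h4
    have h6 : ∀ᵐ x ∂μ, x ∉ A := by
      filter_upwards [(ae_restrict_iff' hA).1 h5] with x hx hxA
      have := hx hxA
      have h7 : ‖F‖ < ‖s₀ x‖ := hxA
      simp only [Pi.zero_apply] at this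
      linarith
    simpa [ae_iff] using h6
  refine ⟨Aᶜ.indicator s₀, hs₀.indicator hA.compl, fun x => ?_, fun f hf => ?_⟩
  · by_cases hx : x ∈ A
    · simp [indicator, hx]
    · rw [indicator_of_mem (show x ∈ Aᶜ from hx)]
      exact not_lt.1 hx
  · rw [hrep f hf]
    refine integral_congr_ae ?_
    have : ∀ᵐ x ∂μ, x ∉ A := by simpa [ae_iff] using hμA
    filter_upwards [this] with x hx
    rw [indicator_of_mem (show x ∈ Aᶜ from hx)]

/-- A functional dominated by `L¹` norms of finitely many operators is a sum of integrals against
bounded densities. -/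
theorem exists_L1_representation {V : Type*} [AddCommGroup V] [Module 𝕜 V] {N : ℕ}
    (D : Fin N → V →ₗ[𝕜] (ℝ → 𝕜)) (hD : ∀ i v, MemLp (D i v) ⊤ μ) (Λ : V →ₗ[𝕜] 𝕜) (C : ℝ)
    (hC : 0 ≤ C) (h : ∀ v, ‖Λ v‖ ≤ C * ∑ i, ∫ x, ‖D i v x‖ ∂μ) :
    ∃ (s : Fin N → ℝ → 𝕜) (B : ℝ), (∀ i, StronglyMeasurable (s i)) ∧ (∀ i x, ‖s i x‖ ≤ B) ∧
      ∀ v, Λ v = ∑ i, ∫ x, s i x * D i v x ∂μ := by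
  have hi : ∀ i v, Integrable (D i v) μ := fun i v => (hD i v).integrable le_top
  let r : V →ₗ[𝕜] (Fin N → Lp 𝕜 1 μ) :=
    { toFun := fun v i => (hi i v).toL1 (D i v)
      map_add' := fun v w => by
        ext1 i
        rw [Pi.add_apply, ← Integrable.toL1_add]
        congr 1
        exact map_add _ _ _
      map_smul' := fun c v => by
        ext1 i
        rw [RingHom.id_apply, Pi.smul_apply, ← Integrable.toL1_smul']
        congr 1
        exact map_smul _ _ _ }
  -- The product of the `L¹` spaces carries the maximum norm, which costs the factor `N`. The
  -- components of `F` are then functionals on single copies of `L¹`.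
  obtain ⟨F, hF⟩ := exists_factorization_of_le r Λ (C * N) (fun v => by
    refine (h v).trans ?_
    rw [mul_assoc]
    refine mul_le_mul_of_nonneg_left ?_ hC
    calc ∑ i, ∫ x, ‖D i v x‖ ∂μ = ∑ i, ‖r v i‖ :=
          Finset.sum_congr rfl fun i _ => (L1.norm_of_fun_eq_integral_norm (hi i v)).symm
      _ ≤ ∑ _i : Fin N, ‖r v‖ := Finset.sum_le_sum fun i _ => norm_le_pi_norm (r v) i
      _ = N * ‖r v‖ := by simp)
  have hFi := fun i : Fin N => exists_density_of_functional (μ := μ)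
    (F.comp (ContinuousLinearMap.single 𝕜 (fun _ : Fin N => Lp 𝕜 1 μ) i))
  choose s hs hsb hrep using hFi
  refine ⟨s, ∑ i, ‖F.comp (ContinuousLinearMap.single 𝕜 (fun _ : Fin N => Lp 𝕜 1 μ) i)‖, hs,
    fun i x => (hsb i x).trans (Finset.single_le_sum
      (f := fun i => ‖F.comp (ContinuousLinearMap.single 𝕜 (fun _ : Fin N => Lp 𝕜 1 μ) i)‖)
      (fun _ _ => norm_nonneg _) (Finset.mem_univ i)), fun v => ?_⟩
  rw [← hF v]
  conv_lhs => rw [← Finset.univ_sum_single (r v), map_sum]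
  refine Finset.sum_congr rfl fun i _ => ?_
  rw [← hrep i (D i v) (hD i v)]
  rfl

end Duality

/-- Sup norms are traded for `L¹` norms at the price of one derivative, since `L¹` norms are what
duality can represent. -/
theorem norm_le_integral_norm_deriv {h : ℝ → 𝕜} (h1 : ContDiff ℝ 1 h) (h2 : HasCompactSupport h)
    (x : ℝ) : ‖h x‖ ≤ ∫ y, ‖deriv h y‖ := by
  rw [← h2.integral_Iic_deriv_eq h1 x]
  refine (norm_integral_le_integral_norm _).trans ?_
  exact setIntegral_le_integral
    ((h1.continuous_deriv le_rfl).integrable_of_hasCompactSupport h2.deriv).norm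
    (ae_of_all _ fun _ => norm_nonneg _)

theorem _root_.HasCompactSupport.iteratedDeriv' {f : ℝ → 𝕜} (hf : HasCompactSupport f) (n : ℕ) :
    HasCompactSupport (iteratedDeriv n f) := by
  induction n with
  | zero => simpa using hf
  | succ n ih => rw [iteratedDeriv_succ]; exact ih.deriv

theorem support_iteratedDeriv_subset (f : ℝ → 𝕜) (n : ℕ) :
    Function.support (iteratedDeriv n f) ⊆ tsupport f := by
  intro x hx
  refine support_iteratedFDeriv_subset (𝕜 := ℝ) n ?_
  rw [Function.mem_support] at hx ⊢
  rwa [Ne, ← norm_eq_zero, norm_iteratedFDeriv_eq_norm_iteratedDeriv, norm_eq_zero]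

/-- The derivatives of `κ φ` are dominated by `L¹` norms of derivatives of `φ` over the support of
the cutoff `κ`. -/
theorem exists_localization_bound {κ : ℝ → 𝕜} (hκ : ContDiff ℝ ∞ κ) (hκs : HasCompactSupport κ)
    (m : ℕ) : ∃ C : ℝ, 0 ≤ C ∧ ∀ φ : ℝ → 𝕜, ContDiff ℝ ∞ φ →
      DerivBound m (C * ∑ i ∈ Finset.range (m + 2), ∫ x in tsupport κ, ‖iteratedDeriv i φ x‖)
        (fun x => κ x * φ x) := by
  have hb : ∀ i, ∃ B, ∀ x, ‖iteratedDeriv i κ x‖ ≤ B := fun i =>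
    (hκ.continuous_iteratedDeriv i (mod_cast le_top)).bounded_above_of_compact_support
      (hκs.iteratedDeriv' i)
  choose B hB using hb
  have hB0 : ∀ i, 0 ≤ B i := fun i => (norm_nonneg _).trans (hB i 0)
  let D : ℝ := ∑ i ∈ Finset.range (m + 2), B i
  have hD0 : 0 ≤ D := Finset.sum_nonneg fun i _ => hB0 i
  -- `D` bounds the derivatives of `κ` up to order `m + 1`, and `2 ^ (m + 1)` bounds the sum of the
  -- binomial coefficients in the Leibniz rule. The order `m + 1` arises from the derivative lost in
  -- passing to `L¹`.
  refine ⟨2 ^ (m + 1) * D, by positivity, fun φ hφ j hj x => ?_⟩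
  have hg : ContDiff ℝ ∞ (fun x => κ x * φ x) := hκ.mul hφ
  have hgs : HasCompactSupport (fun x => κ x * φ x) := hκs.mul_right
  have h1 := norm_le_integral_norm_deriv (h := iteratedDeriv j (fun x => κ x * φ x))
    (by rw [iteratedDeriv_eq_iterate]; exact (hg.iterate_deriv j).of_le (mod_cast le_top))
    (hgs.iteratedDeriv' j) x
  refine h1.trans ?_
  have hcont : ∀ i, Continuous (fun x => ‖iteratedDeriv i φ x‖) := fun i =>
    (hφ.continuous_iteratedDeriv i (mod_cast le_top)).norm
  have hint : ∀ i, IntegrableOn (fun x => ‖iteratedDeriv i φ x‖) (tsupport κ) := fun i =>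
    (hcont i).continuousOn.integrableOn_compact hκs
  have hpt : ∀ y ∈ tsupport κ, ‖iteratedDeriv (j + 1) (fun x => κ x * φ x) y‖ ≤
      2 ^ (m + 1) * D * ∑ i ∈ Finset.range (m + 2), ‖iteratedDeriv i φ y‖ := by
    intro y _
    have h2 := norm_iteratedFDeriv_mul_le (𝕜 := ℝ) (n := j + 1) hκ hφ y (mod_cast le_top)
    simp only [norm_iteratedFDeriv_eq_norm_iteratedDeriv] at h2
    refine h2.trans ?_
    have h3 : ∀ i ∈ Finset.range (j + 1 + 1), ((j + 1).choose i : ℝ) * ‖iteratedDeriv i κ y‖ *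
        ‖iteratedDeriv (j + 1 - i) φ y‖ ≤ ((j + 1).choose i : ℝ) * (D *
          ∑ i ∈ Finset.range (m + 2), ‖iteratedDeriv i φ y‖) := by
      intro i hi
      rw [Finset.mem_range] at hi
      rw [mul_assoc]
      refine mul_le_mul_of_nonneg_left ?_ (by positivity)
      refine mul_le_mul ((hB i y).trans ?_) ?_ (norm_nonneg _) hD0
      · exact Finset.single_le_sum (f := B) (fun i _ => hB0 i) (Finset.mem_range.2 (by omega))
      · exact Finset.single_le_sum (f := fun i => ‖iteratedDeriv i φ y‖)
          (fun i _ => norm_nonneg _) (Finset.mem_range.2 (by omega))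
    refine (Finset.sum_le_sum h3).trans ?_
    rw [← Finset.sum_mul, ← Nat.cast_sum, Nat.sum_range_choose, mul_assoc]
    push_cast
    refine mul_le_mul_of_nonneg_right ?_
      (mul_nonneg hD0 (Finset.sum_nonneg fun _ _ => norm_nonneg _))
    exact pow_le_pow_right₀ one_le_two (by omega)
  have hzero : ∀ y ∉ tsupport κ, ‖iteratedDeriv (j + 1) (fun x => κ x * φ x) y‖ = 0 := by
    intro y hy
    rw [norm_eq_zero]
    by_contra h
    have h3 := support_iteratedDeriv_subset (fun x => κ x * φ x) (j + 1) h
    exact hy (closure_mono (Function.support_mul_subset_left _ _) h3)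
  rw [← iteratedDeriv_succ]
  calc ∫ y, ‖iteratedDeriv (j + 1) (fun x => κ x * φ x) y‖
      = ∫ y in tsupport κ, ‖iteratedDeriv (j + 1) (fun x => κ x * φ x) y‖ :=
        (setIntegral_eq_integral_of_forall_compl_eq_zero hzero).symm
    _ ≤ ∫ y in tsupport κ, 2 ^ (m + 1) * D * ∑ i ∈ Finset.range (m + 2), ‖iteratedDeriv i φ y‖ := by
        refine setIntegral_mono_on ?_ ?_ (isClosed_tsupport κ).measurableSet hpt
        · exact (hg.continuous_iteratedDeriv _ (mod_cast le_top)).norm.continuousOn.integrableOn_compact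
            hκs
        · exact (integrable_finsetSum _ fun i _ => hint i).const_mul _
    _ = _ := by rw [integral_const_mul, integral_finsetSum _ fun i _ => hint i]

end HadamardOp

namespace HadamardOp

open Set Filter Topology
open scoped ContDiff Manifold

variable {𝕜 : Type*} [RCLike 𝕜]

variable (𝕜) in
theorem contDiff_ofReal {n : WithTop ℕ∞} : ContDiff ℝ n (fun x : ℝ => (x : 𝕜)) :=
  (RCLike.ofRealCLM (K := 𝕜)).contDiff

variable (𝕜) in
/-- A smooth cutoff function equal to one near a compact subset of an open set. -/
theorem exists_cutoff {L : Set ℝ} (hL : IsCompact L) (U : Opens ℝ) (hLU : L ⊆ U) :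
    ∃ κ : ℝ → 𝕜, ContDiff ℝ ∞ κ ∧ HasCompactSupport κ ∧ tsupport κ ⊆ U ∧
      ∃ V, IsOpen V ∧ L ⊆ V ∧ ∀ x ∈ V, κ x = 1 := by
  obtain ⟨t, ht, hLt, htU⟩ := exists_compact_between hL U.isOpen hLU
  obtain ⟨f, h1, h0, -⟩ := exists_contMDiffMap_one_nhds_of_subset_interior (n := ⊤) 𝓘(ℝ, ℝ)
    hL.isClosed hLt
  obtain ⟨V, hV, hLV, hV1⟩ := mem_nhdsSet_iff_exists.1 h1
  have hs : Function.support (fun x => ((f x : ℝ) : 𝕜)) ⊆ t := by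
    intro x hx
    by_contra hxt
    exact hx (by simp [h0 x hxt])
  have hts := closure_minimal hs ht.isClosed
  refine ⟨fun x => ((f x : ℝ) : 𝕜), ?_, ht.of_isClosed_subset (isClosed_tsupport _) hts,
    hts.trans htU, V, hV, hLV, fun x hx => ?_⟩
  · exact (contDiff_ofReal 𝕜).comp (contMDiff_iff_contDiff.1 f.contMDiff)
  · have h2 : f x = 1 := hV1 hx
    simp [h2]

/-! ### Local structure of distributions: finite sums of derivatives of bounded functions. -/

section Product

variable {U : Opens ℝ}

/-- Multiplication of test functions by a smooth function. -/
noncomputable def mulTest (κ : ℝ → 𝕜) (hκ : ContDiff ℝ ∞ κ) : 𝓓(U, 𝕜) →ₗ[𝕜] 𝓓(U, 𝕜) where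
  toFun φ := ⟨fun x => κ x * φ x, hκ.mul φ.contDiff, φ.hasCompactSupport.mul_left,
    (closure_mono (Function.support_mul_subset_right _ _)).trans φ.tsupport_subset⟩
  map_add' φ ψ := by ext x; exact mul_add _ _ _
  map_smul' c φ := by ext x; exact mul_left_comm _ _ _

@[simp]
theorem mulTest_apply (κ : ℝ → 𝕜) (hκ : ContDiff ℝ ∞ κ) (φ : 𝓓(U, 𝕜)) (x : ℝ) :
    mulTest κ hκ φ x = κ x * φ x := rfl

/-- The `i`-th derivative as a linear map. -/
noncomputable def derivLM (U : Opens ℝ) (i : ℕ) : 𝓓(U, 𝕜) →ₗ[𝕜] (ℝ → 𝕜) where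
  toFun φ := iteratedDeriv i φ
  map_add' φ ψ := funext fun x => (derivEval (𝕜 := 𝕜) U i x).map_add φ ψ
  map_smul' c φ := funext fun x => (derivEval (𝕜 := 𝕜) U i x).map_smul c φ

@[simp]
theorem derivLM_apply (i : ℕ) (φ : 𝓓(U, 𝕜)) : derivLM U i φ = iteratedDeriv i φ := rfl

theorem continuous_iteratedDeriv_test (φ : 𝓓(U, 𝕜)) (i : ℕ) : Continuous (iteratedDeriv i φ) :=
  (TestFunction.contDiff_infty φ).continuous_iteratedDeriv i (mod_cast le_top)

theorem memLp_iteratedDeriv_test (φ : 𝓓(U, 𝕜)) (i : ℕ) (μ : Measure ℝ) :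
    MemLp (iteratedDeriv i φ) ⊤ μ := by
  obtain ⟨B, -, hB⟩ := exists_derivBound φ i
  exact memLp_top_of_bound (continuous_iteratedDeriv_test φ i).aestronglyMeasurable B
    (ae_of_all _ fun x => hB i le_rfl x)

theorem hasDerivAt_iteratedDeriv {f : ℝ → 𝕜} (hf : ContDiff ℝ ∞ f) (j : ℕ) (x : ℝ) :
    HasDerivAt (iteratedDeriv j f) (iteratedDeriv (j + 1) f x) x := by
  rw [iteratedDeriv_succ]
  exact (hf.differentiable_iteratedDeriv j (mod_cast WithTop.coe_lt_top j) x).hasDerivAt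

/-- A distribution localized by a cutoff function is a sum of integrals of derivatives against
bounded functions over the support of the cutoff. -/
theorem exists_local_representation (S : Dist 𝕜 U) {κ : ℝ → 𝕜} (hκ : ContDiff ℝ ∞ κ)
    (hκs : HasCompactSupport κ) (hκU : tsupport κ ⊆ U) :
    ∃ (N : ℕ) (s : Fin N → ℝ → 𝕜) (B : ℝ), (∀ i, StronglyMeasurable (s i)) ∧
      (∀ i x, ‖s i x‖ ≤ B) ∧ ∀ φ : 𝓓(U, 𝕜), S (mulTest κ hκ φ) =
        ∑ i, ∫ x in tsupport κ, s i x * iteratedDeriv i φ x := by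
  obtain ⟨m, C, hC, hS⟩ := S.exists_bound hκs hκU
  obtain ⟨C', hC', hloc⟩ := exists_localization_bound hκ hκs m
  have : IsFiniteMeasure (volume.restrict (tsupport κ)) :=
    ⟨by rw [Measure.restrict_apply_univ]; exact hκs.measure_lt_top⟩
  let Λ : 𝓓(U, 𝕜) →ₗ[𝕜] 𝕜 :=
    ((ContinuousLinearMap.toUniformConvergenceCLM _ _ _).symm S).toLinearMap ∘ₗ mulTest κ hκ
  obtain ⟨s, B, hs, hB, hrep⟩ := exists_L1_representation (μ := volume.restrict (tsupport κ))
    (fun i : Fin (m + 2) => derivLM (𝕜 := 𝕜) U i)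
    (fun i φ => memLp_iteratedDeriv_test φ i _) Λ (C * C') (by positivity) (fun φ => by
      have h1 := hS (mulTest κ hκ φ) ((Function.support_mul_subset_left _ _).trans
        (subset_tsupport κ)) _ (hloc φ (TestFunction.contDiff_infty φ))
      rw [Finset.sum_range, ← mul_assoc] at h1
      exact h1)
  exact ⟨m + 2, s, B, hs, hB, hrep⟩

end Product

/-- This second-order Taylor bound is uniform over a compact set of test functions, so it makes `y ↦
(φ ↦ φ⁽ʲ⁾(y))` differentiable as a curve of continuous functions on that set. -/
theorem norm_sub_sub_le_of_deriv_bound {g g' g'' : ℝ → 𝕜} (h1 : ∀ x, HasDerivAt g (g' x) x)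
    (h2 : ∀ x, HasDerivAt g' (g'' x) x) {M : ℝ} (hM : ∀ x, ‖g'' x‖ ≤ M) (y z : ℝ) :
    ‖g z - g y - (z - y) • g' y‖ ≤ M * ‖z - y‖ ^ 2 := by
  have hM0 : 0 ≤ M := (norm_nonneg _).trans (hM 0)
  have h3 : ∀ t ∈ segment ℝ y z, ‖g' t - g' y‖ ≤ M * ‖z - y‖ := by
    intro t ht
    refine (convex_univ.norm_image_sub_le_of_norm_hasDerivWithin_le
      (fun x _ => (h2 x).hasDerivWithinAt) (fun x _ => hM x) (mem_univ y) (mem_univ t)).trans ?_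
    refine mul_le_mul_of_nonneg_left ?_ hM0
    rw [← dist_eq_norm, ← dist_eq_norm, dist_comm, dist_comm z]
    have := dist_add_dist_of_mem_segment ht
    linarith [dist_nonneg (x := t) (y := z)]
  have h4 : ∀ t, HasDerivAt (fun t => g t - t • g' y) (g' t - g' y) t := fun t => by
    have h := (h1 t).sub ((hasDerivAt_id t).smul_const (g' y))
    rw [one_smul] at h
    exact h
  have h5 := (convex_segment y z).norm_image_sub_le_of_norm_hasDerivWithin_le
    (fun t _ => (h4 t).hasDerivWithinAt) h3 (left_mem_segment ℝ y z) (right_mem_segment ℝ y z)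
  have h6 : g z - z • g' y - (g y - y • g' y) = g z - g y - (z - y) • g' y := by
    rw [sub_smul]; abel
  rw [h6] at h5
  rw [sq, ← mul_assoc]
  exact h5

theorem contDiff_of_hasDerivAt_seq {g : ℕ → ℝ → 𝕜}
    (h : ∀ j x, HasDerivAt (g j) (g (j + 1) x) x) : ContDiff ℝ ∞ (g 0) := by
  have h2 : ∀ n : ℕ, ∀ j, ContDiff ℝ n (g j) := by
    intro n
    induction n with
    | zero =>
      intro j
      exact contDiff_zero.2 (continuous_iff_continuousAt.2 fun x => (h j x).continuousAt)
    | succ n ih =>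
      intro j
      push_cast
      rw [contDiff_succ_iff_deriv]
      refine ⟨fun x => (h j x).differentiableAt, fun h => by simp at h, ?_⟩
      rw [show deriv (g j) = g (j + 1) from funext fun x => (h j x).deriv]
      exact ih _
  exact contDiff_infty.2 fun n => h2 n 0

theorem iteratedDeriv_of_hasDerivAt_seq {g : ℕ → ℝ → 𝕜}
    (h : ∀ j x, HasDerivAt (g j) (g (j + 1) x) x) (j : ℕ) : iteratedDeriv j (g 0) = g j := by
  induction j with
  | zero => simp
  | succ j ih =>
    rw [iteratedDeriv_succ, ih]
    exact funext fun x => (h j x).deriv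

/-! ### Reflexivity of the space of test functions and the transpose of an operator. -/

section Reflexivity

variable {U : Opens ℝ}

/-- A linear functional on distributions which is bounded by the supremum over a compact set of
test functions is the evaluation at a test function. -/
theorem exists_test_of_functional (f : Dist 𝕜 U →ₗ[𝕜] 𝕜) {C : Set 𝓓(U, 𝕜)} (hC : IsCompact C)
    (c : ℝ) (hf : ∀ (S : Dist 𝕜 U) (B : ℝ), 0 ≤ B → (∀ φ ∈ C, ‖S φ‖ ≤ B) → ‖f S‖ ≤ c * B) :
    ∃ ψ : 𝓓(U, 𝕜), ∀ S : Dist 𝕜 U, f S = S ψ := by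
  have : CompactSpace C := isCompact_iff_compactSpace.1 hC
  have hcont : ∀ S : Dist 𝕜 U, Continuous (fun φ : C => S φ.1) := fun S =>
    ((ContinuousLinearMap.toUniformConvergenceCLM _ _ _).symm S).continuous.comp
      continuous_subtype_val
  -- Distributions are viewed as continuous functions on `C`; `f` is dominated by the sup norm
  -- there, so Hahn–Banach extends it to a functional `F` on `C(C, 𝕜)`.
  let r : Dist 𝕜 U →ₗ[𝕜] C(C, 𝕜) :=
    { toFun := fun S => ⟨fun φ => S φ.1, hcont S⟩
      map_add' := fun S T => rfl
      map_smul' := fun a S => rfl }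
  obtain ⟨F, hF⟩ := exists_factorization_of_le r f c (fun S =>
    hf S ‖r S‖ (norm_nonneg _) fun φ hφ => ContinuousMap.norm_coe_le_norm (r S) ⟨φ, hφ⟩)
  obtain ⟨L, hL, hLU, hCL⟩ := exists_support_subset_of_isCompact hC
  choose M hM0 hM using fun j => exists_bound_of_isCompact hC j
  -- The test function sought must be `ψ(y) = f(δ_y) = F (e 0 y)`. It is smooth because `e 0` is a
  -- smooth curve with derivatives `e j`, and supported in `L` because all members of `C` are.
  let e : ℕ → ℝ → C(C, 𝕜) := fun j y => r (derivEval U j y)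
  have he : ∀ j y, ∀ φ : C, e j y φ = iteratedDeriv j φ.1 y := fun j y φ => rfl
  have hed : ∀ j y, HasDerivAt (e j) (e (j + 1) y) y := by
    intro j y
    rw [hasDerivAt_iff_isLittleO]
    refine Asymptotics.IsBigO.trans_isLittleO ?_
      (Asymptotics.isLittleO_pow_sub_sub y (one_lt_two))
    refine Asymptotics.IsBigO.of_bound (M (j + 2)) (Eventually.of_forall fun z => ?_)
    rw [norm_pow, norm_norm]
    refine (ContinuousMap.norm_le _ (mul_nonneg (hM0 _) (by positivity))).2 fun φ => ?_
    exact norm_sub_sub_le_of_deriv_bound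
      (hasDerivAt_iteratedDeriv (TestFunction.contDiff_infty φ.1) j)
      (hasDerivAt_iteratedDeriv (TestFunction.contDiff_infty φ.1) (j + 1)) (hM (j + 2) φ.1 φ.2) y z
  let g : ℕ → ℝ → 𝕜 := fun j y => F (e j y)
  have hg : ∀ j y, HasDerivAt (g j) (g (j + 1) y) y := fun j y =>
    ((F.restrictScalars ℝ).hasFDerivAt.comp_hasDerivAt y (hed j y))
  have hsupp : Function.support (g 0) ⊆ L := by
    intro y hy
    by_contra hyL
    refine hy ?_
    have h0 : e 0 y = 0 := by
      ext φ
      rw [he, iteratedDeriv_zero]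
      by_contra h
      exact hyL (hCL φ.1 φ.2 h)
    simp only [g, h0, map_zero]
  have hts : tsupport (g 0) ⊆ L := closure_minimal hsupp hL.isClosed
  let ψ : 𝓓(U, 𝕜) := ⟨g 0, contDiff_of_hasDerivAt_seq hg,
    hL.of_isClosed_subset (isClosed_tsupport _) hts, hts.trans hLU⟩
  refine ⟨ψ, fun S => ?_⟩
  obtain ⟨κ, hκ, hκs, hκU, V, -, hLV, hV1⟩ := exists_cutoff 𝕜 hL U hLU
  obtain ⟨N, s, B, hs, hB, hrep⟩ := exists_local_representation S hκ hκs hκU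
  have hfix : ∀ φ : 𝓓(U, 𝕜), Function.support φ ⊆ L → mulTest κ hκ φ = φ := by
    intro φ hφ
    ext x
    rw [mulTest_apply]
    by_cases hx : φ x = 0
    · rw [hx, mul_zero]
    · rw [hV1 x (hLV (hφ hx)), one_mul]
  have : IsFiniteMeasure (volume.restrict (tsupport κ)) :=
    ⟨by rw [Measure.restrict_apply_univ]; exact hκs.measure_lt_top⟩
  have hecont : ∀ j, Continuous (e j) := fun j =>
    continuous_iff_continuousAt.2 fun y => (hed j y).continuousAt
  have hint : ∀ i : Fin N, Integrable (fun x => s i x • e i x) (volume.restrict (tsupport κ)) := by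
    intro i
    refine Integrable.of_bound (C := B * M i) ((hs i).aestronglyMeasurable.smul
      (hecont i).aestronglyMeasurable) (ae_of_all _ fun x => ?_)
    rw [norm_smul]
    refine mul_le_mul (hB i x) ?_ (norm_nonneg _) ((norm_nonneg _).trans (hB i x))
    exact (ContinuousMap.norm_le _ (hM0 _)).2 fun φ => hM i φ.1 φ.2 x
  -- The local structure of `S` writes its restriction to `C` as a Bochner integral of the curves `e
  -- i`. Since `F` commutes with this integral, `F (r S)` is the same expression with `ψ` in place
  -- of `φ`.
  have hr : r S = ∑ i, ∫ x in tsupport κ, s i x • e i x := by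
    ext φ
    have h1 : ∀ i : Fin N, (∫ x in tsupport κ, s i x • e i x) φ =
        ∫ x in tsupport κ, s i x * iteratedDeriv i φ.1 x := by
      intro i
      have := ContinuousLinearMap.integral_comp_comm (ContinuousMap.evalCLM 𝕜 φ) (hint i)
      exact this.symm
    rw [ContinuousMap.sum_apply]
    simp_rw [h1]
    rw [← hrep φ.1, hfix φ.1 (hCL φ.1 φ.2)]
    rfl
  rw [← hF S, hr, map_sum, ← hfix ψ hsupp, hrep ψ]
  refine Finset.sum_congr rfl fun i _ => ?_
  rw [← ContinuousLinearMap.integral_comp_comm F (hint i)]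
  refine integral_congr_ae (ae_of_all _ fun x => ?_)
  have h2 : iteratedDeriv i ψ = g i := iteratedDeriv_of_hasDerivAt_seq hg i
  simp only [h2, map_smul, smul_eq_mul, g]

/-- Continuity at zero for compact convergence, made quantitative by homogeneity. -/
theorem exists_compact_bound (A : Dist 𝕜 U →L[𝕜] Dist 𝕜 U) {C : Set 𝓓(U, 𝕜)} (hC : IsCompact C) :
    ∃ (C' : Set 𝓓(U, 𝕜)) (c : ℝ), IsCompact C' ∧ 0 ≤ c ∧ ∀ (S : Dist 𝕜 U) (B : ℝ), 0 ≤ B →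
      (∀ χ ∈ C', ‖S χ‖ ≤ B) → ∀ φ ∈ C, ‖A S φ‖ ≤ c * B := by
  have hb := CompactConvergenceCLM.hasBasis_nhds_zero_of_basis (σ := RingHom.id 𝕜)
    (E := 𝓓(U, 𝕜)) (F := 𝕜) Metric.nhds_basis_ball
  have h1 := hb.mem_of_mem (i := (C, (1 : ℝ))) ⟨hC, one_pos⟩
  have h2 := A.continuous.tendsto 0
  rw [map_zero] at h2
  obtain ⟨⟨C', r⟩, ⟨hC', hr⟩, hsub⟩ := hb.mem_iff.1 (h2 h1)
  replace hr : 0 < r := hr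
  refine ⟨C', 2 / r, hC', by positivity, fun S B hB hS φ hφ => ?_⟩
  refine le_of_forall_pos_le_add fun ε hε => ?_
  -- The slack `δ` keeps the scaling factor `t` finite when `B = 0` and is chosen so that `1 / t = 2
  -- / r * B + ε`.
  let δ := ε * r / 2
  have hδ : 0 < δ := by positivity
  let t : ℝ := r / (2 * (B + δ))
  have ht : 0 < t := by positivity
  have h3 : ((t : 𝕜) • S) ∈ {f : Dist 𝕜 U | ∀ x ∈ C', f x ∈ Metric.ball (0 : 𝕜) r} := by
    intro χ hχ
    rw [mem_ball_zero_iff, smul_apply, norm_smul, RCLike.norm_ofReal, abs_of_pos ht]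
    have h4 : t * ‖S χ‖ ≤ t * B := mul_le_mul_of_nonneg_left (hS χ hχ) ht.le
    have h5 : t * (B + δ) = r / 2 := by
      simp only [t]; field_simp
    nlinarith
  have h6 := hsub h3 φ hφ
  simp only at h6
  rw [map_smul, mem_ball_zero_iff, smul_apply, norm_smul, RCLike.norm_ofReal, abs_of_pos ht] at h6
  have h7 : ‖A S φ‖ < 1 / t := by
    rw [lt_div_iff₀ ht]; linarith
  have h8 : 1 / t = 2 / r * B + ε := by
    simp only [t, δ]; field_simp
  linarith

/-- A continuous operator on distributions is the transpose of a linear operator on test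
functions. -/
theorem exists_transpose (A : Dist 𝕜 U →L[𝕜] Dist 𝕜 U) :
    ∃ M : 𝓓(U, 𝕜) →ₗ[𝕜] 𝓓(U, 𝕜), ∀ S φ, A S φ = S (M φ) := by
  have h : ∀ φ : 𝓓(U, 𝕜), ∃ ψ : 𝓓(U, 𝕜), ∀ S, A S φ = S ψ := by
    intro φ
    obtain ⟨C', c, hC', hc, hb⟩ := exists_compact_bound A (isCompact_singleton (x := φ))
    exact exists_test_of_functional
      { toFun := fun S => A S φ
        map_add' := fun S T => by rw [map_add]; rfl
        map_smul' := fun a S => by rw [map_smul]; rfl } hC' c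
      (fun S B hB hS => hb S B hB hS φ rfl)
  choose M hM using h
  have hext : ∀ φ ψ : 𝓓(U, 𝕜), (∀ S : Dist 𝕜 U, S φ = S ψ) → φ = ψ := by
    intro φ ψ h
    ext y
    simpa using h (derivEval U 0 y)
  refine ⟨{ toFun := M, map_add' := fun φ ψ => hext _ _ fun S => ?_,
            map_smul' := fun a φ => hext _ _ fun S => ?_ }, fun S φ => hM φ S⟩
  · rw [← hM, map_add, map_add, hM, hM]
  · rw [← hM, map_smul, map_smul, hM, RingHom.id_apply]

end Reflexivity

end HadamardOp

namespace HadamardOp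

open Set Filter Topology
open scoped ContDiff

variable {𝕜 : Type*} [RCLike 𝕜]

/-! ### Local boundedness of the transpose. -/

section LocallyBounded

variable {U : Opens ℝ}

/-- The operator `M` maps functions supported in a fixed compact set boundedly to functions
supported in a fixed compact set. -/
def IsLocallyBounded (M : 𝓓(U, 𝕜) →ₗ[𝕜] 𝓓(U, 𝕜)) : Prop :=
  ∀ K : Set ℝ, IsCompact K → K ⊆ U → ∃ L : Set ℝ, IsCompact L ∧ L ⊆ U ∧
    (∀ φ : 𝓓(U, 𝕜), Function.support φ ⊆ K → Function.support (M φ) ⊆ L) ∧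
    ∀ j : ℕ, ∃ (m : ℕ) (C : ℝ), ∀ φ : 𝓓(U, 𝕜), Function.support φ ⊆ K → ∀ B : ℝ,
      DerivBound m B φ → ∀ x, ‖iteratedDeriv j (M φ) x‖ ≤ C * B

theorem DerivBound.smul {m : ℕ} {B : ℝ} {φ : 𝓓(U, 𝕜)} (h : DerivBound m B φ) (c : 𝕜) :
    DerivBound m (‖c‖ * B) (c • φ : 𝓓(U, 𝕜)) := by
  intro j hj x
  have h1 : iteratedDeriv j (c • φ : 𝓓(U, 𝕜)) x = c • iteratedDeriv j φ x :=
    (derivEval (𝕜 := 𝕜) U j x).map_smul c φ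
  rw [h1, norm_smul]
  exact mul_le_mul_of_nonneg_left (h j hj x) (norm_nonneg _)

theorem support_smul_test_subset (c : 𝕜) (φ : 𝓓(U, 𝕜)) :
    Function.support (c • φ : 𝓓(U, 𝕜)) ⊆ Function.support φ := by
  intro x hx h
  exact hx (show c • φ x = 0 by rw [h, smul_zero])

/-- The transpose of a continuous operator on distributions is locally bounded. -/
theorem isLocallyBounded_of_transpose (A : Dist 𝕜 U →L[𝕜] Dist 𝕜 U)
    (M : 𝓓(U, 𝕜) →ₗ[𝕜] 𝓓(U, 𝕜)) (hAM : ∀ S φ, A S φ = S (M φ)) : IsLocallyBounded M := by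
  intro K hK hKU
  -- A null sequence together with its limit is compact, so the values of any `S` on all `M (φ n)`
  -- are controlled by its supremum over a single compact set `C'`. Taking for `S` suitable point
  -- evaluations of derivatives refutes unboundedness of `M`.
  have hnull : ∀ φ : ℕ → 𝓓(U, 𝕜), (∀ n, Function.support (φ n) ⊆ K) →
      (∀ n, DerivBound n (1 / ((n : ℝ) + 1)) (φ n)) →
      ∃ (C' : Set 𝓓(U, 𝕜)) (c : ℝ), IsCompact C' ∧ 0 ≤ c ∧ ∀ (S : Dist 𝕜 U) (B : ℝ), 0 ≤ B →
        (∀ χ ∈ C', ‖S χ‖ ≤ B) → ∀ n, ‖S (M (φ n))‖ ≤ c * B := by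
    intro φ hφ hb
    have h1 := tendsto_zero_of_derivBound hK hKU φ hφ tendsto_one_div_add_atTop_nhds_zero_nat hb
    obtain ⟨C', c, hC', hc, h⟩ := exists_compact_bound A h1.isCompact_insert_range
    exact ⟨C', c, hC', hc, fun S B hB hS n => hAM S (φ n) ▸
      h S B hB hS (φ n) (Set.mem_insert_of_mem _ ⟨n, rfl⟩)⟩
  have hsupp : ∃ L : Set ℝ, IsCompact L ∧ L ⊆ U ∧
      ∀ φ : 𝓓(U, 𝕜), Function.support φ ⊆ K → Function.support (M φ) ⊆ L := by
    obtain ⟨L, hL, hLU, hmono, hex⟩ := exists_exhaustion U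
    by_contra hcon
    have h1 : ∀ n, ∃ φ : 𝓓(U, 𝕜), Function.support φ ⊆ K ∧ ∃ x, M φ x ≠ 0 ∧ x ∉ L n := by
      intro n
      by_contra h
      push Not at h
      exact hcon ⟨L n, hL n, hLU n, fun φ hφ x hx => h φ hφ x hx⟩
    choose φ hφ x hx hxL using h1
    choose B hB0 hB using fun n => exists_derivBound (φ n) n
    -- This scaling produces a null sequence without destroying `M (φ n) (x n) ≠ 0`. The evaluation
    -- at a point `x N` outside the common support of `C'` vanishes on `C'`, hence on the scaled `M
    -- (φ N)`.
    let c : ℕ → 𝕜 := fun n => (((B n * (n + 1))⁻¹ : ℝ) : 𝕜)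
    have hc : ∀ n, ‖c n‖ = (B n * (n + 1))⁻¹ := fun n => by
      have := hB0 n
      rw [RCLike.norm_ofReal, abs_of_pos (by positivity)]
    obtain ⟨C', d, hC', hd, h⟩ := hnull (fun n => c n • φ n)
      (fun n => (support_smul_test_subset _ _).trans (hφ n))
      (fun n => ((hB n).smul (c n)).mono le_rfl (by
        have := hB0 n
        rw [hc n, mul_inv]
        field_simp
        exact le_rfl))
    obtain ⟨L', hL', hLU', hCL'⟩ := exists_support_subset_of_isCompact hC'
    obtain ⟨N, hN⟩ := hex L' hL' hLU'
    have h2 := h (derivEval U 0 (x N)) 0 le_rfl (fun χ hχ => by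
      rw [derivEval_apply, iteratedDeriv_zero, norm_le_zero_iff]
      by_contra hne
      exact hxL N (hN (hCL' χ hχ hne))) N
    rw [mul_zero, norm_le_zero_iff, map_smul, map_smul, derivEval_apply, iteratedDeriv_zero,
      smul_eq_mul] at h2
    rcases mul_eq_zero.1 h2 with h3 | h3
    · have := hB0 N
      rw [← norm_eq_zero, hc N] at h3
      exact absurd h3 (by positivity)
    · exact hx N h3
  obtain ⟨L, hL, hLU, hML⟩ := hsupp
  refine ⟨L, hL, hLU, hML, fun j => ?_⟩
  by_contra hcon
  push Not at hcon
  -- Of the factor `(n + 1) ^ 2`, one power is spent on turning `φ` into a null sequence and the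
  -- other outgrows the fixed bound `d * D`.
  choose φ hφ B hB x hx using fun n : ℕ => hcon n (((n : ℝ) + 1) ^ 2)
  have hB0 : ∀ n, 0 < B n := by
    intro n
    refine (hB n).nonneg.lt_of_ne fun h0 => ?_
    have hφ0 : φ n = 0 := by
      ext y
      have h1 := hB n 0 (Nat.zero_le _) y
      rw [← h0, norm_le_zero_iff, iteratedDeriv_zero] at h1
      exact h1
    have h2 := hx n
    rw [← h0, mul_zero, hφ0, map_zero] at h2
    have h3 : iteratedDeriv j ((0 : 𝓓(U, 𝕜)) : ℝ → 𝕜) (x n) = 0 :=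
      (derivEval (𝕜 := 𝕜) U j (x n)).map_zero
    rw [h3, norm_zero] at h2
    exact lt_irrefl _ h2
  let c : ℕ → 𝕜 := fun n => (((B n * (n + 1))⁻¹ : ℝ) : 𝕜)
  have hc : ∀ n, ‖c n‖ = (B n * (n + 1))⁻¹ := fun n => by
    have := hB0 n
    rw [RCLike.norm_ofReal, abs_of_pos (by positivity)]
  obtain ⟨C', d, hC', hd, h⟩ := hnull (fun n => c n • φ n)
    (fun n => (support_smul_test_subset _ _).trans (hφ n))
    (fun n => ((hB n).smul (c n)).mono le_rfl (by
      have := hB0 n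
      rw [hc n, mul_inv]
      field_simp
      exact le_rfl))
  obtain ⟨D, hD0, hD⟩ := exists_bound_of_isCompact hC' j
  obtain ⟨n, hn⟩ := exists_nat_gt (d * D)
  have h2 := h (derivEval U j (x n)) D hD0 (fun χ hχ => hD χ hχ (x n)) n
  rw [map_smul, map_smul, derivEval_apply, norm_smul, hc n] at h2
  have h3 : ((n : ℝ) + 1) ≤ (B n * (n + 1))⁻¹ * ‖iteratedDeriv j (M (φ n)) (x n)‖ := by
    have h4 := (hx n).le
    have := hB0 n
    calc ((n : ℝ) + 1) = (B n * (n + 1))⁻¹ * (((n : ℝ) + 1) ^ 2 * B n) := by field_simp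
      _ ≤ _ := mul_le_mul_of_nonneg_left h4 (by positivity)
  linarith

end LocallyBounded

/-! ### Moments determine a test function; operations commuting with `M`. -/

section Moments

/-- By Weierstrass, `u` is uniformly close on its support to a polynomial `p`, while `∫ u² = ∫ u (u
- p)` because `u` is orthogonal to polynomials. -/
theorem eq_zero_of_moments_real {u : ℝ → ℝ} (hc : Continuous u) (hs : HasCompactSupport u)
    (h : ∀ n : ℕ, ∫ x, u x * x ^ n = 0) : u = 0 := by
  obtain ⟨R, hR⟩ := hs.isBounded.subset_closedBall 0
  have hint : ∀ g : ℝ → ℝ, Continuous g → Integrable (fun x => u x * g x) := fun g hg =>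
    (hc.mul hg).integrable_of_hasCompactSupport hs.mul_right
  have hpoly : ∀ p : Polynomial ℝ, ∫ x, u x * p.eval x = 0 := by
    intro p
    simp_rw [Polynomial.eval_eq_sum_range, Finset.mul_sum]
    rw [integral_finsetSum _ fun i _ => hint (fun x => p.coeff i * x ^ i) (by fun_prop)]
    refine Finset.sum_eq_zero fun i _ => ?_
    simp_rw [mul_left_comm (u _)]
    rw [integral_const_mul, h, mul_zero]
  have hu : ∫ x, u x * u x = 0 := by
    refine le_antisymm ?_ (integral_nonneg fun x => mul_self_nonneg _)
    refine le_of_forall_pos_le_add fun ε hε => ?_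
    rw [zero_add]
    let I := ∫ x, |u x|
    have hI : 0 ≤ I := integral_nonneg fun _ => abs_nonneg _
    obtain ⟨p, hp⟩ := exists_polynomial_near_of_continuousOn (-R) R u hc.continuousOn (ε / (I + 1))
      (by positivity)
    have h1 : ∫ x, u x * u x = ∫ x, u x * (u x - p.eval x) := by
      simp_rw [mul_sub]
      rw [integral_sub (hint u hc) (hint _ p.continuous), hpoly, sub_zero]
    rw [h1]
    have h2 : ∀ x, u x * (u x - p.eval x) ≤ |u x| * (ε / (I + 1)) := by
      intro x
      by_cases hx : u x = 0
      · simp [hx]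
      · have hxR := hR (subset_tsupport u hx)
        rw [Real.closedBall_eq_Icc, zero_sub, zero_add] at hxR
        refine (le_abs_self _).trans ?_
        rw [abs_mul, abs_sub_comm]
        exact mul_le_mul_of_nonneg_left (hp x hxR).le (abs_nonneg _)
    refine (integral_mono (hint (fun x => u x - p.eval x) (hc.sub p.continuous))
      ((hc.abs.integrable_of_hasCompactSupport hs.norm).mul_const _) h2).trans ?_
    rw [integral_mul_const]
    change I * _ ≤ _
    rw [mul_div_assoc', div_le_iff₀ (by positivity)]
    nlinarith
  have h0 := (integral_eq_zero_iff_of_nonneg (fun x => mul_self_nonneg (u x)) (hint u hc)).1 hu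
  have h1 := (Continuous.ae_eq_iff_eq volume (hc.mul hc) continuous_const).1 h0
  ext x
  exact mul_self_eq_zero.1 (congrFun h1 x)

theorem eq_zero_of_moments {f : ℝ → 𝕜} (hc : Continuous f) (hs : HasCompactSupport f)
    (h : ∀ n : ℕ, ∫ x, f x * (x : 𝕜) ^ n = 0) : f = 0 := by
  have hint : ∀ n : ℕ, Integrable (fun x => f x * (x : 𝕜) ^ n) := fun n =>
    (hc.mul (RCLike.continuous_ofReal.pow n)).integrable_of_hasCompactSupport hs.mul_right
  have hre := eq_zero_of_moments_real (u := fun x => RCLike.re (f x))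
    (RCLike.continuous_re.comp hc) (hs.comp_left (g := RCLike.re) (map_zero _)) (fun n => by
      have h1 := integral_re (hint n)
      rw [h n, map_zero] at h1
      rw [← h1]
      refine integral_congr_ae (ae_of_all _ fun x => ?_)
      change RCLike.re (f x) * x ^ n = RCLike.re (f x * (x : 𝕜) ^ n)
      rw [← RCLike.ofReal_pow, mul_comm (f x), RCLike.re_ofReal_mul, mul_comm])
  have him := eq_zero_of_moments_real (u := fun x => RCLike.im (f x))
    (RCLike.continuous_im.comp hc) (hs.comp_left (g := RCLike.im) (map_zero _)) (fun n => by
      have h1 := integral_im (hint n)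
      rw [h n, map_zero] at h1
      rw [← h1]
      refine integral_congr_ae (ae_of_all _ fun x => ?_)
      change RCLike.im (f x) * x ^ n = RCLike.im (f x * (x : 𝕜) ^ n)
      rw [← RCLike.ofReal_pow, mul_comm (f x), RCLike.im_ofReal_mul, mul_comm])
  ext x
  exact RCLike.ext (by simpa using congrFun hre x) (by simpa using congrFun him x)

variable {U : Opens ℝ}

/-- The monomials are eigenvectors of the transpose of `M`. -/
def PreservesMoments (M : 𝓓(U, 𝕜) →ₗ[𝕜] 𝓓(U, 𝕜)) : Prop :=
  ∀ n : ℕ, ∃ m : 𝕜, ∀ φ : 𝓓(U, 𝕜), ∫ x, M φ x * (x : 𝕜) ^ n = m * ∫ x, φ x * (x : 𝕜) ^ n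

theorem integrable_mul_pow {f : ℝ → 𝕜} (hc : Continuous f) (hs : HasCompactSupport f) (n : ℕ) :
    Integrable (fun x => f x * (x : 𝕜) ^ n) :=
  (hc.mul (RCLike.continuous_ofReal.pow n)).integrable_of_hasCompactSupport hs.mul_right

/-- Two operations that both act diagonally on moments commute: here both sides have `n`-th moment
`m_n * c n` times that of `φ`, and moments determine the function. This is the source of all
symmetries of `M`. -/
theorem PreservesMoments.eq_of_moments {M : 𝓓(U, 𝕜) →ₗ[𝕜] 𝓓(U, 𝕜)} (hM : PreservesMoments M)
    (φ φ' : 𝓓(U, 𝕜)) {G : ℝ → 𝕜} (hGc : Continuous G) (hGs : HasCompactSupport G) (c : ℕ → 𝕜)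
    (h1 : ∀ n : ℕ, ∫ x, φ' x * (x : 𝕜) ^ n = c n * ∫ x, φ x * (x : 𝕜) ^ n)
    (h2 : ∀ n : ℕ, ∫ x, G x * (x : 𝕜) ^ n = c n * ∫ x, M φ x * (x : 𝕜) ^ n) (x : ℝ) :
    M φ' x = G x := by
  have h := eq_zero_of_moments ((M φ').continuous.sub hGc)
    (HasCompactSupport.sub (M φ').hasCompactSupport hGs) (fun n => by
      obtain ⟨m, hm⟩ := hM n
      simp only [Pi.sub_apply, sub_mul]
      rw [integral_sub (integrable_mul_pow (M φ').continuous (M φ').hasCompactSupport n)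
        (integrable_mul_pow hGc hGs n), hm φ', h1, h2, hm φ]
      ring)
  exact sub_eq_zero.1 (congrFun h x)

theorem integral_dilation_mul_pow (f : ℝ → 𝕜) {a : ℝ} (ha : a ≠ 0) (n : ℕ) :
    ∫ x, f (a * x) * (x : 𝕜) ^ n = ((|a⁻¹| : ℝ) : 𝕜) * ((a : 𝕜)⁻¹) ^ n *
      ∫ x, f x * (x : 𝕜) ^ n := by
  have ha' : (a : 𝕜) ≠ 0 := by simpa using ha
  have h := Measure.integral_comp_mul_left (fun z : ℝ => f z * (((a : 𝕜)⁻¹) * (z : 𝕜)) ^ n) a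
  have h2 : ∀ x : ℝ, f (a * x) * ((a : 𝕜)⁻¹ * ((a * x : ℝ) : 𝕜)) ^ n = f (a * x) * (x : 𝕜) ^ n := by
    intro x
    rw [RCLike.ofReal_mul, inv_mul_cancel_left₀ ha']
  simp_rw [h2] at h
  rw [h]
  simp_rw [mul_pow, mul_left_comm (f _)]
  rw [integral_const_mul, RCLike.real_smul_eq_coe_mul, mul_assoc]

/-- `M` commutes with dilations. -/
theorem PreservesMoments.dilation {M : 𝓓(U, 𝕜) →ₗ[𝕜] 𝓓(U, 𝕜)} (hM : PreservesMoments M)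
    {φ φ' : 𝓓(U, 𝕜)} {a : ℝ} (ha : a ≠ 0) (h : ∀ x, φ' x = φ (a * x)) (x : ℝ) :
    M φ' x = M φ (a * x) := by
  refine hM.eq_of_moments φ φ' (G := fun x => M φ (a * x)) ((M φ).continuous.comp (by fun_prop))
    ((M φ).hasCompactSupport.comp_homeomorph (Homeomorph.mulLeft₀ a ha))
    (fun n => ((|a⁻¹| : ℝ) : 𝕜) * ((a : 𝕜)⁻¹) ^ n) (fun n => ?_) (fun n => ?_) x
  · simp_rw [h]
    exact integral_dilation_mul_pow φ ha n
  · exact integral_dilation_mul_pow (M φ) ha n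

theorem integral_euler_mul_pow {f : ℝ → 𝕜} (hf : ContDiff ℝ ∞ f) (hs : HasCompactSupport f)
    (n : ℕ) : ∫ x : ℝ, ((x : 𝕜) * deriv f x) * (x : 𝕜) ^ n =
      -((n : 𝕜) + 1) * ∫ x, f x * (x : 𝕜) ^ n := by
  have hd : ∀ x, HasDerivAt f (deriv f x) x := fun x =>
    (hf.differentiable (by simp) x).hasDerivAt
  have hp : ∀ x : ℝ, HasDerivAt (fun x : ℝ => (x : 𝕜) ^ (n + 1)) (((n : 𝕜) + 1) * (x : 𝕜) ^ n) x := by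
    intro x
    have h1 : HasDerivAt (fun x : ℝ => (x : 𝕜)) 1 x := by
      simpa using (RCLike.ofRealCLM (K := 𝕜)).hasDerivAt (x := x)
    have h := h1.pow (n + 1)
    rw [mul_one, Nat.add_sub_cancel, Nat.cast_add, Nat.cast_one] at h
    exact h
  have hdc : Continuous (deriv f) := hf.continuous_deriv (by simp)
  have h1 := integral_mul_deriv_eq_deriv_mul_of_integrable (u := f) (v := fun x : ℝ => (x : 𝕜) ^ (n + 1))
    (u' := deriv f) (v' := fun x : ℝ => ((n : 𝕜) + 1) * (x : 𝕜) ^ n)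
    (fun x _ => hd x) (fun x _ => hp x)
    ((hf.continuous.mul (by fun_prop)).integrable_of_hasCompactSupport hs.mul_right)
    (integrable_mul_pow hdc hs.deriv (n + 1)) (integrable_mul_pow hf.continuous hs (n + 1))
  have h2 : ∀ x : ℝ, ((x : 𝕜) * deriv f x) * (x : 𝕜) ^ n = deriv f x * (x : 𝕜) ^ (n + 1) := by
    intro x; ring
  simp_rw [h2]
  rw [neg_mul, ← integral_const_mul, eq_neg_iff_add_eq_zero]
  rw [eq_neg_iff_add_eq_zero, add_comm] at h1
  rw [← h1]
  congr 1
  refine integral_congr_ae (ae_of_all _ fun x => ?_)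
  simp only; ring

/-- The Euler derivative `x ↦ x φ'(x)` of a test function. -/
noncomputable def eulerTest (φ : 𝓓(U, 𝕜)) : 𝓓(U, 𝕜) :=
  ⟨fun x => (x : 𝕜) * deriv φ x, (contDiff_ofReal 𝕜).mul
    (contDiff_infty_iff_deriv.1 (TestFunction.contDiff_infty φ)).2,
    φ.hasCompactSupport.deriv.mul_left,
    (closure_mono (Function.support_mul_subset_right _ _)).trans
      ((tsupport_deriv_subset).trans φ.tsupport_subset)⟩

/-- `M` commutes with the Euler derivative. -/
theorem PreservesMoments.euler {M : 𝓓(U, 𝕜) →ₗ[𝕜] 𝓓(U, 𝕜)} (hM : PreservesMoments M)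
    (φ : 𝓓(U, 𝕜)) : M (eulerTest φ) = eulerTest (M φ) := by
  ext x
  exact hM.eq_of_moments φ (eulerTest φ) (eulerTest (M φ)).continuous
    (eulerTest (M φ)).hasCompactSupport (fun n => -((n : 𝕜) + 1))
    (integral_euler_mul_pow (TestFunction.contDiff_infty φ) φ.hasCompactSupport)
    (integral_euler_mul_pow (TestFunction.contDiff_infty (M φ)) (M φ).hasCompactSupport) x

end Moments

end HadamardOp

namespace HadamardOp

open Set Filter Topology
open scoped ContDiff

variable {𝕜 : Type*} [RCLike 𝕜] {U V : Opens ℝ}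

/-! ### Recovering `T` from `M` when `0 ∈ U`. -/

section Dilation

/-- A smooth function supported in a compact subset of `U`, as a test function. -/
noncomputable def mkTest (U : Opens ℝ) (f : ℝ → 𝕜) (hf : ContDiff ℝ ∞ f) {K : Set ℝ}
    (hK : IsCompact K) (hKU : K ⊆ U) (hfK : Function.support f ⊆ K) : 𝓓(U, 𝕜) :=
  ⟨f, hf, HasCompactSupport.of_support_subset_isCompact hK hfK,
    (closure_minimal hfK hK.isClosed).trans hKU⟩

theorem contDiff_dilation {f : ℝ → 𝕜} (hf : ContDiff ℝ ∞ f) (c : ℝ) :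
    ContDiff ℝ ∞ (fun x => f (c * x)) :=
  hf.comp (contDiff_const.mul contDiff_id)

theorem iteratedDeriv_dilation {f : ℝ → 𝕜} (hf : ContDiff ℝ ∞ f) (c : ℝ) (j : ℕ) (x : ℝ) :
    iteratedDeriv j (fun x => f (c * x)) x = (c : 𝕜) ^ j * iteratedDeriv j f (c * x) := by
  have h := congrFun (iteratedDeriv_comp_const_smul (n := j) (hf.of_le (mod_cast le_top)) c) x
  rw [h, RCLike.real_smul_eq_coe_mul, RCLike.ofReal_pow]

theorem DerivBound.dilation {f : ℝ → 𝕜} (hf : ContDiff ℝ ∞ f) {m : ℕ} {B : ℝ}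
    (h : DerivBound m B f) (c : ℝ) : DerivBound m ((1 + |c|) ^ m * B) (fun x => f (c * x)) := by
  intro j hj x
  rw [iteratedDeriv_dilation hf, norm_mul, norm_pow, RCLike.norm_ofReal]
  refine mul_le_mul ?_ (h j hj _) (norm_nonneg _) (by positivity)
  calc |c| ^ j ≤ (1 + |c|) ^ j := pow_le_pow_left₀ (abs_nonneg c) (by linarith) j
    _ ≤ (1 + |c|) ^ m := pow_le_pow_right₀ (by linarith [abs_nonneg c]) hj

/-- Test functions supported in a compact set `K` can be dilated to test functions on `U`, if the
corresponding dilate of `K` is contained in `U`. -/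
theorem exists_dilated_test (φ : 𝓓(V, 𝕜)) {K : Set ℝ} (hK : IsCompact K)
    (hφ : Function.support φ ⊆ K) {η : ℝ} (hη : η ≠ 0) (hKU : (fun x => η * x) '' K ⊆ U) :
    ∃ φ' : 𝓓(U, 𝕜), (∀ x, φ' x = φ (η⁻¹ * x)) ∧ Function.support φ' ⊆ (fun x => η * x) '' K :=
  have h : Function.support (fun x => φ (η⁻¹ * x)) ⊆ (fun x => η * x) '' K :=
    fun x hx => ⟨η⁻¹ * x, hφ hx, by field_simp⟩
  ⟨mkTest U (fun x => φ (η⁻¹ * x)) (contDiff_dilation (TestFunction.contDiff_infty φ) _)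
    (hK.image (by fun_prop)) hKU h, fun _ => rfl, h⟩

theorem exists_dilation_subset (h0 : (0 : ℝ) ∈ U) {K : Set ℝ} (hK : IsCompact K) :
    ∃ η : ℝ, 0 < η ∧ (fun x => η * x) '' K ⊆ U := by
  obtain ⟨r, hr⟩ := hK.isBounded.exists_norm_le
  obtain ⟨ε, hε, hεU⟩ := Metric.isOpen_iff.1 U.isOpen 0 h0
  refine ⟨ε / (|r| + 1), by positivity, ?_⟩
  rintro _ ⟨x, hx, rfl⟩
  refine hεU ?_
  rw [mem_ball_zero_iff, norm_mul, Real.norm_of_nonneg (by positivity), div_mul_eq_mul_div,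
    div_lt_iff₀ (by positivity)]
  have := (hr x hx).trans (le_abs_self r)
  nlinarith

/-- The distribution `T` with `T (φ (· y)) = M φ y`, if `0 ∈ U`. -/
theorem exists_dist_of_zero_mem (h0 : (0 : ℝ) ∈ U) {M : 𝓓(U, 𝕜) →ₗ[𝕜] 𝓓(U, 𝕜)}
    (hM : PreservesMoments M) (hb : IsLocallyBounded M) :
    ∃ T : Dist 𝕜 ⊤, ∀ (φ : 𝓓((⊤ : Opens ℝ), 𝕜)) (φ' : 𝓓(U, 𝕜)) (η : ℝ), η ≠ 0 →
      (∀ x, φ' x = φ (η⁻¹ * x)) → T φ = M φ' η := by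
  -- Since `M` commutes with dilations, the value does not depend on the factor by which `φ` is
  -- shrunk into `U`; this makes `T` well defined.
  have huniq : ∀ (φ : 𝓓((⊤ : Opens ℝ), 𝕜)) (φ' φ'' : 𝓓(U, 𝕜)) (η η' : ℝ), η ≠ 0 → η' ≠ 0 →
      (∀ x, φ' x = φ (η⁻¹ * x)) → (∀ x, φ'' x = φ (η'⁻¹ * x)) → M φ' η = M φ'' η' := by
    intro φ φ' φ'' η η' hη hη' h h'
    rw [hM.dilation (φ := φ'') (φ' := φ') (a := η' * η⁻¹) (by positivity) (fun x => by
      rw [h, h']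
      congr 1
      field_simp)]
    congr 1
    field_simp
  have hex : ∀ φ : 𝓓((⊤ : Opens ℝ), 𝕜), ∃ t : 𝕜, ∀ (φ' : 𝓓(U, 𝕜)) (η : ℝ), η ≠ 0 →
      (∀ x, φ' x = φ (η⁻¹ * x)) → M φ' η = t := by
    intro φ
    obtain ⟨η, hη, hU⟩ := exists_dilation_subset h0 (K := tsupport φ) φ.hasCompactSupport
    obtain ⟨φ', h, -⟩ := exists_dilated_test φ φ.hasCompactSupport (subset_tsupport _) hη.ne' hU
    exact ⟨M φ' η, fun φ'' η' hη' h' => huniq φ φ'' φ' η' η hη' hη.ne' h' h⟩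
  choose t ht using hex
  have hcommon : ∀ K : Set ℝ, IsCompact K → ∃ η : ℝ, 0 < η ∧ (fun x => η * x) '' K ⊆ U ∧
      ∀ φ : 𝓓((⊤ : Opens ℝ), 𝕜), Function.support φ ⊆ K → ∃ φ' : 𝓓(U, 𝕜),
        (∀ x, φ' x = φ (η⁻¹ * x)) ∧ Function.support φ' ⊆ (fun x => η * x) '' K ∧
        M φ' η = t φ := by
    intro K hK
    obtain ⟨η, hη, hU⟩ := exists_dilation_subset h0 hK
    refine ⟨η, hη, hU, fun φ hφ => ?_⟩
    obtain ⟨φ', h, hs⟩ := exists_dilated_test φ hK hφ hη.ne' hU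
    exact ⟨φ', h, hs, ht φ φ' η hη.ne' h⟩
  let T : 𝓓((⊤ : Opens ℝ), 𝕜) →ₗ[𝕜] 𝕜 :=
    { toFun := t
      map_add' := fun φ ψ => by
        obtain ⟨η, hη, -, h⟩ := hcommon (tsupport φ ∪ tsupport ψ)
          (φ.hasCompactSupport.isCompact.union ψ.hasCompactSupport)
        obtain ⟨φ', h1, -, h2⟩ := h φ ((subset_tsupport _).trans subset_union_left)
        obtain ⟨ψ', h3, -, h4⟩ := h ψ ((subset_tsupport _).trans subset_union_right)
        rw [← ht (φ + ψ) (φ' + ψ') η hη.ne' (fun x => by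
          change φ' x + ψ' x = φ _ + ψ _
          rw [h1, h3]), ← h2, ← h4, map_add]
        rfl
      map_smul' := fun c φ => by
        obtain ⟨η, hη, -, h⟩ := hcommon (tsupport φ) φ.hasCompactSupport
        obtain ⟨φ', h1, -, h2⟩ := h φ (subset_tsupport _)
        rw [← ht (c • φ) (c • φ') η hη.ne' (fun x => by
          change c • φ' x = c • φ _
          rw [h1]), ← h2, map_smul]
        rfl }
  refine ⟨mkDist T fun K hK _ => ?_, fun φ φ' η hη h => (ht φ φ' η hη h).symm⟩
  obtain ⟨η, hη, hU, h⟩ := hcommon K hK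
  obtain ⟨L, -, -, -, hL⟩ := hb _ (hK.image (f := fun x => η * x) (by fun_prop)) hU
  obtain ⟨m, C, hC⟩ := hL 0
  refine ⟨m, C * (1 + |η⁻¹|) ^ m, fun φ hφ B hB => ?_⟩
  obtain ⟨φ', h1, h2, h3⟩ := h φ hφ
  have h4 := hC φ' h2 ((1 + |η⁻¹|) ^ m * B)
    (funext h1 ▸ hB.dilation (TestFunction.contDiff_infty φ) η⁻¹) η
  rw [iteratedDeriv_zero, h3] at h4
  rw [mul_assoc]
  exact h4

theorem isDualDilation_of_dist {M : 𝓓(U, 𝕜) →ₗ[𝕜] 𝓓(U, 𝕜)} {T : Dist 𝕜 ⊤}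
    (hT : ∀ (φ : 𝓓((⊤ : Opens ℝ), 𝕜)) (φ' : 𝓓(U, 𝕜)) (η : ℝ), η ≠ 0 →
      (∀ x, φ' x = φ (η⁻¹ * x)) → T φ = M φ' η) (φ : 𝓓(U, 𝕜)) : IsDualDilation T φ (M φ) := by
  intro y hy
  obtain ⟨χ, h1, -⟩ := exists_dilated_test (U := ⊤) φ φ.hasCompactSupport (subset_tsupport _)
    (inv_ne_zero hy) (fun _ _ => trivial)
  rw [inv_inv] at h1
  refine ⟨χ, fun x => by rw [h1, mul_comm], ?_⟩
  rw [hT χ φ y hy fun x => by rw [h1, mul_inv_cancel_left₀ hy]]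

end Dilation

/-! ### Support properties of `T` deduced from those of `M`. -/

section Support

variable {M : 𝓓(U, 𝕜) →ₗ[𝕜] 𝓓(U, 𝕜)} {T : Dist 𝕜 V}

theorem IsDualDilation.apply_eq {φ ψ : 𝓓(U, 𝕜)} (h : IsDualDilation T φ ψ) {y : ℝ} (hy : y ≠ 0)
    (χ : 𝓓(V, 𝕜)) (hχ : ∀ x, χ x = φ (x * y)) : T χ = ψ y := by
  obtain ⟨χ', h1, h2⟩ := h y hy
  have : χ = χ' := by
    ext x
    rw [hχ, h1]
  rw [this, h2]

/-- If the functions `M φ`, `φ` supported in `K`, vanish at `y`, then `T` vanishes on functions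
supported in `y⁻¹ K`. -/
theorem eq_zero_of_support (hT : ∀ φ : 𝓓(U, 𝕜), IsDualDilation T φ (M φ)) {K : Set ℝ}
    (hK : IsCompact K) (hKU : K ⊆ U) {y : ℝ} (hy : y ≠ 0)
    (hM : ∀ φ : 𝓓(U, 𝕜), Function.support φ ⊆ K → M φ y = 0) (χ : 𝓓(V, 𝕜))
    (hχ : ∀ x, χ x ≠ 0 → x * y ∈ K) : T χ = 0 := by
  obtain ⟨φ, h1, h2⟩ := exists_dilated_test (U := U) (K := (fun x => y⁻¹ * x) '' K) χ
    (hK.image (by fun_prop)) (fun x hx => ⟨x * y, hχ x hx, by field_simp⟩) hy (by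
      rintro _ ⟨_, ⟨x, hx, rfl⟩, rfl⟩
      simpa only [mul_inv_cancel_left₀ hy] using hKU hx)
  rw [(hT φ).apply_eq hy χ (fun x => by rw [h1]; congr 1; field_simp), hM φ]
  refine h2.trans ?_
  rintro _ ⟨_, ⟨x, hx, rfl⟩, rfl⟩
  simpa only [mul_inv_cancel_left₀ hy] using hx

/-- If `y = x⁻¹ * k` is nonzero and outside `L`, every `M φ` with `φ` supported in `K'` vanishes at
`y`, so `T` vanishes on functions supported in `y⁻¹ K'`. This is a neighbourhood of `x`, because `x
* y = k` is interior to `K'`. -/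
theorem exists_compact_of_supp (hT : ∀ φ : 𝓓(U, 𝕜), IsDualDilation T φ (M φ))
    (hb : IsLocallyBounded M) {K : Set ℝ} (hK : IsCompact K) (hKU : K ⊆ U) :
    ∃ L : Set ℝ, IsCompact L ∧ L ⊆ U ∧ ∀ x ∈ supp T, ∀ k ∈ K, x⁻¹ * k ∈ L ∨ x⁻¹ * k = 0 := by
  obtain ⟨K', hK', hKK', hK'U⟩ := exists_compact_between hK U.isOpen hKU
  obtain ⟨L, hL, hLU, hML, -⟩ := hb K' hK' hK'U
  refine ⟨L, hL, hLU, fun x hx k hk => ?_⟩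
  by_contra hcon
  push Not at hcon
  obtain ⟨h1, h2⟩ := hcon
  refine (Distribution.notMem_dsupport_iff x).2 ⟨{z | z * (x⁻¹ * k) ∈ interior K'}, ?_,
    isOpen_interior.preimage (by fun_prop), ?_⟩ hx
  · intro χ hχ
    refine eq_zero_of_support hT hK' hK'U h2 (fun φ hφ => ?_) χ
      fun z hz => interior_subset (hχ (subset_tsupport _ hz))
    by_contra h
    exact h1 (hML φ hφ h)
  · have hx0 : x ≠ 0 := fun h => h2 (by simp [h])
    rw [Set.mem_ofPred_eq, mul_inv_cancel_left₀ hx0]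
    exact hKK' hk

theorem suppCondition_of_zero_mem (h0 : (0 : ℝ) ∈ U)
    (hT : ∀ φ : 𝓓(U, 𝕜), IsDualDilation T φ (M φ)) (hb : IsLocallyBounded M) :
    SuppCondition T U := by
  intro K hK hKU
  obtain ⟨L, hL, hLU, h⟩ := exists_compact_of_supp hT hb hK hKU
  have hsub : closure ((supp T)⁻¹ * K) ⊆ insert 0 L := by
    refine closure_minimal ?_ (hL.insert 0).isClosed
    rintro _ ⟨x, hx, k, hk, rfl⟩
    rcases h x⁻¹ hx k hk with h' | h'
    · exact Or.inr (by simpa using h')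
    · exact Or.inl (by simpa using h')
  exact ⟨(hL.insert 0).of_isClosed_subset isClosed_closure hsub,
    hsub.trans (insert_subset h0 hLU)⟩

/-- If `0 ∈ U` then `T` vanishes near zero. -/
theorem exists_vanishing_near_zero (h0 : (0 : ℝ) ∈ U)
    (hT : ∀ φ : 𝓓(U, 𝕜), IsDualDilation T φ (M φ)) (hb : IsLocallyBounded M) :
    ∃ δ : ℝ, 0 < δ ∧ ∀ χ : 𝓓(V, 𝕜), (∀ x, χ x ≠ 0 → |x| ≤ δ) → T χ = 0 := by
  obtain ⟨a, ha, haU⟩ := Metric.nhds_basis_closedBall.mem_iff.1 (U.isOpen.mem_nhds h0)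
  obtain ⟨L, hL, hLU, hML, -⟩ := hb _ (isCompact_closedBall _ _) haU
  obtain ⟨R, hR⟩ := hL.isBounded.exists_norm_le
  have hR' : 0 < |R| + 1 := by positivity
  -- Functions supported in `[-a, a]` have images supported in `[-R, R]`, which vanish at `y = |R| +
  -- 1`; so `T` kills functions supported where `|x| * y ≤ a`.
  refine ⟨a / (|R| + 1), by positivity, fun χ hχ => ?_⟩
  refine eq_zero_of_support hT (isCompact_closedBall 0 a) haU hR'.ne' (fun φ hφ => ?_) χ
    fun x hx => ?_
  · by_contra h
    have h1 := hR _ (hML φ hφ h)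
    rw [Real.norm_of_nonneg hR'.le] at h1
    linarith [le_abs_self R]
  · rw [mem_closedBall_zero_iff, norm_mul, Real.norm_of_nonneg hR'.le, Real.norm_eq_abs,
      ← le_div_iff₀ hR']
    exact hχ x hx

theorem supp_away_from_zero {δ : ℝ}
    (h : ∀ χ : 𝓓(V, 𝕜), (∀ x, χ x ≠ 0 → |x| ≤ δ) → T χ = 0) : ∀ x ∈ supp T, δ ≤ |x| := by
  intro x hx
  by_contra hlt
  push Not at hlt
  refine (Distribution.notMem_dsupport_iff x).2 ⟨{z | |z| < δ}, fun χ hχ => h χ fun z hz => ?_,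
    isOpen_lt continuous_abs continuous_const, hlt⟩ hx
  exact le_of_lt (hχ (subset_tsupport _ hz))

end Support

/-! ### Estimates at a zero of high order, and a Leibniz formula for `θ`. -/

section Flatness

theorem norm_le_pow_of_iteratedDeriv_eq_zero {f : ℝ → 𝕜} (hf : ContDiff ℝ ∞ f) {k : ℕ}
    (h0 : ∀ j < k, iteratedDeriv j f 0 = 0) {B : ℝ} (hB : ∀ x, ‖iteratedDeriv k f x‖ ≤ B) (y : ℝ) :
    ‖f y‖ ≤ B * |y| ^ k := by
  have hB0 : 0 ≤ B := (norm_nonneg _).trans (hB 0)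
  have h : ∀ i ≤ k, ∀ y, ‖iteratedDeriv (k - i) f y‖ ≤ B * |y| ^ i := by
    intro i
    induction i with
    | zero => intro _ y; simpa using hB y
    | succ i ih =>
      intro hi y
      have hk : k - i = (k - (i + 1)) + 1 := by omega
      have hd : ∀ x, HasDerivAt (iteratedDeriv (k - (i + 1)) f) (iteratedDeriv (k - i) f x) x := by
        intro x
        rw [hk]
        exact hasDerivAt_iteratedDeriv hf _ x
      have h1 := (convex_closedBall (0 : ℝ) |y|).norm_image_sub_le_of_norm_hasDerivWithin_le
        (f := iteratedDeriv (k - (i + 1)) f) (f' := iteratedDeriv (k - i) f) (C := B * |y| ^ i)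
        (x := 0) (y := y) (fun x _ => (hd x).hasDerivWithinAt) (fun x hx => by
          refine (ih (by omega) x).trans ?_
          rw [mem_closedBall_zero_iff, Real.norm_eq_abs] at hx
          gcongr) (by simp) (by simp)
      rw [h0 _ (by omega), sub_zero, sub_zero, Real.norm_eq_abs] at h1
      rwa [pow_succ, ← mul_assoc]
  simpa using h k le_rfl y

/-- At `x = 0` this says that the `k`-th derivative of `(θ - k) f` vanishes, whatever `f` is. -/
theorem iteratedDeriv_mul_deriv {f : ℝ → 𝕜} (hf : ContDiff ℝ ∞ f) (k : ℕ) (x : ℝ) :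
    iteratedDeriv k (fun x : ℝ => (x : 𝕜) * deriv f x) x =
      (x : 𝕜) * iteratedDeriv (k + 1) f x + k * iteratedDeriv k f x := by
  have h := iteratedDeriv_of_hasDerivAt_seq (𝕜 := 𝕜) (g := fun k x =>
    (x : 𝕜) * iteratedDeriv (k + 1) f x + k * iteratedDeriv k f x) (fun j x => by
      have hx : HasDerivAt (fun x : ℝ => (x : 𝕜)) 1 x := by
        simpa using (RCLike.ofRealCLM (K := 𝕜)).hasDerivAt (x := x)
      have h1 := (hx.mul (hasDerivAt_iteratedDeriv hf (j + 1) x)).add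
        ((hasDerivAt_iteratedDeriv hf j x).const_mul (j : 𝕜))
      refine h1.congr_deriv ?_
      push_cast
      ring) k
  have h2 := congrFun h x
  simp only [iteratedDeriv_one, zero_add, Nat.cast_zero, zero_mul, add_zero] at h2
  exact h2

end Flatness

end HadamardOp

namespace HadamardOp

open Set Filter Topology
open scoped ContDiff

variable {𝕜 : Type*} [RCLike 𝕜] {U V : Opens ℝ}

/-! ### Flatness of `M φ` at zero when `φ` vanishes near zero. -/

section Flatness

theorem contDiff_mul_inv_pow {h : ℝ → 𝕜} (hh : ContDiff ℝ ∞ h) {b : ℝ} (hb : 0 < b)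
    (hs : ∀ x, h x ≠ 0 → b ≤ |x|) (n : ℕ) : ContDiff ℝ ∞ (fun t : ℝ => h t * ((t : 𝕜) ^ n)⁻¹) := by
  rw [contDiff_iff_contDiffAt]
  intro t
  by_cases ht : t = 0
  · subst ht
    refine (contDiffAt_const (c := (0 : 𝕜))).congr_of_eventuallyEq ?_
    filter_upwards [Metric.ball_mem_nhds (0 : ℝ) hb] with x hx
    rw [mem_ball_zero_iff, Real.norm_eq_abs] at hx
    have : h x = 0 := by
      by_contra hne
      exact absurd (hs x hne) (not_le.2 hx)
    rw [this, zero_mul]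
  · refine hh.contDiffAt.mul ?_
    refine (((contDiff_ofReal 𝕜).pow n).contDiffAt).inv ?_
    exact pow_ne_zero _ (by simpa using ht)

/-- A test function of parity `(-1)ᵏ` vanishing near zero is in the range of `θ - k`. -/
theorem exists_euler_solution {a b : ℝ} (hb : 0 < b) (haU : Metric.closedBall 0 a ⊆ (U : Set ℝ))
    (k : ℕ) (h : 𝓓(U, 𝕜)) (hs : ∀ x, h x ≠ 0 → b ≤ |x| ∧ |x| ≤ a)
    (hpar : ∀ x, h (-x) = (-1) ^ k * h x) :
    ∃ χ : 𝓓(U, 𝕜), h = eulerTest χ - (k : 𝕜) • χ := by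
  -- With the ansatz `χ = x ^ k * F` the equation becomes `F' = h / x ^ (k + 1)`. The parity of `h`
  -- makes this quotient odd, so its integral is zero and the primitive `F` has compact support.
  let w : ℝ → 𝕜 := fun t => h t * ((t : 𝕜) ^ (k + 1))⁻¹
  have hw : ContDiff ℝ ∞ w :=
    contDiff_mul_inv_pow (TestFunction.contDiff_infty h) hb (fun x hx => (hs x hx).1) _
  have hw0 : ∀ t, a < |t| → w t = 0 := by
    intro t ht
    have : h t = 0 := by
      by_contra hne
      exact absurd (hs t hne).2 (not_le.2 ht)
    simp [w, this]
  let F : ℝ → 𝕜 := fun x => ∫ t in (-(a + 1))..x, w t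
  have hF : ∀ x, HasDerivAt F (w x) x := fun x =>
    (hw.continuous.integral_hasStrictDerivAt _ x).hasDerivAt
  have hFs : ContDiff ℝ ∞ F := by
    rw [contDiff_infty_iff_deriv]
    exact ⟨fun x => (hF x).differentiableAt, (funext fun x => (hF x).deriv : deriv F = w) ▸ hw⟩
  have hodd : ∀ t, w (-t) = -w t := by
    intro t
    have h1 : ((-1 : 𝕜) ^ k) * ((-1 : 𝕜) ^ k)⁻¹ = 1 := mul_inv_cancel₀ (by simp)
    simp only [w]
    rw [hpar, RCLike.ofReal_neg, neg_pow (t : 𝕜), mul_inv, pow_succ (-1 : 𝕜), mul_inv]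
    calc _ = ((-1 : 𝕜) ^ k * ((-1 : 𝕜) ^ k)⁻¹) * (h t * (-1 : 𝕜)⁻¹ * ((t : 𝕜) ^ (k + 1))⁻¹) := by
          ring
      _ = _ := by rw [h1]; norm_num
  have hint : ∫ t in (-(a + 1))..(a + 1), w t = 0 := by
    have h1 := intervalIntegral.integral_comp_neg (a := -(a + 1)) (b := a + 1) w
    simp_rw [hodd] at h1
    rw [intervalIntegral.integral_neg, neg_neg] at h1
    exact self_eq_neg.1 h1.symm
  have hF0 : ∀ x, a < |x| → F x = 0 := by
    intro x hx
    have hz : ∀ u v : ℝ, (∀ t ∈ uIcc u v, a < |t|) → ∫ t in u..v, w t = 0 := fun u v huv => by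
      rw [intervalIntegral.integral_congr (g := fun _ => (0 : 𝕜)) fun t ht => hw0 t (huv t ht)]
      simp
    rcases lt_or_ge 0 x with h0 | h0
    · rw [abs_of_pos h0] at hx
      have h2 := intervalIntegral.integral_add_adjacent_intervals
        (hw.continuous.intervalIntegrable (μ := volume) (-(a + 1)) (a + 1))
        (hw.continuous.intervalIntegrable (a + 1) x)
      rw [hint, hz (a + 1) x (fun t ht => (lt_min (by linarith) hx).trans_le
        (ht.1.trans (le_abs_self t))), add_zero] at h2
      exact h2.symm
    · rw [abs_of_nonpos h0] at hx
      refine hz _ _ fun t ht => ?_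
      have h3 : t < -a := ht.2.trans_lt (max_lt (by linarith) (by linarith))
      exact (by linarith : a < -t).trans_le (neg_le_abs t)
  let χ : 𝓓(U, 𝕜) := mkTest U (fun x => (x : 𝕜) ^ k * F x) (((contDiff_ofReal 𝕜).pow k).mul hFs)
    (isCompact_closedBall 0 a) haU (fun x hx => by
      rw [mem_closedBall_zero_iff, Real.norm_eq_abs]
      by_contra hlt
      exact hx (by simp [hF0 x (not_le.1 hlt)]))
  refine ⟨χ, ?_⟩
  ext x
  change h x = (x : 𝕜) * deriv (fun x : ℝ => (x : 𝕜) ^ k * F x) x - (k : 𝕜) * ((x : 𝕜) ^ k * F x)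
  have hx : HasDerivAt (fun x : ℝ => (x : 𝕜)) 1 x := by
    simpa using (RCLike.ofRealCLM (K := 𝕜)).hasDerivAt (x := x)
  have hp : HasDerivAt (fun x : ℝ => (x : 𝕜) ^ k * F x)
      ((k : 𝕜) * (x : 𝕜) ^ (k - 1) * F x + (x : 𝕜) ^ k * w x) x := by
    have h1 := hx.pow k
    rw [mul_one] at h1
    exact h1.mul (hF x)
  rw [hp.deriv]
  have h2 : (x : 𝕜) * ((k : 𝕜) * (x : 𝕜) ^ (k - 1)) = k * (x : 𝕜) ^ k := by
    rcases k with _ | k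
    · simp
    · rw [Nat.add_sub_cancel, pow_succ]; ring
  have h3 : (x : 𝕜) ^ (k + 1) * w x = h x := by
    by_cases hx0 : x = 0
    · subst hx0
      have : h 0 = 0 := by
        by_contra hne
        have := (hs 0 hne).1
        rw [abs_zero] at this
        linarith
      simp [w, this]
    · have : (x : 𝕜) ^ (k + 1) ≠ 0 := pow_ne_zero _ (by simpa using hx0)
      simp only [w]
      field_simp
  rw [← h3, mul_add, ← mul_assoc _ _ (F x), h2, pow_succ]
  ring

/-- Here `g` has the parity opposite to `k`, so its `k`-th derivative is odd. -/
theorem iteratedDeriv_eq_zero_of_parity {g : ℝ → 𝕜} (hg : ContDiff ℝ ∞ g) (k : ℕ)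
    (h : ∀ x, g (-x) = -(-1) ^ k * g x) : iteratedDeriv k g 0 = 0 := by
  have h1 := iteratedDeriv_dilation hg (-1) k 0
  have h2 : (fun x => g (-1 * x)) = fun x => (-(-1) ^ k : 𝕜) * g x := by
    ext x
    rw [neg_one_mul, h]
  rw [h2, iteratedDeriv_const_mul_field, mul_zero, RCLike.ofReal_neg, RCLike.ofReal_one, neg_mul,
    neg_eq_self] at h1
  exact (mul_eq_zero.1 h1).resolve_left (by simp)

/-- The functions `M φ`, `φ` vanishing near zero, are flat at zero. -/
theorem iteratedDeriv_apply_zero {M : 𝓓(U, 𝕜) →ₗ[𝕜] 𝓓(U, 𝕜)} (hM : PreservesMoments M) {a b : ℝ}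
    (hb : 0 < b) (haU : Metric.closedBall 0 a ⊆ (U : Set ℝ)) (φ : 𝓓(U, 𝕜))
    (hs : ∀ x, φ x ≠ 0 → b ≤ |x| ∧ |x| ≤ a) (k : ℕ) : iteratedDeriv k (M φ) 0 = 0 := by
  -- `φ` is split into its parts of parity `(-1) ^ k` and `-(-1) ^ k`. The latter parity is
  -- preserved by `M` and forces the derivative at zero to vanish. The former part lies in the range
  -- of `θ - k`, which commutes with `M` and whose values have vanishing `k`-th derivative at zero.
  let s : 𝕜 := (-1) ^ k
  have hss : s * s = 1 := by simp [s, ← mul_pow]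
  let ψ : 𝓓(U, 𝕜) := mkTest U (fun x => φ (-1 * x))
    (contDiff_dilation (TestFunction.contDiff_infty φ) _) (isCompact_closedBall 0 a) haU
    (fun x hx => by
      rw [mem_closedBall_zero_iff, Real.norm_eq_abs]
      simpa using (hs _ hx).2)
  have hψ : ∀ x, ψ x = φ (-x) := fun x => by rw [← neg_one_mul]; rfl
  have h2 : iteratedDeriv k (M (φ - s • ψ)) 0 = 0 := by
    refine iteratedDeriv_eq_zero_of_parity (TestFunction.contDiff_infty _) k fun x => ?_
    have h3 := hM.dilation (φ := φ - s • ψ) (φ' := (-s) • (φ - s • ψ)) (a := -1) (by norm_num)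
      (fun x => by
        change -s * (φ x - s * ψ x) = φ (-1 * x) - s * ψ (-1 * x)
        rw [hψ, hψ, neg_one_mul, neg_neg]
        linear_combination (φ (-x)) * hss) x
    rw [neg_one_mul, map_smul] at h3
    exact h3.symm
  have h1 : iteratedDeriv k (M (φ + s • ψ)) 0 = 0 := by
    obtain ⟨χ, hχ⟩ := exists_euler_solution hb haU k (φ + s • ψ) (fun x hx => by
      change φ x + s * ψ x ≠ 0 at hx
      by_cases hφ : φ x = 0
      · rw [hφ, zero_add, hψ] at hx
        simpa using hs _ (right_ne_zero_of_mul hx)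
      · exact hs x hφ) (fun x => by
        change φ (-x) + s * ψ (-x) = s * (φ x + s * ψ x)
        rw [hψ, hψ, neg_neg]
        linear_combination (-φ (-x)) * hss)
    rw [hχ, map_sub, map_smul, hM.euler]
    have h4 := (derivEval (𝕜 := 𝕜) U k 0).map_sub (eulerTest (M χ)) ((k : 𝕜) • M χ)
    rw [(derivEval (𝕜 := 𝕜) U k 0).map_smul] at h4
    refine h4.trans ?_
    have h5 := iteratedDeriv_mul_deriv (TestFunction.contDiff_infty (M χ)) k 0
    rw [RCLike.ofReal_zero, zero_mul, zero_add] at h5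
    exact sub_eq_zero.2 h5
  have h6 : (2 : 𝕜) • φ = (φ + s • ψ) + (φ - s • ψ) := by
    rw [two_smul]
    abel
  have h7 := (derivEval (𝕜 := 𝕜) U k 0).map_add (M (φ + s • ψ)) (M (φ - s • ψ))
  have h8 := (derivEval (𝕜 := 𝕜) U k 0).map_smul (2 : 𝕜) (M φ)
  rw [← map_add, ← h6, map_smul, h8] at h7
  have h9 : (2 : 𝕜) • iteratedDeriv k (M φ) 0 = 0 := by
    exact h7.trans ((congrArg₂ (· + ·) h1 h2).trans (add_zero 0))
  exact (smul_eq_zero.1 h9).resolve_left two_ne_zero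

/-- Taylor's formula with vanishing derivatives at zero and the local bound on the `k`-th one. The
power of `|y|` for small `y` becomes decay of `T` at infinity. -/
theorem exists_flatness_bound {M : 𝓓(U, 𝕜) →ₗ[𝕜] 𝓓(U, 𝕜)} (hM : PreservesMoments M)
    (hbM : IsLocallyBounded M) {a b : ℝ} (hb : 0 < b)
    (haU : Metric.closedBall 0 a ⊆ (U : Set ℝ)) (k : ℕ) : ∃ (m : ℕ) (C : ℝ), 0 ≤ C ∧
      ∀ φ : 𝓓(U, 𝕜), (∀ x, φ x ≠ 0 → b ≤ |x| ∧ |x| ≤ a) → ∀ B : ℝ, DerivBound m B φ →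
        ∀ y, ‖M φ y‖ ≤ C * B * |y| ^ k := by
  obtain ⟨L, -, -, -, hL⟩ := hbM _ (isCompact_closedBall 0 a) haU
  obtain ⟨m, C, hC⟩ := hL k
  refine ⟨m, |C|, abs_nonneg _, fun φ hφ B hB y => ?_⟩
  refine norm_le_pow_of_iteratedDeriv_eq_zero (TestFunction.contDiff_infty _)
    (fun j _ => iteratedDeriv_apply_zero hM hb haU φ hφ j) (fun x => ?_) y
  refine (hC φ (fun x hx => ?_) B hB x).trans
    (mul_le_mul_of_nonneg_right (le_abs_self C) hB.nonneg)
  rw [mem_closedBall_zero_iff, Real.norm_eq_abs]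
  exact (hφ x hx).2

end Flatness

end HadamardOp

namespace HadamardOp

open Set Filter Topology
open scoped ContDiff

variable {𝕜 : Type*} [RCLike 𝕜] {U V : Opens ℝ}

/-! ### The dilation-invariant operators `xⁱ (d/dx)ⁱ` and powers of `θ*`. -/

section PowDeriv

/-- The operator `f ↦ xⁱ f⁽ⁱ⁾`. -/
noncomputable def powDeriv (i : ℕ) (f : ℝ → 𝕜) : ℝ → 𝕜 :=
  fun x => (x : 𝕜) ^ i * iteratedDeriv i f x

/-- The operator `φ ↦ xⁱ φ⁽ⁱ⁾` on test functions, as a linear map. -/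
noncomputable def powDerivLM (U : Opens ℝ) (i : ℕ) : 𝓓(U, 𝕜) →ₗ[𝕜] (ℝ → 𝕜) where
  toFun φ := powDeriv i φ
  map_add' φ ψ := by
    ext x
    have h := congrFun (map_add (derivLM (𝕜 := 𝕜) U i) φ ψ) x
    exact (congrArg ((x : 𝕜) ^ i * ·) h).trans (mul_add _ _ _)
  map_smul' c φ := by
    ext x
    have h := congrFun (map_smul (derivLM (𝕜 := 𝕜) U i) c φ) x
    exact (congrArg ((x : 𝕜) ^ i * ·) h).trans (mul_left_comm _ _ _)

@[simp]
theorem powDerivLM_apply (i : ℕ) (φ : 𝓓(U, 𝕜)) : powDerivLM U i φ = powDeriv i φ := rfl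

theorem contDiff_iteratedDeriv {f : ℝ → 𝕜} (hf : ContDiff ℝ ∞ f) (i : ℕ) :
    ContDiff ℝ ∞ (iteratedDeriv i f) := by
  rw [iteratedDeriv_eq_iterate]
  exact hf.iterate_deriv i

theorem contDiff_powDeriv {f : ℝ → 𝕜} (hf : ContDiff ℝ ∞ f) (i : ℕ) :
    ContDiff ℝ ∞ (powDeriv i f) :=
  ((contDiff_ofReal 𝕜).pow i).mul (contDiff_iteratedDeriv hf i)

theorem hasCompactSupport_powDeriv {f : ℝ → 𝕜} (hf : HasCompactSupport f) (i : ℕ) :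
    HasCompactSupport (powDeriv i f) :=
  (hf.iteratedDeriv' i).mul_left

theorem hasDerivAt_ofReal (x : ℝ) : HasDerivAt (fun x : ℝ => (x : 𝕜)) 1 x := by
  simpa using (RCLike.ofRealCLM (K := 𝕜)).hasDerivAt (x := x)

/-- In operator form `xⁱ⁺¹ Dⁱ⁺¹ = (θ - i) xⁱ Dⁱ`, the recursion behind every comparison of `xⁱ Dⁱ`
with powers of `θ` or `θ*`. -/
theorem mul_deriv_powDeriv {f : ℝ → 𝕜} (hf : ContDiff ℝ ∞ f) (i : ℕ) (x : ℝ) :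
    (x : 𝕜) * deriv (powDeriv i f) x = i * powDeriv i f x + powDeriv (i + 1) f x := by
  have h1 := ((hasDerivAt_ofReal (𝕜 := 𝕜) x).pow i).mul (hasDerivAt_iteratedDeriv hf i x)
  have h2 : deriv (powDeriv i f) x = _ := h1.deriv
  rw [h2, mul_one]
  have h3 : (x : 𝕜) * ((i : 𝕜) * (x : 𝕜) ^ (i - 1)) = i * (x : 𝕜) ^ i := by
    rcases i with _ | i
    · simp
    · rw [Nat.add_sub_cancel, pow_succ]; ring
  simp only [powDeriv, Pi.pow_apply]
  rw [mul_add, ← mul_assoc, h3, pow_succ]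
  ring

theorem contDiff_mul_ofReal {f : ℝ → 𝕜} (hf : ContDiff ℝ ∞ f) :
    ContDiff ℝ ∞ (fun x : ℝ => (x : 𝕜) * f x) :=
  (contDiff_ofReal 𝕜).mul hf

theorem eulerTranspose_apply {f : ℝ → 𝕜} (hf : ContDiff ℝ ∞ f) (x : ℝ) :
    eulerTranspose f x = -(f x + (x : 𝕜) * deriv f x) := by
  have h1 := (hasDerivAt_ofReal (𝕜 := 𝕜) x).mul (hf.differentiable (by simp) x).hasDerivAt
  rw [one_mul] at h1
  exact congrArg Neg.neg h1.deriv

theorem contDiff_eulerTranspose {f : ℝ → 𝕜} (hf : ContDiff ℝ ∞ f) :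
    ContDiff ℝ ∞ (eulerTranspose f) :=
  (contDiff_infty_iff_deriv.1 (contDiff_mul_ofReal hf)).2.neg

theorem contDiff_iterate_eulerTranspose {f : ℝ → 𝕜} (hf : ContDiff ℝ ∞ f) (j : ℕ) :
    ContDiff ℝ ∞ (eulerTranspose^[j] f) := by
  induction j with
  | zero => exact hf
  | succ j ih =>
    rw [Function.iterate_succ_apply']
    exact contDiff_eulerTranspose ih

theorem hasCompactSupport_iterate_eulerTranspose {f : ℝ → 𝕜} (hf : HasCompactSupport f) (j : ℕ) :
    HasCompactSupport (eulerTranspose^[j] f) := by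
  induction j with
  | zero => exact hf
  | succ j ih =>
    rw [Function.iterate_succ_apply']
    have h : HasCompactSupport (deriv fun y : ℝ => (y : 𝕜) * eulerTranspose^[j] f y) :=
      (HasCompactSupport.mul_left ih).deriv
    exact h.neg

/-- The operators `xⁱ (d/dx)ⁱ` are linear combinations of powers of the transposed Euler
derivative. -/
theorem exists_powDeriv_eq_sum (i : ℕ) : ∃ c : ℕ → 𝕜, (∀ j, i < j → c j = 0) ∧
    ∀ f : ℝ → 𝕜, ContDiff ℝ ∞ f → ∀ N, i < N → ∀ x,
      powDeriv i f x = ∑ j ∈ Finset.range N, c j * (eulerTranspose^[j] f) x := by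
  induction i with
  | zero =>
    refine ⟨fun j => if j = 0 then 1 else 0, fun j hj => if_neg hj.ne', fun f hf N hN x => ?_⟩
    rw [Finset.sum_eq_single_of_mem 0 (Finset.mem_range.2 hN) (fun j _ hj => by simp [hj])]
    simp [powDeriv]
  | succ i ih =>
    obtain ⟨c, hc, h⟩ := ih
    -- The coefficients of `(-θ* - 1 - i) ∑ c j θ*ʲ`, obtained by inserting `θ = -θ* - 1` into the
    -- recursion for `xⁱ⁺¹ Dⁱ⁺¹`.
    refine ⟨fun j => (if j = 0 then 0 else -c (j - 1)) - (1 + i) * c j, fun j hj => ?_,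
      fun f hf N hN x => ?_⟩
    · simp [hc j (by omega), hc (j - 1) (by omega)]
    · obtain ⟨N, rfl⟩ : ∃ N', N = N' + 1 := ⟨N - 1, by omega⟩
      have hN' : i < N := by omega
      have h1 := mul_deriv_powDeriv hf i x
      have h2 : deriv (powDeriv i f) x =
          ∑ j ∈ Finset.range N, c j * deriv (eulerTranspose^[j] f) x := by
        rw [funext fun x => h f hf N hN' x]
        refine HasDerivAt.deriv (HasDerivAt.fun_sum fun j _ => ?_)
        exact ((contDiff_iterate_eulerTranspose hf j).differentiable (by simp) x).hasDerivAt.const_mul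
          (c j)
      have h3 : ∀ j, (x : 𝕜) * deriv (eulerTranspose^[j] f) x =
          -(eulerTranspose^[j + 1] f) x - (eulerTranspose^[j] f) x := fun j => by
        rw [Function.iterate_succ_apply',
          eulerTranspose_apply (contDiff_iterate_eulerTranspose hf j)]
        ring
      have h4 : powDeriv (i + 1) f x = (x : 𝕜) * deriv (powDeriv i f) x - i * powDeriv i f x := by
        rw [h1]; ring
      simp only [sub_mul]
      rw [Finset.sum_sub_distrib, Finset.sum_range_succ' _ N, Finset.sum_range_succ _ N,
        hc N hN', h4, h2, h f hf N hN' x, Finset.mul_sum]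
      simp only [mul_left_comm (x : 𝕜), h3, if_true, zero_mul, mul_zero, add_zero, add_eq_zero,
        one_ne_zero, and_false, if_false, Nat.add_sub_cancel]
      rw [Finset.mul_sum, ← Finset.sum_sub_distrib, ← Finset.sum_sub_distrib]
      refine Finset.sum_congr rfl fun j _ => ?_
      ring

end PowDeriv

/-! ### From weighted `L¹` bounds to membership in `𝒪'_H`. -/

section Decay

/-- A distribution is in `𝒪'_H` if it is bounded by weighted `L¹` norms of `xⁱ φ⁽ⁱ⁾`. -/
theorem isOH_of_bounds {T : Dist 𝕜 ⊤} (h : ∀ k : ℕ, ∃ (S : Set ℝ) (N : ℕ) (C : ℝ),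
    MeasurableSet S ∧ 0 ≤ C ∧ ∀ φ : 𝓓((⊤ : Opens ℝ), 𝕜), ‖T φ‖ ≤ C * ∑ i ∈ Finset.range N,
      ∫ x in S, ((1 + x ^ 2) ^ k)⁻¹ * ‖powDeriv i φ x‖) : IsOH T := by
  intro k
  -- One extra power makes the weight integrable even for `k = 0`, so that the measure `μ` with this
  -- density is finite and `L¹` duality applies.
  obtain ⟨S, N, C, hS, hC, hb⟩ := h (k + 1)
  let w : ℝ → NNReal := fun x => ((1 + ‖x‖₊ ^ 2) ^ (k + 1))⁻¹
  have hwr : ∀ x, (w x : ℝ) = ((1 + x ^ 2) ^ (k + 1))⁻¹ := fun x => by simp [w]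
  have hwc : Continuous w := by
    refine Continuous.inv₀ (by fun_prop) fun x => by positivity
  let μ : Measure ℝ := (volume.restrict S).withDensity fun x => w x
  have hwint : Integrable (fun x => (w x : ℝ)) (volume.restrict S) := by
    refine (integrable_inv_one_add_sq.mono' (NNReal.continuous_coe.comp hwc).aestronglyMeasurable
      (ae_of_all _ fun x => ?_)).restrict
    change ‖(w x : ℝ)‖ ≤ _
    rw [hwr, Real.norm_of_nonneg (by positivity)]
    refine inv_anti₀ (by positivity) ?_
    exact le_self_pow₀ (by nlinarith [sq_nonneg x]) (by omega)
  have : IsFiniteMeasure μ := by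
    have h1 := isFiniteMeasure_withDensity_ofReal hwint.2
    simpa only [ENNReal.ofReal_coe_nnreal] using h1
  have hD : ∀ (i : Fin N) (φ : 𝓓((⊤ : Opens ℝ), 𝕜)), MemLp (powDerivLM ⊤ i φ) ⊤ μ := by
    intro i φ
    have hc := (contDiff_powDeriv (TestFunction.contDiff_infty φ) i).continuous
    obtain ⟨B, hB⟩ := hc.bounded_above_of_compact_support
      (hasCompactSupport_powDeriv φ.hasCompactSupport i)
    exact memLp_top_of_bound hc.aestronglyMeasurable B (ae_of_all _ hB)
  obtain ⟨s, B, hsm, hsB, hs⟩ := exists_L1_representation (μ := μ)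
    (fun i : Fin N => powDerivLM (𝕜 := 𝕜) ⊤ i) hD
    { toFun := fun φ => T φ
      map_add' := fun φ ψ => by rw [map_add]
      map_smul' := fun c φ => by rw [map_smul]; rfl } C hC (fun φ => by
      refine (hb φ).trans (le_of_eq ?_)
      rw [Finset.sum_range]
      congr 1
      refine Finset.sum_congr rfl fun i _ => ?_
      rw [integral_withDensity_eq_integral_smul hwc.measurable]
      refine integral_congr_ae (ae_of_all _ fun x => ?_)
      simp only [NNReal.smul_def, hwr, smul_eq_mul, powDerivLM_apply])
  choose c hc0 hc using fun i => exists_powDeriv_eq_sum (𝕜 := 𝕜) i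
  let τ : Fin N → ℝ → 𝕜 := fun i => S.indicator fun x => ((w x : ℝ) : 𝕜) * s i x
  have hτm : ∀ i, StronglyMeasurable (τ i) := fun i =>
    ((RCLike.continuous_ofReal.comp (NNReal.continuous_coe.comp hwc)).stronglyMeasurable.mul
      (hsm i)).indicator hS
  have hτb : ∀ i x, (1 + x ^ 2) ^ (k + 1) * ‖τ i x‖ ≤ B := by
    intro i x
    have hB0 : 0 ≤ B := (norm_nonneg _).trans (hsB i x)
    by_cases hx : x ∈ S
    · simp only [τ, indicator_of_mem hx, norm_mul, RCLike.norm_ofReal, hwr]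
      rw [abs_of_nonneg (by positivity), mul_inv_cancel_left₀ (by positivity)]
      exact hsB i x
    · simp only [τ, indicator_of_notMem hx, norm_zero, mul_zero]
      exact hB0
  have hweight : ∀ i : Fin N,
      MemLp (fun x : ℝ => (((1 + |x| ^ 2) ^ ((k : ℝ) / 2) : ℝ) : 𝕜) * τ i x) ⊤ volume := by
    intro i
    refine memLp_top_of_bound (C := B) ?_ (ae_of_all _ fun x => ?_)
    · refine (Continuous.aestronglyMeasurable ?_).mul (hτm i).aestronglyMeasurable
      refine RCLike.continuous_ofReal.comp (Continuous.rpow_const (by fun_prop) fun x => ?_)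
      exact Or.inl (by positivity)
    · rw [norm_mul, RCLike.norm_ofReal, abs_of_nonneg (by positivity), sq_abs]
      refine (mul_le_mul_of_nonneg_right ?_ (norm_nonneg _)).trans (hτb i x)
      rw [← Real.rpow_natCast (1 + x ^ 2) (k + 1)]
      have h1 : 1 ≤ 1 + x ^ 2 := by nlinarith [sq_nonneg x]
      refine Real.rpow_le_rpow_of_exponent_le h1 ?_
      push_cast
      have : (0 : ℝ) ≤ k := Nat.cast_nonneg k
      linarith
  have hint : ∀ (i : Fin N) (g : ℝ → 𝕜), Continuous g → HasCompactSupport g →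
      Integrable fun x => τ i x * g x := by
    intro i g hg hgs
    refine (hg.integrable_of_hasCompactSupport hgs).bdd_mul (c := B) (hτm i).aestronglyMeasurable
      (ae_of_all _ fun x => (le_trans ?_ (hτb i x)))
    have h1 : 1 ≤ 1 + x ^ 2 := by nlinarith [sq_nonneg x]
    exact le_mul_of_one_le_left (norm_nonneg _) (one_le_pow₀ h1)
  -- Each `xⁱ Dⁱ` with `i < N` is rewritten in powers `θ*ʲ` with `j < N`, and the densities are
  -- collected by `j`.
  refine ⟨N, fun j x => ∑ i : Fin N, c i j * τ i x, fun j _ => ?_, fun φ => ?_⟩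
  · have h1 := memLp_finsetSum (μ := volume) (p := ⊤) Finset.univ
      (f := fun (i : Fin N) (x : ℝ) => c i j * ((((1 + |x| ^ 2) ^ ((k : ℝ) / 2) : ℝ) : 𝕜) * τ i x))
      fun i _ => (hweight i).const_mul (c i j)
    simp only [Finset.mul_sum, mul_left_comm _ (c _ j)]
    exact h1
  · have h1 : T φ = ∑ i : Fin N, ∫ x, τ i x * powDeriv i φ x := by
      refine (hs φ).trans (Finset.sum_congr rfl fun i _ => ?_)
      rw [integral_withDensity_eq_integral_smul hwc.measurable, ← integral_indicator hS]
      refine integral_congr_ae (ae_of_all _ fun x => ?_)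
      by_cases hx : x ∈ S
      · simp only [τ, indicator_of_mem hx, powDerivLM_apply]
        rw [NNReal.smul_def, RCLike.real_smul_eq_coe_mul, mul_assoc]
      · simp only [τ, indicator_of_notMem hx, zero_mul]
    have hφ := TestFunction.contDiff_infty φ
    have hint' : ∀ (i : Fin N) (j : ℕ), Integrable fun x =>
        c i j * (τ i x * (eulerTranspose^[j] φ) x) := fun i j =>
      (hint i _ (contDiff_iterate_eulerTranspose hφ j).continuous
        (hasCompactSupport_iterate_eulerTranspose φ.hasCompactSupport j)).const_mul _
    rw [h1]
    have h2 : ∀ i : Fin N, ∫ x, τ i x * powDeriv i φ x = ∑ j ∈ Finset.range N,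
        ∫ x, c i j * (τ i x * (eulerTranspose^[j] φ) x) := by
      intro i
      rw [← integral_finsetSum _ fun j _ => hint' i j]
      refine integral_congr_ae (ae_of_all _ fun x => ?_)
      simp only
      rw [hc i φ hφ N i.2 x, Finset.mul_sum]
      exact Finset.sum_congr rfl fun j _ => mul_left_comm _ _ _
    simp_rw [h2]
    rw [Finset.sum_comm]
    refine Finset.sum_congr rfl fun j _ => ?_
    rw [← integral_finsetSum _ fun i _ => hint' i j]
    refine integral_congr_ae (ae_of_all _ fun x => ?_)
    simp only
    rw [Finset.sum_mul]
    exact Finset.sum_congr rfl fun i _ => (mul_assoc _ _ _).symm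

end Decay

end HadamardOp

namespace HadamardOp

open Set Filter Topology
open scoped ContDiff

variable {𝕜 : Type*} [RCLike 𝕜] {U V : Opens ℝ}

/-! ### Dyadic decomposition: flatness at zero yields decay at infinity. -/

section Decay

theorem sum_test_apply {ι : Type*} (s : Finset ι) (f : ι → 𝓓(U, 𝕜)) (x : ℝ) :
    (∑ i ∈ s, f i) x = ∑ i ∈ s, f i x := by
  have h := congrFun (map_sum (derivLM (𝕜 := 𝕜) U 0) f s) x
  simpa only [Finset.sum_apply, derivLM_apply, iteratedDeriv_zero] using h

theorem exists_annulus_cutoff (𝕜 : Type*) [RCLike 𝕜] {a : ℝ} (ha : 0 < a) :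
    ∃ η : ℝ → 𝕜, ContDiff ℝ ∞ η ∧ (∀ x, |x| ≤ a / 2 → η x = 1) ∧ ∀ x, a ≤ |x| → η x = 0 := by
  obtain ⟨η, h1, -, h2, W, -, hW, h3⟩ := exists_cutoff 𝕜 (isCompact_closedBall (0 : ℝ) (a / 2))
    ⟨Metric.ball 0 a, Metric.isOpen_ball⟩ (Metric.closedBall_subset_ball (half_lt_self ha))
  refine ⟨η, h1, fun x hx => h3 x (hW (by simpa using hx)), fun x hx => ?_⟩
  by_contra hne
  have := h2 (subset_tsupport _ hne)
  simp only [Opens.coe_mk, mem_ball_zero_iff, Real.norm_eq_abs] at this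
  linarith

/-- The values of `T` on localizations of `φ` to dyadic annuli decay rapidly. -/
theorem exists_annulus_bound {M : 𝓓(U, 𝕜) →ₗ[𝕜] 𝓓(U, 𝕜)}
    (hM : PreservesMoments M) (hb : IsLocallyBounded M) {T : Dist 𝕜 ⊤}
    (hT : ∀ φ : 𝓓(U, 𝕜), IsDualDilation T φ (M φ)) {a b : ℝ} (hpos : 0 < b)
    (haU : Metric.closedBall 0 a ⊆ (U : Set ℝ)) {χ : ℝ → 𝕜} (hχ : ContDiff ℝ ∞ χ)
    (hχs : ∀ x, χ x ≠ 0 → b ≤ |x| ∧ |x| ≤ a) {R : ℝ} (hR : 0 < R) (k : ℕ) :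
    ∃ (N : ℕ) (C : ℝ), 0 ≤ C ∧ ∀ (φ : 𝓓((⊤ : Opens ℝ), 𝕜)) (y : ℝ), 0 < y → y ≤ R →
      ‖T (mulTest (fun x => χ (y * x)) (contDiff_dilation hχ y) φ)‖ ≤ C * y *
        ∑ i ∈ Finset.range N, ∫ x in {x : ℝ | b / R ≤ |x|},
          ((1 + x ^ 2) ^ k)⁻¹ * ‖powDeriv i φ x‖ := by
  let A : Set ℝ := {x | b ≤ |x| ∧ |x| ≤ a}
  have hA : IsClosed A := (isClosed_le continuous_const continuous_abs).inter
    (isClosed_le continuous_abs continuous_const)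
  have hχA : tsupport χ ⊆ A := closure_minimal hχs hA
  have hAK : A ⊆ Metric.closedBall 0 a := fun x hx => by simpa using hx.2
  have hχK : Function.support χ ⊆ Metric.closedBall 0 a := (subset_tsupport _).trans (hχA.trans hAK)
  have hχc : HasCompactSupport χ :=
    HasCompactSupport.of_support_subset_isCompact (isCompact_closedBall 0 a) hχK
  -- The order `2 * k` is right because with `z = y⁻¹ * x` one has `y² (1 + z²) = y² + x² ≤ D` on
  -- the annulus, so `y ^ (2 * k)` is at most `D ^ k` times the weight at `z`.
  obtain ⟨m, C, hC, hflat⟩ := exists_flatness_bound hM hb hpos haU (2 * k)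
  obtain ⟨C', hC', hloc⟩ := exists_localization_bound hχ hχc m
  -- Since `b ≤ |x|` on the annulus, `1 ≤ E * |x| ^ i`; this converts `y⁻ⁱ φ⁽ⁱ⁾(z)` into `zⁱ
  -- φ⁽ⁱ⁾(z)`.
  let E : ℝ := (1 + b⁻¹) ^ (m + 2)
  let D : ℝ := R ^ 2 + a ^ 2
  have hD : 0 ≤ D := by positivity
  have hE : 0 ≤ E := by positivity
  let S : Set ℝ := {x : ℝ | b / R ≤ |x|}
  have hS : MeasurableSet S := (isClosed_le continuous_const continuous_abs).measurableSet
  refine ⟨m + 2, C * C' * E * D ^ k, by positivity, fun φ y hy hyR => ?_⟩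
  have hφ := TestFunction.contDiff_infty φ
  let G : ℕ → ℝ → ℝ := fun i => S.indicator fun x => ((1 + x ^ 2) ^ k)⁻¹ * ‖powDeriv i φ x‖
  have hGi : ∀ i, Integrable (G i) := by
    intro i
    refine (Continuous.integrable_of_hasCompactSupport ?_ ?_).indicator hS
    · refine Continuous.mul ?_ (contDiff_powDeriv hφ i).continuous.norm
      exact Continuous.inv₀ (by fun_prop) fun x => by positivity
    · exact (hasCompactSupport_powDeriv φ.hasCompactSupport i).norm.mul_left
  have hpt : ∀ i < m + 2, ∀ x ∈ tsupport χ,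
      y ^ (2 * k) * ‖iteratedDeriv i (fun x => φ (y⁻¹ * x)) x‖ ≤ E * D ^ k * G i (y⁻¹ * x) := by
    intro i hi x hx
    obtain ⟨hbx, hxa⟩ := hχA hx
    have hxS : y⁻¹ * x ∈ S := by
      change b / R ≤ |y⁻¹ * x|
      rw [abs_mul, abs_of_pos (inv_pos.2 hy), div_eq_inv_mul]
      exact mul_le_mul (inv_anti₀ hy hyR) hbx hpos.le (inv_pos.2 hy).le
    simp only [G, indicator_of_mem hxS, powDeriv]
    rw [iteratedDeriv_dilation hφ, norm_mul, norm_mul, norm_pow, norm_pow, RCLike.norm_ofReal,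
      RCLike.norm_ofReal, abs_mul, mul_pow]
    have h1 : 1 ≤ E * |x| ^ i := by
      have h2 : 1 ≤ (1 + b⁻¹) * |x| := by
        have : b⁻¹ * b = 1 := inv_mul_cancel₀ hpos.ne'
        have h3 : b⁻¹ * b ≤ b⁻¹ * |x| := mul_le_mul_of_nonneg_left hbx (inv_pos.2 hpos).le
        nlinarith [abs_nonneg x]
      calc (1 : ℝ) ≤ ((1 + b⁻¹) * |x|) ^ i := one_le_pow₀ h2
        _ = (1 + b⁻¹) ^ i * |x| ^ i := mul_pow _ _ _
        _ ≤ E * |x| ^ i := by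
          refine mul_le_mul_of_nonneg_right (pow_le_pow_right₀ ?_ hi.le) (by positivity)
          linarith [inv_pos.2 hpos]
    have h4 : y ^ (2 * k) ≤ D ^ k * ((1 + (y⁻¹ * x) ^ 2) ^ k)⁻¹ := by
      rw [← div_eq_mul_inv, ← div_pow, pow_mul]
      refine pow_le_pow_left₀ (by positivity) ?_ k
      rw [le_div_iff₀ (by positivity), mul_add, mul_one, ← mul_pow, mul_inv_cancel_left₀ hy.ne']
      refine add_le_add (pow_le_pow_left₀ hy.le hyR 2) ?_
      rw [← sq_abs x]
      exact pow_le_pow_left₀ (abs_nonneg x) hxa 2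
    calc y ^ (2 * k) * (|y⁻¹| ^ i * ‖iteratedDeriv i φ (y⁻¹ * x)‖)
        ≤ (D ^ k * ((1 + (y⁻¹ * x) ^ 2) ^ k)⁻¹) *
          ((E * |x| ^ i) * (|y⁻¹| ^ i * ‖iteratedDeriv i φ (y⁻¹ * x)‖)) := by
          refine mul_le_mul h4 (le_mul_of_one_le_left (by positivity) h1) (by positivity)
            (by positivity)
      _ = _ := by ring
  let Φ : 𝓓(U, 𝕜) := mkTest U (fun x => χ x * φ (y⁻¹ * x)) (hχ.mul (contDiff_dilation hφ _))
    (isCompact_closedBall 0 a) haU ((Function.support_mul_subset_left _ _).trans hχK)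
  -- Dilation moves the far annulus into `U`: the value of `T` is that of `M Φ` at `y`, where `Φ` is
  -- supported in the fixed annulus `A`.
  have h1 := (hT Φ).apply_eq hy.ne' (mulTest (fun x => χ (y * x)) (contDiff_dilation hχ y) φ)
    (fun x => by
      change χ (y * x) * φ x = χ (x * y) * φ (y⁻¹ * (x * y))
      rw [mul_comm x y, inv_mul_cancel_left₀ hy.ne'])
  rw [h1]
  refine (hflat Φ (fun x hx => hχs x (left_ne_zero_of_mul hx)) _
    (hloc _ (contDiff_dilation hφ y⁻¹)) y).trans ?_
  rw [abs_of_pos hy]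
  have h2 : ∀ i ∈ Finset.range (m + 2), y ^ (2 * k) *
      ∫ x in tsupport χ, ‖iteratedDeriv i (fun x => φ (y⁻¹ * x)) x‖ ≤
        E * D ^ k * (y * ∫ x in S, ((1 + x ^ 2) ^ k)⁻¹ * ‖powDeriv i φ x‖) := by
    intro i hi
    -- The Jacobian supplies the factor `y` that makes the sum over dyadic scales converge.
    have h3 : ∫ x, G i (y⁻¹ * x) = y * ∫ x in S, ((1 + x ^ 2) ^ k)⁻¹ * ‖powDeriv i φ x‖ := by
      rw [Measure.integral_comp_mul_left, inv_inv, abs_of_pos hy, smul_eq_mul,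
        ← integral_indicator hS]
    rw [← integral_const_mul, ← h3, ← integral_const_mul]
    have hGy : Integrable fun x => E * D ^ k * G i (y⁻¹ * x) :=
      ((hGi i).comp_mul_left' (inv_ne_zero hy.ne')).const_mul _
    refine (setIntegral_mono_on ?_ hGy.integrableOn (isClosed_tsupport χ).measurableSet
      fun x hx => hpt i (Finset.mem_range.1 hi) x hx).trans
      (setIntegral_le_integral hGy (ae_of_all _ fun x => ?_))
    · refine (Continuous.integrable_of_hasCompactSupport ?_ ?_).integrableOn
      · exact continuous_const.mul (contDiff_iteratedDeriv (contDiff_dilation hφ _) i).continuous.norm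
      · exact ((((φ.hasCompactSupport).comp_homeomorph
          (Homeomorph.mulLeft₀ y⁻¹ (inv_ne_zero hy.ne'))).iteratedDeriv' i).norm).mul_left
    · refine mul_nonneg (by positivity) (indicator_nonneg (fun x _ => by positivity) _)
  calc _ = C * C' * ∑ i ∈ Finset.range (m + 2), y ^ (2 * k) *
      ∫ x in tsupport χ, ‖iteratedDeriv i (fun x => φ (y⁻¹ * x)) x‖ := by
        rw [← Finset.mul_sum]; ring
    _ ≤ C * C' * ∑ i ∈ Finset.range (m + 2), E * D ^ k *
        (y * ∫ x in S, ((1 + x ^ 2) ^ k)⁻¹ * ‖powDeriv i φ x‖) := by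
        refine mul_le_mul_of_nonneg_left (Finset.sum_le_sum h2) (by positivity)
    _ = _ := by
        rw [← Finset.mul_sum, ← Finset.mul_sum]; ring

/-- A telescoping sum cuts `φ` into pieces on dyadic annuli and a piece near zero killed by `T`. The
number of pieces depends on `φ`, but the bounds form a geometric series, so the constant does not.
-/
theorem isDH_of_dualDilation (h0 : (0 : ℝ) ∈ U) {M : 𝓓(U, 𝕜) →ₗ[𝕜] 𝓓(U, 𝕜)}
    (hM : PreservesMoments M) (hb : IsLocallyBounded M) {T : Dist 𝕜 ⊤}
    (hT : ∀ φ : 𝓓(U, 𝕜), IsDualDilation T φ (M φ)) : IsDH T := by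
  obtain ⟨δ, hδ, hvan⟩ := exists_vanishing_near_zero h0 hT hb
  refine ⟨isOH_of_bounds fun k => ?_, δ, hδ, supp_away_from_zero hvan⟩
  obtain ⟨a, ha, haU⟩ := Metric.nhds_basis_closedBall.mem_iff.1 (U.isOpen.mem_nhds h0)
  obtain ⟨η, hη, hη1, hη0⟩ := exists_annulus_cutoff 𝕜 ha
  let χ : ℝ → 𝕜 := fun x => η x - η (2 * x)
  have hχ : ContDiff ℝ ∞ χ := hη.sub (contDiff_dilation hη 2)
  have hχs : ∀ x, χ x ≠ 0 → a / 4 ≤ |x| ∧ |x| ≤ a := by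
    intro x hx
    constructor
    · by_contra hlt
      refine hx ?_
      simp only [χ]
      rw [hη1 x (by linarith), hη1 (2 * x) (by rw [abs_mul, abs_two]; linarith), sub_self]
    · by_contra hlt
      refine hx ?_
      simp only [χ]
      rw [hη0 x (by linarith), hη0 (2 * x) (by rw [abs_mul, abs_two]; linarith [abs_nonneg x]),
        sub_self]
  -- With this choice `η (2 * R * x) ≠ 0` forces `|x| < δ / 2`, inside the zone where `T` vanishes.
  let R : ℝ := a / δ
  have hR : 0 < R := by positivity
  obtain ⟨N, C, hC, hbd⟩ := exists_annulus_bound hM hb hT (by positivity : 0 < a / 4) haU hχ hχs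
    hR k
  let S : Set ℝ := {x : ℝ | a / 4 / R ≤ |x|}
  let y : ℕ → ℝ := fun n => R * (1 / 2) ^ n
  refine ⟨S, N, C * (R * 2), (isClosed_le continuous_const continuous_abs).measurableSet,
    by positivity, fun φ => ?_⟩
  obtain ⟨r, hr⟩ := φ.hasCompactSupport.isCompact.isBounded.exists_norm_le
  -- So many scales that the last cutoff in the telescoping sum equals one on the support of `φ`.
  obtain ⟨n, hn⟩ := exists_pow_lt_of_lt_one (x := a / 2 / (R * (|r| + 1))) (y := (1 / 2 : ℝ))
    (by positivity) (by norm_num)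
  have hsum : φ = mulTest (fun x => η (2 * R * x)) (contDiff_dilation hη _) φ +
      ∑ i ∈ Finset.range (n + 1), mulTest (fun x => χ (y i * x)) (contDiff_dilation hχ _) φ := by
    ext x
    have h1 : ∀ i, χ (y i * x) = η (2 * (y (i + 1) * x)) - η (2 * (y i * x)) := by
      intro i
      simp only [χ, y]
      congr 2
      rw [pow_succ]
      ring
    refine Eq.trans ?_ (congrArg (η (2 * R * x) * φ x + ·) (sum_test_apply _ _ x).symm)
    simp only [mulTest_apply]
    rw [← Finset.sum_mul, ← add_mul]
    simp_rw [h1]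
    rw [Finset.sum_range_sub (fun i => η (2 * (y i * x)))]
    by_cases hx : φ x = 0
    · rw [hx, mul_zero]
    · have h2 : |x| ≤ |r| := (hr x (subset_tsupport _ hx)).trans (le_abs_self r)
      have h3 : η (2 * (y (n + 1) * x)) = 1 := by
        refine hη1 _ ?_
        have h4 : 2 * (y (n + 1) * x) = R * (1 / 2) ^ n * x := by
          simp only [y]
          rw [pow_succ]
          ring
        rw [lt_div_iff₀ (by positivity)] at hn
        rw [h4, abs_mul, abs_of_pos (by positivity)]
        calc R * (1 / 2) ^ n * |x| ≤ R * (1 / 2) ^ n * (|r| + 1) := by gcongr; linarith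
          _ = (1 / 2) ^ n * (R * (|r| + 1)) := by ring
          _ ≤ a / 2 := hn.le
      have h5 : y 0 = R := by simp [y]
      rw [h3, h5, mul_assoc, add_sub_cancel, one_mul]
  have hX : 0 ≤ ∑ i ∈ Finset.range N, ∫ x in S, ((1 + x ^ 2) ^ k)⁻¹ * ‖powDeriv i φ x‖ :=
    Finset.sum_nonneg fun i _ => integral_nonneg fun x => by positivity
  set X := ∑ i ∈ Finset.range N, ∫ x in S, ((1 + x ^ 2) ^ k)⁻¹ * ‖powDeriv i φ x‖
  rw [hsum, map_add, map_sum, hvan, zero_add]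
  · refine (norm_sum_le _ _).trans ?_
    calc _ ≤ ∑ i ∈ Finset.range (n + 1), C * y i * X :=
          Finset.sum_le_sum fun i _ => hbd φ (y i) (by positivity) (by
            refine mul_le_of_le_one_right hR.le ?_
            exact pow_le_one₀ (by norm_num) (by norm_num))
      _ = C * (R * ∑ i ∈ Finset.range (n + 1), (1 / 2 : ℝ) ^ i) * X := by
          have h1 : R * ∑ i ∈ Finset.range (n + 1), (1 / 2 : ℝ) ^ i =
            ∑ i ∈ Finset.range (n + 1), y i := Finset.mul_sum _ _ _
          rw [h1, ← Finset.sum_mul, ← Finset.mul_sum]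
      _ ≤ C * (R * 2) * X := by
          refine mul_le_mul_of_nonneg_right (mul_le_mul_of_nonneg_left
            (mul_le_mul_of_nonneg_left ?_ hR.le) hC) hX
          exact sum_geometric_two_le _
  · intro x hx
    have h1 : η (2 * R * x) ≠ 0 := left_ne_zero_of_mul hx
    by_contra hlt
    refine h1 (hη0 _ ?_)
    rw [abs_mul, abs_of_pos (by positivity)]
    have h2 : R * δ = a := div_mul_cancel₀ _ hδ.ne'
    nlinarith

end Decay

end HadamardOp

namespace HadamardOp

open Set Filter Topology
open scoped ContDiff

variable {𝕜 : Type*} [RCLike 𝕜] {U V : Opens ℝ}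

/-! ### Smoothness of `y ↦ T_x φ(xy)` from integral representations. -/

section Representation

/-- A representation `T φ = ∑ ∫ τᵢ xⁱ φ⁽ⁱ⁾` with functions `τᵢ` which vanish near zero and have
integrable moments up to order `k`. -/
structure IsRep (T : Dist 𝕜 V) (δ : ℝ) (k N : ℕ) (τ : ℕ → ℝ → 𝕜) : Prop where
  integrable : ∀ i, ∀ l ≤ k, Integrable fun x : ℝ => (x : 𝕜) ^ l * τ i x
  eq_zero : ∀ i x, |x| < δ → τ i x = 0
  apply_eq : ∀ φ : 𝓓(V, 𝕜), T φ = ∑ i ∈ Finset.range N, ∫ x, τ i x * powDeriv i φ x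

/-- The derivative of order `j` of `y ↦ ∫ s(x) u(x y) dx`. -/
noncomputable def dilationIntegral (s u : ℝ → 𝕜) (j : ℕ) (y : ℝ) : 𝕜 :=
  ∫ x : ℝ, ((x : 𝕜) ^ j * s x) * iteratedDeriv j u (x * y)

theorem aestronglyMeasurable_dilationIntegral {s u : ℝ → 𝕜} (hu : ContDiff ℝ ∞ u) {j : ℕ}
    (hs : Integrable fun x : ℝ => (x : 𝕜) ^ j * s x) (l : ℕ) (y : ℝ) :
    AEStronglyMeasurable fun x : ℝ => ((x : 𝕜) ^ j * s x) * iteratedDeriv l u (x * y) :=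
  hs.aestronglyMeasurable.mul
    ((contDiff_iteratedDeriv hu l).continuous.comp (by fun_prop)).aestronglyMeasurable

theorem exists_iteratedDeriv_bound {u : ℝ → 𝕜} (hu : ContDiff ℝ ∞ u) (hus : HasCompactSupport u)
    (j : ℕ) : ∃ B, ∀ x, ‖iteratedDeriv j u x‖ ≤ B :=
  (contDiff_iteratedDeriv hu j).continuous.bounded_above_of_compact_support (hus.iteratedDeriv' j)

/-- Each derivative in `y` brings down a factor `x`, so it uses up one more integrable moment of
`s`. -/
theorem hasDerivAt_dilationIntegral {s u : ℝ → 𝕜} (hu : ContDiff ℝ ∞ u)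
    (hus : HasCompactSupport u) {j : ℕ} (hs : Integrable fun x : ℝ => (x : 𝕜) ^ j * s x)
    (hs' : Integrable fun x : ℝ => (x : 𝕜) ^ (j + 1) * s x) (y : ℝ) :
    HasDerivAt (dilationIntegral s u j) (dilationIntegral s u (j + 1) y) y := by
  obtain ⟨B, hB⟩ := exists_iteratedDeriv_bound hu hus (j + 1)
  obtain ⟨B', hB'⟩ := exists_iteratedDeriv_bound hu hus j
  refine (hasDerivAt_integral_of_dominated_loc_of_deriv_le (𝕜 := ℝ) (μ := volume)
    (F := fun y (x : ℝ) => ((x : 𝕜) ^ j * s x) * iteratedDeriv j u (x * y))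
    (F' := fun y (x : ℝ) => ((x : 𝕜) ^ (j + 1) * s x) * iteratedDeriv (j + 1) u (x * y))
    (bound := fun x : ℝ => ‖(x : 𝕜) ^ (j + 1) * s x‖ * B) (s := univ) univ_mem
    (Eventually.of_forall fun y => aestronglyMeasurable_dilationIntegral hu hs _ y) ?_
    (aestronglyMeasurable_dilationIntegral hu hs' _ y) ?_ (hs'.norm.mul_const B) ?_).2
  · exact hs.mul_bdd (c := B') ((contDiff_iteratedDeriv hu j).continuous.comp
      (by fun_prop : Continuous fun x => x * y)).aestronglyMeasurable (ae_of_all _ fun x => hB' _)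
  · refine ae_of_all _ fun x z _ => ?_
    rw [norm_mul]
    exact mul_le_mul_of_nonneg_left (hB _) (norm_nonneg _)
  · refine ae_of_all _ fun x z _ => ?_
    have h1 : HasDerivAt (fun z => x * z) x z := by simpa using (hasDerivAt_id z).const_mul x
    have h2 := ((hasDerivAt_iteratedDeriv hu j (x * z)).scomp z h1).const_mul ((x : 𝕜) ^ j * s x)
    refine h2.congr_deriv ?_
    rw [RCLike.real_smul_eq_coe_mul, pow_succ]
    ring

theorem continuous_dilationIntegral {s u : ℝ → 𝕜} (hu : ContDiff ℝ ∞ u)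
    (hus : HasCompactSupport u) {j : ℕ} (hs : Integrable fun x : ℝ => (x : 𝕜) ^ j * s x) :
    Continuous (dilationIntegral s u j) := by
  obtain ⟨B, hB⟩ := exists_iteratedDeriv_bound hu hus j
  refine continuous_of_dominated (bound := fun x : ℝ => ‖(x : 𝕜) ^ j * s x‖ * B)
    (fun y => aestronglyMeasurable_dilationIntegral hu hs _ y)
    (fun y => ae_of_all _ fun x => ?_) (hs.norm.mul_const B) (ae_of_all _ fun x => ?_)
  · rw [norm_mul]
    exact mul_le_mul_of_nonneg_left (hB _) (norm_nonneg _)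
  · exact continuous_const.mul ((contDiff_iteratedDeriv hu j).continuous.comp (by fun_prop))

theorem norm_dilationIntegral_le {s u : ℝ → 𝕜} {j : ℕ}
    (hs : Integrable fun x : ℝ => (x : 𝕜) ^ j * s x) {B : ℝ} (hB : ∀ x, ‖iteratedDeriv j u x‖ ≤ B)
    (y : ℝ) : ‖dilationIntegral s u j y‖ ≤ (∫ x : ℝ, ‖(x : 𝕜) ^ j * s x‖) * B := by
  rw [← integral_mul_const]
  refine norm_integral_le_of_norm_le (hs.norm.mul_const B) (ae_of_all _ fun x => ?_)
  rw [norm_mul]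
  exact mul_le_mul_of_nonneg_left (hB _) (norm_nonneg _)

theorem contDiff_of_hasDerivAt_finite {k : ℕ} {g : ℕ → ℝ → 𝕜}
    (h : ∀ j < k, ∀ x, HasDerivAt (g j) (g (j + 1) x) x) (hc : Continuous (g k)) :
    ContDiff ℝ k (g 0) ∧ ∀ j ≤ k, iteratedDeriv j (g 0) = g j := by
  have h1 : ∀ j ≤ k, iteratedDeriv j (g 0) = g j := by
    intro j
    induction j with
    | zero => intro _; simp
    | succ j ih =>
      intro hj
      rw [iteratedDeriv_succ, ih (by omega)]
      exact funext fun x => (h j (by omega) x).deriv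
  refine ⟨?_, h1⟩
  rw [contDiff_nat_iff_iteratedDeriv]
  refine ⟨fun m hm => ?_, fun m hm => ?_⟩
  · rw [h1 m hm]
    rcases hm.lt_or_eq with hm | rfl
    · exact continuous_iff_continuousAt.2 fun x => (h m hm x).continuousAt
    · exact hc
  · rw [h1 m hm.le]
    exact fun x => (h m hm x).differentiableAt

/-- The derivatives of `y ↦ T (φ (· y))`. -/
noncomputable def repFun (N : ℕ) (τ : ℕ → ℝ → 𝕜) (φ : ℝ → 𝕜) (j : ℕ) (y : ℝ) : 𝕜 :=
  ∑ i ∈ Finset.range N, dilationIntegral (τ i) (powDeriv i φ) j y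

variable {T : Dist 𝕜 V} {δ : ℝ} {k N : ℕ} {τ : ℕ → ℝ → 𝕜}

theorem IsRep.contDiff_repFun (h : IsRep T δ k N τ) (φ : 𝓓(U, 𝕜)) :
    ContDiff ℝ k (repFun N τ φ 0) ∧ ∀ j ≤ k, iteratedDeriv j (repFun N τ φ 0) = repFun N τ φ j := by
  have hφ := TestFunction.contDiff_infty φ
  refine contDiff_of_hasDerivAt_finite (g := repFun N τ φ) (fun j hj y => ?_) ?_
  · exact HasDerivAt.fun_sum fun i _ => hasDerivAt_dilationIntegral (contDiff_powDeriv hφ i)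
      (hasCompactSupport_powDeriv φ.hasCompactSupport i) (h.integrable i j hj.le)
      (h.integrable i (j + 1) hj) y
  · exact continuous_finsetSum _ fun i _ => continuous_dilationIntegral (contDiff_powDeriv hφ i)
      (hasCompactSupport_powDeriv φ.hasCompactSupport i) (h.integrable i k le_rfl)

/-- This invariance is why representations use `xⁱ Dⁱ`: the functional applied to `φ(· y)` becomes
an integral of `powDeriv i φ (x * y)` against a density independent of `y`. -/
theorem powDeriv_dilation {f : ℝ → 𝕜} (hf : ContDiff ℝ ∞ f) (i : ℕ) (x y : ℝ) :
    powDeriv i (fun x => f (x * y)) x = powDeriv i f (x * y) := by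
  simp_rw [powDeriv, mul_comm _ y]
  rw [iteratedDeriv_dilation hf, RCLike.ofReal_mul, mul_pow]
  ring

theorem IsRep.repFun_zero (h : IsRep T δ k N τ) (φ : 𝓓(U, 𝕜)) (χ : 𝓓(V, 𝕜)) {y : ℝ}
    (hχ : ∀ x, χ x = φ (x * y)) : repFun N τ φ 0 y = T χ := by
  rw [h.apply_eq, repFun]
  refine Finset.sum_congr rfl fun i _ => ?_
  rw [funext hχ, dilationIntegral]
  simp_rw [powDeriv_dilation (TestFunction.contDiff_infty φ), pow_zero, one_mul,
    iteratedDeriv_zero]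

theorem eq_of_eq_off_zero {f g : ℝ → 𝕜} (hf : Continuous f) (hg : Continuous g)
    (h : ∀ y ≠ 0, f y = g y) : f = g :=
  Continuous.ext_on (dense_compl_singleton (0 : ℝ)) hf hg h

theorem IsDualDilation.unique {φ ψ ψ' : 𝓓(U, 𝕜)} (h : IsDualDilation T φ ψ)
    (h' : IsDualDilation T φ ψ') : ψ = ψ' := by
  refine DFunLike.coe_injective (eq_of_eq_off_zero ψ.continuous ψ'.continuous fun y hy => ?_)
  obtain ⟨χ, h1, h2⟩ := h y hy
  rw [h2, h'.apply_eq hy χ h1]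

theorem IsRep.eq_repFun (h : IsRep T δ k N τ) {φ ψ : 𝓓(U, 𝕜)} (hψ : IsDualDilation T φ ψ) :
    (ψ : ℝ → 𝕜) = repFun N τ φ 0 := by
  refine eq_of_eq_off_zero ψ.continuous (h.contDiff_repFun φ).1.continuous fun y hy => ?_
  obtain ⟨χ, h1, h2⟩ := hψ y hy
  rw [h2, h.repFun_zero φ χ h1]

/-- `T` vanishes on functions supported in `y⁻¹ K` if `y` is outside of a compact set depending on
`K`. -/
def DilationProper (T : Dist 𝕜 V) (U : Opens ℝ) : Prop :=
  ∀ K : Set ℝ, IsCompact K → K ⊆ U → ∃ L : Set ℝ, IsCompact L ∧ L ⊆ U ∧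
    ∀ y ≠ 0, y ∉ L → ∀ χ : 𝓓(V, 𝕜), (∀ x, χ x ≠ 0 → x * y ∈ K) → T χ = 0

theorem DilationProper.support_subset (h : DilationProper T U) {K : Set ℝ} (hK : IsCompact K)
    (hKU : K ⊆ U) : ∃ L : Set ℝ, IsCompact L ∧ L ⊆ U ∧ ∀ φ : 𝓓(U, 𝕜), Function.support φ ⊆ K →
      ∀ f : ℝ → 𝕜, Continuous f →
        (∀ y ≠ 0, ∃ χ : 𝓓(V, 𝕜), (∀ x, χ x = φ (x * y)) ∧ f y = T χ) → Function.support f ⊆ L := by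
  obtain ⟨L, hL, hLU, hT⟩ := h K hK hKU
  refine ⟨L, hL, hLU, fun φ hφ f hf hfT => ?_⟩
  have h1 : ∀ y ≠ 0, y ∉ L → f y = 0 := by
    intro y hy hyL
    obtain ⟨χ, h2, h3⟩ := hfT y hy
    rw [h3, hT y hy hyL χ fun x hx => hφ (by rwa [Function.mem_support, ← h2])]
  intro y hy
  by_contra hyL
  -- Nothing is assumed about `f` at `0`; continuity carries a nonzero value to nearby points `y ≠
  -- 0` outside `L`.
  by_cases hy0 : y = 0
  · subst hy0
    have h2 : {z | f z ≠ 0} ∩ Lᶜ ∈ 𝓝 (0 : ℝ) :=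
      ((isOpen_ne_fun hf continuous_const).inter hL.isClosed.isOpen_compl).mem_nhds ⟨hy, hyL⟩
    obtain ⟨z, hz, hz0⟩ := ((dense_compl_singleton (0 : ℝ)).inter_nhds_nonempty h2)
    exact hz0.1 (h1 z hz hz0.2)
  · exact hy (h1 y hy0 hyL)

/-- On `K` the factor `xⁱ` may be cut off to `κ xⁱ`, to which `exists_localization_bound` applies;
`L¹` norms over its compact support are at most measure times sup norm. -/
theorem exists_powDeriv_bound {K : Set ℝ} (hK : IsCompact K) (i j : ℕ) :
    ∃ (m : ℕ) (C : ℝ), 0 ≤ C ∧ ∀ φ : 𝓓(U, 𝕜), Function.support φ ⊆ K → ∀ B : ℝ, DerivBound m B φ →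
      ∀ x, ‖iteratedDeriv j (powDeriv i φ) x‖ ≤ C * B := by
  obtain ⟨κ, hκ, hκs, -, W, -, hKW, h1⟩ := exists_cutoff 𝕜 hK ⊤ (fun _ _ => trivial)
  obtain ⟨C, hC, hloc⟩ := exists_localization_bound (κ := fun x : ℝ => κ x * (x : 𝕜) ^ i)
    (hκ.mul ((contDiff_ofReal 𝕜).pow i)) hκs.mul_right j
  set S := tsupport fun x : ℝ => κ x * (x : 𝕜) ^ i with hSdef
  have hS : IsCompact S := hκs.mul_right
  refine ⟨i + (j + 2), C * ((j + 2) * volume.real S), by positivity, fun φ hφ B hB x => ?_⟩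
  have hφs := TestFunction.contDiff_infty φ
  have h2 : powDeriv i φ = fun x => κ x * (x : 𝕜) ^ i * iteratedDeriv i φ x := by
    ext x
    by_cases hx : iteratedDeriv i φ x = 0
    · simp [powDeriv, hx]
    · have h3 : x ∈ K := closure_minimal hφ hK.isClosed (support_iteratedDeriv_subset φ i hx)
      rw [h1 x (hKW h3), one_mul, powDeriv]
  rw [h2]
  refine (hloc _ (contDiff_iteratedDeriv hφs i) j le_rfl x).trans ?_
  rw [mul_assoc]
  refine mul_le_mul_of_nonneg_left ?_ hC
  have h4 : ∀ l ∈ Finset.range (j + 2),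
      ∫ x in S, ‖iteratedDeriv l (iteratedDeriv i φ) x‖ ≤ volume.real S * B := by
    intro l hl
    rw [Finset.mem_range] at hl
    have h5 := norm_setIntegral_le_of_norm_le_const (μ := volume) (s := S) (C := B)
      (f := fun x => ‖iteratedDeriv l (iteratedDeriv i φ) x‖) hS.measure_lt_top (fun x _ => by
        rw [norm_norm]
        have h6 : iteratedDeriv l (iteratedDeriv i φ) = iteratedDeriv (l + i) φ := by
          rw [iteratedDeriv_eq_iterate, iteratedDeriv_eq_iterate, iteratedDeriv_eq_iterate,
            Function.iterate_add_apply]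
        rw [h6]
        exact hB _ (by omega) x)
    rw [mul_comm]
    exact (le_abs_self _).trans h5
  refine (Finset.sum_le_sum h4).trans (le_of_eq ?_)
  rw [Finset.sum_const, Finset.card_range, nsmul_eq_mul]
  push_cast
  ring

/-- Integration by parts shows that `θ` acts on the `n`-th moment as `-(n + 1)`, and `xⁱ Dⁱ` is a
polynomial in `θ`. -/
theorem exists_integral_powDeriv_mul_pow (𝕜 : Type*) [RCLike 𝕜] (n i : ℕ) : ∃ c : 𝕜, ∀ f : ℝ → 𝕜, ContDiff ℝ ∞ f → HasCompactSupport f →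
      ∫ x : ℝ, powDeriv i f x * (x : 𝕜) ^ n = c * ∫ x, f x * (x : 𝕜) ^ n := by
  induction i with
  | zero => exact ⟨1, fun f _ _ => by simp [powDeriv]⟩
  | succ i ih =>
    obtain ⟨c, hc⟩ := ih
    refine ⟨(-((n : 𝕜) + 1) - i) * c, fun f hf hs => ?_⟩
    have h1 := integral_euler_mul_pow (contDiff_powDeriv hf i) (hasCompactSupport_powDeriv hs i) n
    have h2 : ∀ x : ℝ, powDeriv (i + 1) f x * (x : 𝕜) ^ n =
        ((x : 𝕜) * deriv (powDeriv i f) x) * (x : 𝕜) ^ n - i * (powDeriv i f x * (x : 𝕜) ^ n) := by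
      intro x
      rw [mul_deriv_powDeriv hf]
      ring
    simp_rw [h2]
    rw [integral_sub, h1, integral_const_mul, hc f hf hs]
    · ring
    · refine integrable_mul_pow ?_ ?_ n
      · exact RCLike.continuous_ofReal.mul
          ((contDiff_powDeriv hf i).continuous_deriv (by simp))
      · exact (hasCompactSupport_powDeriv hs i).deriv.mul_left
    · exact (integrable_mul_pow (contDiff_powDeriv hf i).continuous
        (hasCompactSupport_powDeriv hs i) n).const_mul _

end Representation

end HadamardOp

namespace HadamardOp

open Set Filter Topology
open scoped ContDiff

variable {𝕜 : Type*} [RCLike 𝕜] {U V : Opens ℝ}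

/-! ### The operator on test functions defined by `T`. -/

section Operator

/-- The moments of `y ↦ ∫ s(x) u(x y) dx`. -/
theorem integral_dilationIntegral_mul_pow {s u : ℝ → 𝕜} (hs : Integrable s) {δ : ℝ} (hδ : 0 < δ)
    (hs0 : ∀ x, |x| < δ → s x = 0) (hu : ContDiff ℝ ∞ u) (hus : HasCompactSupport u) (n : ℕ) :
    Integrable (fun y : ℝ => dilationIntegral s u 0 y * (y : 𝕜) ^ n) ∧
    ∫ y : ℝ, dilationIntegral s u 0 y * (y : 𝕜) ^ n =
      (∫ x : ℝ, s x * (((|x⁻¹| : ℝ) : 𝕜) * ((x : 𝕜)⁻¹) ^ n)) * ∫ y : ℝ, u y * (y : 𝕜) ^ n := by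
  let v : ℝ → 𝕜 := fun y => u y * (y : 𝕜) ^ n
  let C : ℝ := ∫ y, ‖v y‖
  have hv : Integrable v := integrable_mul_pow hu.continuous hus n
  let f : ℝ → ℝ → 𝕜 := fun x y => s x * (u (x * y) * (y : 𝕜) ^ n)
  have hnorm : ∀ x : ℝ, x ≠ 0 → ∀ y : ℝ,
      ‖u (x * y) * (y : 𝕜) ^ n‖ = (|x|⁻¹) ^ n * ‖v (x * y)‖ := by
    intro x hx y
    have hx' : |x| ≠ 0 := abs_ne_zero.2 hx
    simp only [v, norm_mul, norm_pow, RCLike.norm_ofReal, abs_mul, mul_pow, inv_pow]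
    field_simp
  have hdil : ∀ x : ℝ, x ≠ 0 → Integrable fun y : ℝ => u (x * y) * (y : 𝕜) ^ n := fun x hx =>
    integrable_mul_pow (hu.continuous.comp (by fun_prop))
      (hus.comp_homeomorph (Homeomorph.mulLeft₀ x hx)) n
  have hx0 : ∀ x, s x ≠ 0 → δ ≤ |x| := fun x hx => not_lt.1 fun h => hx (hs0 x h)
  -- Integrating in `y` produces the factor `|x|⁻ⁿ⁻¹`, harmless because `s` vanishes for `|x| < δ`;
  -- this justifies Fubini.
  have hint : Integrable (Function.uncurry f) (volume.prod volume) := by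
    rw [integrable_prod_iff]
    · refine ⟨ae_of_all _ fun x => ?_, ?_⟩
      · by_cases hx : s x = 0
        · simp [Function.uncurry, f, hx]
        · exact (hdil x (abs_pos.1 (hδ.trans_le (hx0 x hx)))).const_mul (s x)
      · refine (hs.norm.mul_const ((δ⁻¹) ^ n * (δ⁻¹ * C))).mono' ?_ (ae_of_all _ fun x => ?_)
        · refine AEStronglyMeasurable.integral_prod_right' (f := fun z : ℝ × ℝ =>
            ‖Function.uncurry f z‖) ?_
          refine AEStronglyMeasurable.norm ?_
          exact hs.aestronglyMeasurable.comp_fst.mul (Continuous.aestronglyMeasurable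
            ((hu.continuous.comp (by fun_prop)).mul (by fun_prop)))
        · simp only [Function.uncurry, f, norm_mul (s x)]
          rw [integral_const_mul, norm_mul, norm_norm]
          by_cases hx : s x = 0
          · simp [hx]
          refine mul_le_mul_of_nonneg_left ?_ (norm_nonneg _)
          have hx1 := hx0 x hx
          have hx2 : x ≠ 0 := abs_pos.1 (hδ.trans_le hx1)
          simp_rw [hnorm x hx2]
          rw [integral_const_mul, Measure.integral_comp_mul_left (fun y => ‖v y‖), smul_eq_mul,
            abs_inv, Real.norm_of_nonneg (by positivity)]
          have hC : 0 ≤ C := integral_nonneg fun _ => norm_nonneg _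
          have h1 : |x|⁻¹ ≤ δ⁻¹ := inv_anti₀ hδ hx1
          change |x|⁻¹ ^ n * (|x|⁻¹ * C) ≤ _
          gcongr
    · exact hs.aestronglyMeasurable.comp_fst.mul (Continuous.aestronglyMeasurable
        ((hu.continuous.comp (by fun_prop)).mul (by fun_prop)))
  have heq : ∀ y : ℝ, dilationIntegral s u 0 y * (y : 𝕜) ^ n = ∫ x, f x y := by
    intro y
    simp only [dilationIntegral, pow_zero, one_mul, iteratedDeriv_zero, f]
    rw [← integral_mul_const]
    simp_rw [mul_assoc]
  simp_rw [heq]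
  refine ⟨hint.integral_prod_right, ?_⟩
  rw [← integral_integral_swap hint, ← integral_mul_const]
  refine integral_congr_ae (ae_of_all _ fun x => ?_)
  simp only [f]
  by_cases hx : s x = 0
  · simp [hx]
  · rw [integral_const_mul, integral_dilation_mul_pow u (abs_pos.1 (hδ.trans_le (hx0 x hx))) n]
    ring

variable {T : Dist 𝕜 V} {δ : ℝ}

/-- One representation gives only finitely many derivatives. The representations for all `k` yield
the same function off zero, hence by continuity everywhere, which is therefore smooth. -/
theorem exists_isDualDilation (hrep : ∀ k, ∃ N τ, IsRep T δ k N τ)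
    (hdil : ∀ (φ : 𝓓(U, 𝕜)) (y : ℝ), y ≠ 0 → ∃ χ : 𝓓(V, 𝕜), ∀ x, χ x = φ (x * y))
    (hp : DilationProper T U) (φ : 𝓓(U, 𝕜)) : ∃ ψ : 𝓓(U, 𝕜), IsDualDilation T φ ψ := by
  choose N τ h using hrep
  let f : ℝ → 𝕜 := repFun (N 0) (τ 0) φ 0
  have hfc : Continuous f := ((h 0).contDiff_repFun φ).1.continuous
  have hfT : ∀ y ≠ 0, ∃ χ : 𝓓(V, 𝕜), (∀ x, χ x = φ (x * y)) ∧ f y = T χ := by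
    intro y hy
    obtain ⟨χ, hχ⟩ := hdil φ y hy
    exact ⟨χ, hχ, (h 0).repFun_zero φ χ hχ⟩
  have hf : ∀ k, f = repFun (N k) (τ k) φ 0 := by
    intro k
    refine eq_of_eq_off_zero hfc ((h k).contDiff_repFun φ).1.continuous fun y hy => ?_
    obtain ⟨χ, hχ, h1⟩ := hfT y hy
    rw [h1, (h k).repFun_zero φ χ hχ]
  have hfs : ContDiff ℝ ∞ f := by
    rw [contDiff_infty]
    intro k
    rw [hf k]
    exact ((h k).contDiff_repFun φ).1
  obtain ⟨L, hL, hLU, hs⟩ := hp.support_subset (K := tsupport φ) φ.hasCompactSupport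
    φ.tsupport_subset
  exact ⟨mkTest U f hfs hL hLU (hs φ (subset_tsupport _) f hfc hfT), hfT⟩

/-- The operator `φ ↦ T (φ (· y))`. -/
theorem exists_operator (hδ : 0 < δ) (hrep : ∀ k, ∃ N τ, IsRep T δ k N τ)
    (hdil : ∀ (φ : 𝓓(U, 𝕜)) (y : ℝ), y ≠ 0 → ∃ χ : 𝓓(V, 𝕜), ∀ x, χ x = φ (x * y))
    (hp : DilationProper T U) : ∃ M : 𝓓(U, 𝕜) →L[𝕜] 𝓓(U, 𝕜),
      (∀ φ, IsDualDilation T φ (M φ)) ∧ PreservesMoments M.toLinearMap := by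
  choose m hm using exists_isDualDilation hrep hdil hp
  let M : 𝓓(U, 𝕜) →ₗ[𝕜] 𝓓(U, 𝕜) :=
    { toFun := m
      map_add' := fun φ ψ => by
        refine (hm (φ + ψ)).unique fun y hy => ?_
        obtain ⟨χ, h1, h2⟩ := hm φ y hy
        obtain ⟨χ', h3, h4⟩ := hm ψ y hy
        refine ⟨χ + χ', fun x => ?_, ?_⟩
        · exact congrArg₂ (· + ·) (h1 x) (h3 x)
        · rw [map_add]
          exact congrArg₂ (· + ·) h2 h4
      map_smul' := fun c φ => by
        refine (hm (c • φ)).unique fun y hy => ?_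
        obtain ⟨χ, h1, h2⟩ := hm φ y hy
        refine ⟨c • χ, fun x => ?_, ?_⟩
        · exact congrArg (c • ·) (h1 x)
        · rw [map_smul]
          exact congrArg (c • ·) h2 }
  have hM : Continuous M := by
    refine continuous_operator_of_bounds M fun K hK hKU => ?_
    obtain ⟨L, hL, hLU, hs⟩ := hp.support_subset hK hKU
    refine ⟨L, hL, hLU, fun φ hφ => hs φ hφ (m φ) (m φ).continuous (hm φ), fun j => ?_⟩
    obtain ⟨N, τ, h⟩ := hrep j
    choose p C hC hb using fun i => exists_powDeriv_bound (𝕜 := 𝕜) (U := U) hK i j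
    refine ⟨∑ i ∈ Finset.range N, p i,
      ∑ i ∈ Finset.range N, (∫ x : ℝ, ‖(x : 𝕜) ^ j * τ i x‖) * C i, fun φ hφ B hB x => ?_⟩
    have h1 : iteratedDeriv j (M φ) x = repFun N τ φ j x := by
      change iteratedDeriv j (m φ) x = _
      rw [h.eq_repFun (hm φ), (h.contDiff_repFun φ).2 j le_rfl]
    rw [h1, repFun, Finset.sum_mul]
    refine norm_sum_le_of_le _ fun i hi => ?_
    rw [mul_assoc]
    refine norm_dilationIntegral_le (h.integrable i j le_rfl) (fun x => hb i φ hφ B ?_ x) x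
    exact hB.mono (Finset.single_le_sum (fun _ _ => Nat.zero_le _) hi) le_rfl
  refine ⟨⟨M, hM⟩, hm, fun n => ?_⟩
  obtain ⟨N, τ, h⟩ := hrep 0
  choose c hc using fun i => exists_integral_powDeriv_mul_pow 𝕜 n i
  refine ⟨∑ i ∈ Finset.range N, (∫ x : ℝ, τ i x * (((|x⁻¹| : ℝ) : 𝕜) * ((x : 𝕜)⁻¹) ^ n)) * c i,
    fun φ => ?_⟩
  change ∫ y : ℝ, m φ y * (y : 𝕜) ^ n = _
  have hφ := TestFunction.contDiff_infty φ
  have h1 := fun i => integral_dilationIntegral_mul_pow (by simpa using h.integrable i 0 le_rfl) hδ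
    (h.eq_zero i) (contDiff_powDeriv hφ i) (hasCompactSupport_powDeriv φ.hasCompactSupport i) n
  rw [h.eq_repFun (hm φ)]
  simp only [repFun, Finset.sum_mul]
  rw [integral_finsetSum _ fun i _ => (h1 i).1]
  refine Finset.sum_congr rfl fun i _ => ?_
  rw [(h1 i).2, hc i φ hφ φ.hasCompactSupport, mul_assoc]

end Operator

end HadamardOp

namespace HadamardOp

open Set Filter Topology
open scoped ContDiff

variable {𝕜 : Type*} [RCLike 𝕜] {U V : Opens ℝ}

/-! ### Supports of distributions and properness of the dual dilation. -/

section Vanishing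

theorem tsupport_mul_subset_left' (f g : ℝ → 𝕜) : tsupport (fun x => f x * g x) ⊆ tsupport f :=
  closure_mono (Function.support_mul_subset_left _ _)

theorem tsupport_mul_subset_right' (f g : ℝ → 𝕜) : tsupport (fun x => f x * g x) ⊆ tsupport g :=
  closure_mono (Function.support_mul_subset_right _ _)

theorem tsupport_one_sub_mul_subset {κ : ℝ → 𝕜} {W : Set ℝ} (hW : IsOpen W)
    (h : ∀ x ∈ W, κ x = 1) (f : ℝ → 𝕜) : tsupport (fun x => (1 - κ x) * f x) ⊆ Wᶜ :=
  closure_minimal (fun x hx hxW => hx (by simp [h x hxW])) hW.isClosed_compl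

theorem mulTest_one_sub (κ : ℝ → 𝕜) (hκ : ContDiff ℝ ∞ κ) (φ : 𝓓(V, 𝕜)) :
    φ = mulTest κ hκ φ + mulTest (fun x => 1 - κ x) (contDiff_const.sub hκ) φ := by
  ext x
  change φ x = κ x * φ x + (1 - κ x) * φ x
  ring

theorem isVanishingOn_union (T : Dist 𝕜 V) {W₁ W₂ : Set ℝ} (hW₁ : IsOpen W₁) (hW₂ : IsOpen W₂)
    (h₁ : Distribution.IsVanishingOn (T : 𝓓(V, 𝕜) → 𝕜) W₁)
    (h₂ : Distribution.IsVanishingOn (T : 𝓓(V, 𝕜) → 𝕜) W₂) :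
    Distribution.IsVanishingOn (T : 𝓓(V, 𝕜) → 𝕜) (W₁ ∪ W₂) := by
  intro φ hφ
  -- `κ` lives in `W₁` and equals one near the part of the support of `φ` outside `W₂`, so `φ`
  -- splits into pieces supported in `W₁` and in `W₂`.
  obtain ⟨κ, hκ, -, hκ1, W, hW, hKW, h1⟩ := exists_cutoff 𝕜
    (φ.hasCompactSupport.isCompact.diff hW₂) ⟨W₁, hW₁⟩
    (fun x hx => (hφ hx.1).resolve_right hx.2)
  rw [mulTest_one_sub κ hκ φ, map_add, h₁, h₂, add_zero]
  · intro x hx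
    by_contra hx2
    exact tsupport_one_sub_mul_subset hW h1 φ hx
      (hKW ⟨tsupport_mul_subset_right' _ _ hx, hx2⟩)
  · exact (tsupport_mul_subset_left' _ _).trans hκ1

/-- A distribution vanishes on test functions whose support is disjoint from its own. -/
theorem eq_zero_of_disjoint_supp (T : Dist 𝕜 V) (φ : 𝓓(V, 𝕜)) (h : ∀ x ∈ tsupport φ, x ∉ supp T) :
    T φ = 0 := by
  obtain ⟨W, -, hW, hT⟩ := φ.hasCompactSupport.isCompact.induction_on
    (p := fun s => ∃ W, IsOpen W ∧ s ⊆ W ∧ Distribution.IsVanishingOn (T : 𝓓(V, 𝕜) → 𝕜) W)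
    ⟨∅, isOpen_empty, Subset.rfl, fun φ hφ => by
      have : φ = 0 := by
        ext x
        by_contra hx
        exact hφ (subset_tsupport _ hx)
      rw [this, map_zero]⟩
    (fun s t hst ⟨W, h1, h2, h3⟩ => ⟨W, h1, hst.trans h2, h3⟩)
    (fun s t ⟨W₁, h1, h2, h3⟩ ⟨W₂, h4, h5, h6⟩ => ⟨W₁ ∪ W₂, h1.union h4, union_subset_union h2 h5,
      isVanishingOn_union T h1 h4 h3 h6⟩)
    (fun x hx => by
      obtain ⟨W, h1, h2, h3⟩ := (Distribution.notMem_dsupport_iff x).1 (h x hx)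
      exact ⟨W, mem_nhdsWithin_of_mem_nhds (h2.mem_nhds h3), W, h2, Subset.rfl, h1⟩)
  exact hT φ hW

/-- A point `x` common to `supp T` and `y⁻¹ K` gives `y = x⁻¹ * (x * y) ∈ (supp T)⁻¹ * K`, which is
impossible for `y` outside `L`. -/
theorem dilationProper_of_supp {T : Dist 𝕜 V} (h0 : (0 : ℝ) ∉ supp T)
    (h : ∀ K : Set ℝ, IsCompact K → K ⊆ U → ∃ L : Set ℝ, IsCompact L ∧ L ⊆ U ∧
      (supp T)⁻¹ * K ⊆ L) : DilationProper T U := by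
  intro K hK hKU
  obtain ⟨L, hL, hLU, hsub⟩ := h K hK hKU
  refine ⟨L, hL, hLU, fun y hy hyL χ hχ => eq_zero_of_disjoint_supp T χ fun x hx hxT => hyL ?_⟩
  have h1 : x * y ∈ K := by
    have h2 : tsupport χ ⊆ (fun x => x * y) ⁻¹' K :=
      closure_minimal hχ (hK.isClosed.preimage (by fun_prop))
    exact h2 hx
  have hx0 : x ≠ 0 := fun h => h0 (h ▸ hxT)
  refine hsub ⟨x⁻¹, by simpa using hxT, x * y, h1, ?_⟩
  exact inv_mul_cancel_left₀ hx0 y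

theorem dilationProper_of_suppCondition {T : Dist 𝕜 V} (h0 : (0 : ℝ) ∉ supp T)
    (h : SuppCondition T U) : DilationProper T U :=
  dilationProper_of_supp h0 fun K hK hKU =>
    ⟨_, (h K hK hKU).1, (h K hK hKU).2, subset_closure⟩

theorem dilationProper_of_hasCompactSupp {T : Dist 𝕜 puncturedLine} (hT : HasCompactSupp T)
    (h : (supp T)⁻¹ ⊆ dilationSet U) : DilationProper T U := by
  have h0 : (0 : ℝ) ∉ supp T := fun h0 => hT.2 h0 rfl
  refine dilationProper_of_supp h0 fun K hK hKU => ⟨(supp T)⁻¹ * K, IsCompact.mul ?_ hK, ?_,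
    Subset.rfl⟩
  · rw [← Set.image_inv_eq_inv]
    refine hT.1.image_of_continuousOn (continuousOn_inv₀.mono fun x hx => ?_)
    exact hT.2 hx
  · rintro _ ⟨x, hx, k, hk, rfl⟩
    exact (h hx).2 k (hKU hk)

end Vanishing

/-! ### Representations of compactly supported `T`, and outer cutoffs. -/

section Representation

/-- A representation of a compactly supported distribution on the punctured line. -/
theorem exists_isRep_of_hasCompactSupp {T : Dist 𝕜 puncturedLine} (hT : HasCompactSupp T) :
    ∃ δ > 0, ∀ k, ∃ N τ, IsRep T δ k N τ := by
  obtain ⟨κ, hκ, hκs, hκU, W, hW, hKW, h1⟩ := exists_cutoff 𝕜 hT.1 puncturedLine hT.2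
  obtain ⟨δ, hδ, hball⟩ := Metric.isOpen_iff.1 (isClosed_tsupport κ).isOpen_compl 0
    (fun h => hκU h rfl)
  obtain ⟨N, s, B, hsm, hsB, hs⟩ := exists_local_representation T hκ hκs hκU
  -- The support of `κ` avoids zero, so `sᵢ` may be divided by `xⁱ` there. It is compact, so all
  -- moments are integrable and one representation serves every `k`.
  refine ⟨δ, hδ, fun k => ⟨N, fun i => if hi : i < N then (tsupport κ).indicator
    fun x : ℝ => s ⟨i, hi⟩ x * ((x : 𝕜) ^ i)⁻¹ else 0, ⟨fun i l _ => ?_, fun i x hx => ?_,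
    fun φ => ?_⟩⟩⟩
  · split_ifs with hi
    · have hc : ContinuousOn (fun x : ℝ => (x : 𝕜) ^ l * ((x : 𝕜) ^ i)⁻¹) (tsupport κ) := by
        refine ContinuousOn.mul (by fun_prop) (ContinuousOn.inv₀ (by fun_prop) fun x hx => ?_)
        have hx0 : x ≠ 0 := hκU hx
        exact pow_ne_zero _ (by simpa using hx0)
      have h2 := (hc.integrableOn_compact (μ := volume) hκs).bdd_mul (c := B)
        (hsm ⟨i, hi⟩).aestronglyMeasurable (ae_of_all _ fun x => hsB ⟨i, hi⟩ x)
      refine ((integrable_indicator_iff (isClosed_tsupport κ).measurableSet).2 h2).congr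
        (ae_of_all _ fun x => ?_)
      by_cases hx : x ∈ tsupport κ
      · simp only [indicator_of_mem hx]
        ring
      · simp only [indicator_of_notMem hx, mul_zero]
    · simp
  · split_ifs with hi
    · exact indicator_of_notMem (hball (by simpa using hx)) _
    · rfl
  · have h2 : T φ = T (mulTest κ hκ φ) := by
      conv_lhs => rw [mulTest_one_sub κ hκ φ]
      rw [map_add, eq_zero_of_disjoint_supp T (mulTest (fun x => 1 - κ x) _ _), add_zero]
      exact fun x hx hxT => tsupport_one_sub_mul_subset hW h1 φ hx (hKW hxT)
    · rw [h2, hs, Finset.sum_range]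
      refine Finset.sum_congr rfl fun i _ => ?_
      rw [← integral_indicator (isClosed_tsupport κ).measurableSet]
      refine integral_congr_ae (ae_of_all _ fun x => ?_)
      simp only [i.2, dif_pos]
      by_cases hx : x ∈ tsupport κ
      · have hx0 : x ≠ 0 := hκU hx
        have hx1 : (x : 𝕜) ^ (i : ℕ) ≠ 0 := pow_ne_zero _ (by simpa using hx0)
        simp only [indicator_of_mem hx, powDeriv]
        field_simp
      · simp only [indicator_of_notMem hx, zero_mul]

/-- Smooth bounded functions vanishing on `(-δ, δ)` which are locally constant near infinity. -/
structure IsOuterCutoff (δ : ℝ) (κ : ℝ → 𝕜) : Prop where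
  contDiff : ContDiff ℝ ∞ κ
  eq_zero : ∀ x, |x| < δ → κ x = 0
  deriv : HasCompactSupport (deriv κ)
  bounded : ∃ B, ∀ x, ‖κ x‖ ≤ B

theorem IsOuterCutoff.zero (δ : ℝ) : IsOuterCutoff δ (fun _ => (0 : 𝕜)) :=
  ⟨contDiff_const, fun _ _ => rfl, by
    have : _root_.deriv (fun _ : ℝ => (0 : 𝕜)) = 0 := funext fun x => by simp
    rw [this]; exact HasCompactSupport.zero, 0, by simp⟩

theorem IsOuterCutoff.add {δ : ℝ} {κ κ' : ℝ → 𝕜} (h : IsOuterCutoff δ κ) (h' : IsOuterCutoff δ κ') :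
    IsOuterCutoff δ (fun x => κ x + κ' x) := by
  refine ⟨h.contDiff.add h'.contDiff, fun x hx => by rw [h.eq_zero x hx, h'.eq_zero x hx, add_zero],
    ?_, ?_⟩
  · have : _root_.deriv (fun x => κ x + κ' x) = _root_.deriv κ + _root_.deriv κ' := funext fun x =>
      deriv_fun_add (h.contDiff.differentiable (by simp) x) (h'.contDiff.differentiable (by simp) x)
    rw [this]
    exact h.deriv.add h'.deriv
  · obtain ⟨B, hB⟩ := h.bounded
    obtain ⟨B', hB'⟩ := h'.bounded
    exact ⟨B + B', fun x => norm_add_le_of_le (hB x) (hB' x)⟩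

theorem IsOuterCutoff.const_mul {δ : ℝ} {κ : ℝ → 𝕜} (h : IsOuterCutoff δ κ) (c : 𝕜) :
    IsOuterCutoff δ (fun x => c * κ x) := by
  refine ⟨contDiff_const.mul h.contDiff, fun x hx => by rw [h.eq_zero x hx, mul_zero], ?_, ?_⟩
  · have : _root_.deriv (fun x => c * κ x) = fun x => c * _root_.deriv κ x := funext fun x =>
      deriv_const_mul c (h.contDiff.differentiable (by simp) x)
    rw [this]
    exact h.deriv.mul_left
  · obtain ⟨B, hB⟩ := h.bounded
    refine ⟨‖c‖ * B, fun x => ?_⟩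
    rw [norm_mul]
    exact mul_le_mul_of_nonneg_left (hB x) (norm_nonneg c)

theorem IsOuterCutoff.euler {δ : ℝ} {κ : ℝ → 𝕜} (h : IsOuterCutoff δ κ) :
    IsOuterCutoff δ (fun x : ℝ => (x : 𝕜) * _root_.deriv κ x) := by
  have h1 : ContDiff ℝ ∞ (fun x : ℝ => (x : 𝕜) * _root_.deriv κ x) :=
    contDiff_mul_ofReal (contDiff_infty_iff_deriv.1 h.contDiff).2
  have h2 : HasCompactSupport (fun x : ℝ => (x : 𝕜) * _root_.deriv κ x) := h.deriv.mul_left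
  refine ⟨h1, fun x hx => ?_, h2.deriv, h1.continuous.bounded_above_of_compact_support h2⟩
  have h3 : κ =ᶠ[𝓝 x] fun _ => 0 := by
    filter_upwards [(isOpen_lt continuous_abs continuous_const).mem_nhds hx] with z hz
    exact h.eq_zero z hz
  rw [h3.deriv_eq, deriv_const, mul_zero]

/-- The Leibniz rule for powers of the transposed Euler derivative. -/
theorem exists_iterate_eulerTranspose_mul {δ : ℝ} {κ : ℝ → 𝕜} (hκ : IsOuterCutoff δ κ) (j : ℕ) :
    ∃ q : ℕ → ℝ → 𝕜, (∀ i, IsOuterCutoff δ (q i)) ∧ (∀ i x, j < i → q i x = 0) ∧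
      ∀ f : ℝ → 𝕜, ContDiff ℝ ∞ f → ∀ N, j < N → ∀ x,
        (eulerTranspose^[j] fun x => κ x * f x) x =
          ∑ i ∈ Finset.range N, q i x * powDeriv i f x := by
  induction j with
  | zero =>
    refine ⟨fun i => if i = 0 then κ else fun _ => 0, fun i => ?_, fun i x hi => ?_,
      fun f hf N hN x => ?_⟩
    · dsimp only
      split_ifs
      exacts [hκ, IsOuterCutoff.zero δ]
    · simp [hi.ne']
    · rw [Finset.sum_eq_single_of_mem 0 (Finset.mem_range.2 hN) (fun j _ hj => by simp [hj])]
      simp [powDeriv]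
  | succ j ih =>
    obtain ⟨q, hq, hq0, h⟩ := ih
    -- These coefficients come from `θ*(q xⁱDⁱf) = -q xⁱ⁺¹Dⁱ⁺¹f - ((1 + i) q + θq) xⁱDⁱf`. Outer
    -- cutoffs are stable under `θ` because their derivative has compact support.
    refine ⟨fun i x => (if i = 0 then fun _ => (0 : 𝕜) else fun x => (-1) * q (i - 1) x) x +
      ((-(1 + (i : 𝕜))) * q i x + (-1) * ((x : 𝕜) * deriv (q i) x)), fun i => ?_, fun i x hi => ?_,
      fun f hf N hN x => ?_⟩
    · refine IsOuterCutoff.add ?_ (((hq i).const_mul _).add ((hq i).euler.const_mul _))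
      split_ifs
      exacts [IsOuterCutoff.zero δ, (hq _).const_mul _]
    · have h1 : q i = fun _ => 0 := funext fun x => hq0 i x (by omega)
      have h2 : q (i - 1) = fun _ => 0 := funext fun x => hq0 (i - 1) x (by omega)
      simp [h1, h2]
    · obtain ⟨N, rfl⟩ : ∃ N', N = N' + 1 := ⟨N - 1, by omega⟩
      have hN' : j < N := by omega
      have hκf : ContDiff ℝ ∞ fun x => κ x * f x := hκ.contDiff.mul hf
      have h2 : deriv (eulerTranspose^[j] fun x => κ x * f x) x = ∑ i ∈ Finset.range N,
          (deriv (q i) x * powDeriv i f x + q i x * deriv (powDeriv i f) x) := by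
        rw [funext fun x => h f hf N hN' x]
        refine HasDerivAt.deriv (HasDerivAt.fun_sum fun i _ => ?_)
        exact ((hq i).contDiff.differentiable (by simp) x).hasDerivAt.mul
          ((contDiff_powDeriv hf i).differentiable (by simp) x).hasDerivAt
      rw [Function.iterate_succ_apply', eulerTranspose_apply (contDiff_iterate_eulerTranspose hκf j),
        h2, h f hf N hN' x]
      have h3 : deriv (q N) x = 0 := by
        have h1 : q N = fun _ => 0 := funext fun x => hq0 N x hN'
        rw [h1, deriv_const]
      have e1 : ∑ i ∈ Finset.range (N + 1), (if i = 0 then fun _ => (0 : 𝕜) else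
          fun x => (-1) * q (i - 1) x) x * powDeriv i f x =
          ∑ i ∈ Finset.range N, (-1) * q i x * powDeriv (i + 1) f x := by
        rw [Finset.sum_range_succ']
        simp
      have e2 : ∑ i ∈ Finset.range (N + 1), ((-(1 + (i : 𝕜))) * q i x +
          (-1) * ((x : 𝕜) * deriv (q i) x)) * powDeriv i f x =
          ∑ i ∈ Finset.range N, ((-(1 + (i : 𝕜))) * q i x +
            (-1) * ((x : 𝕜) * deriv (q i) x)) * powDeriv i f x := by
        rw [Finset.sum_range_succ, hq0 N x hN', h3]
        simp
      rw [Finset.sum_congr rfl (fun i _ => add_mul _ _ _)]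
      refine Eq.trans ?_ Finset.sum_add_distrib.symm
      rw [e1, e2, Finset.mul_sum]
      rw [← Finset.sum_add_distrib, ← Finset.sum_add_distrib, ← Finset.sum_neg_distrib]
      refine Finset.sum_congr rfl fun i _ => ?_
      have h4 := mul_deriv_powDeriv hf i x
      linear_combination (-q i x) * h4

end Representation

end HadamardOp

namespace HadamardOp

open Set Filter Topology
open scoped ContDiff

variable {𝕜 : Type*} [RCLike 𝕜] {U V : Opens ℝ}

/-! ### Representations of `T` in `𝓓'_H`. -/

section Representation

/-- The two extra orders of the weight dominate `|x| ^ l * (1 + x ^ 2)`, and `(1 + x ^ 2)⁻¹` is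
integrable. -/
theorem integrable_pow_mul_of_weight {k l : ℕ} (hl : l ≤ k) {t : ℝ → 𝕜}
    (ht : MemLp (fun x : ℝ => (((1 + |x| ^ 2) ^ (((k + 2 : ℕ) : ℝ) / 2) : ℝ) : 𝕜) * t x) ⊤ volume) :
    Integrable fun x : ℝ => (x : 𝕜) ^ l * t x := by
  let w : ℝ → ℝ := fun x => (1 + |x| ^ 2) ^ (((k + 2 : ℕ) : ℝ) / 2)
  have hw0 : ∀ x, 0 < w x := fun x => Real.rpow_pos_of_pos (by positivity) _
  have hwc : Continuous w := Continuous.rpow_const (by fun_prop) fun x => Or.inl (by positivity)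
  have hw : ∀ x, |x| ^ l * (1 + x ^ 2) ≤ w x := by
    intro x
    have h1 : (1 : ℝ) ≤ 1 + |x| ^ 2 := by nlinarith [sq_nonneg |x|]
    have h2 : w x = (1 + |x| ^ 2) ^ ((k : ℝ) / 2) * (1 + x ^ 2) := by
      simp only [w]
      rw [← sq_abs x, show ((k + 2 : ℕ) : ℝ) / 2 = (k : ℝ) / 2 + 1 by push_cast; ring,
        Real.rpow_add (by positivity), Real.rpow_one]
    rw [h2]
    refine mul_le_mul_of_nonneg_right ?_ (by positivity)
    calc |x| ^ l = (|x| ^ 2) ^ ((l : ℝ) / 2) := by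
          rw [← Real.rpow_natCast (|x|) 2, ← Real.rpow_mul (abs_nonneg x), ← Real.rpow_natCast]
          congr 1
          push_cast
          ring
      _ ≤ (1 + |x| ^ 2) ^ ((l : ℝ) / 2) :=
          Real.rpow_le_rpow (by positivity) (by linarith) (by positivity)
      _ ≤ (1 + |x| ^ 2) ^ ((k : ℝ) / 2) := by
          refine Real.rpow_le_rpow_of_exponent_le h1 ?_
          have : (l : ℝ) ≤ k := by exact_mod_cast hl
          linarith
  have hint : Integrable fun x : ℝ => (x : 𝕜) ^ l * ((w x : ℝ) : 𝕜)⁻¹ := by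
    refine integrable_inv_one_add_sq.mono' (Continuous.aestronglyMeasurable ?_)
      (ae_of_all _ fun x => ?_)
    · refine Continuous.mul (by fun_prop) (Continuous.inv₀ (by fun_prop) fun x => ?_)
      exact_mod_cast (hw0 x).ne'
    · rw [norm_mul, norm_inv, norm_pow, RCLike.norm_ofReal, RCLike.norm_ofReal, abs_of_pos (hw0 x),
        ← div_eq_mul_inv, div_le_iff₀ (hw0 x), inv_mul_eq_div, le_div_iff₀ (by positivity)]
      exact hw x
  refine (hint.mul_of_top_left ht).congr (ae_of_all _ fun x => ?_)
  have h1 : ((w x : ℝ) : 𝕜) ≠ 0 := by exact_mod_cast (hw0 x).ne'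
  change (x : 𝕜) ^ l * ((w x : ℝ) : 𝕜)⁻¹ * (((w x : ℝ) : 𝕜) * t x) = _
  field_simp

/-- As `T` vanishes near zero, `φ` may be replaced by `(1 - ρ) φ`. The Leibniz rule for `θ*ʲ` then
transfers the cutoff to the densities, which acquire the gap at zero and keep their decay, outer
cutoffs being bounded. -/
theorem exists_isRep_of_isDH {T : Dist 𝕜 ⊤} (hT : IsDH T) :
    ∃ δ > 0, ∀ k, ∃ N τ, IsRep T δ k N τ := by
  obtain ⟨hOH, ε, hε, hsupp⟩ := hT
  obtain ⟨ρ, hρ, hρ1, hρ0⟩ := exists_annulus_cutoff 𝕜 (half_pos hε)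
  have hρK : Function.support ρ ⊆ Metric.closedBall 0 (ε / 2) := by
    intro x hx
    rw [mem_closedBall_zero_iff, Real.norm_eq_abs]
    by_contra hlt
    exact hx (hρ0 x (by linarith))
  have hρs : HasCompactSupport ρ :=
    HasCompactSupport.of_support_subset_isCompact (isCompact_closedBall _ _) hρK
  have hκ : IsOuterCutoff (ε / 4) fun x => 1 - ρ x := by
    refine ⟨contDiff_const.sub hρ, fun x hx => ?_, ?_, ?_⟩
    · rw [hρ1 x (by linarith), sub_self]
    · have h1 : deriv (fun x => 1 - ρ x) = -deriv ρ := funext fun x => by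
        rw [deriv_const_sub, Pi.neg_apply]
      rw [h1]
      exact hρs.deriv.neg
    · obtain ⟨B, hB⟩ := hρ.continuous.bounded_above_of_compact_support hρs
      exact ⟨1 + B, fun x => (norm_sub_le _ _).trans (by
        rw [norm_one]
        exact add_le_add_right (hB x) 1)⟩
  have hTκ : ∀ φ, T φ = T (mulTest (fun x => 1 - ρ x) (contDiff_const.sub hρ) φ) := by
    intro φ
    conv_lhs => rw [mulTest_one_sub ρ hρ φ]
    rw [map_add, eq_zero_of_disjoint_supp T (mulTest ρ hρ φ), zero_add]
    intro x hx hxT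
    have h1 := closure_minimal hρK Metric.isClosed_closedBall (tsupport_mul_subset_left' _ _ hx)
    rw [mem_closedBall_zero_iff, Real.norm_eq_abs] at h1
    linarith [hsupp x hxT]
  choose q hq hq0 hqe using fun j => exists_iterate_eulerTranspose_mul hκ j
  refine ⟨ε / 4, by positivity, fun k => ?_⟩
  obtain ⟨N, t, ht, hTt⟩ := hOH (k + 2)
  have hint : ∀ j < N, ∀ i, ∀ l ≤ k, Integrable fun x : ℝ => (x : 𝕜) ^ l * (q j i x * t j x) := by
    intro j hj i l hl
    obtain ⟨B, hB⟩ := (hq j i).bounded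
    refine ((integrable_pow_mul_of_weight hl (ht j hj)).bdd_mul (c := B)
      (hq j i).contDiff.continuous.aestronglyMeasurable (ae_of_all _ hB)).congr
      (ae_of_all _ fun x => ?_)
    simp only
    ring
  refine ⟨N, fun i x => ∑ j ∈ Finset.range N, q j i x * t j x, fun i l hl => ?_, fun i x hx => ?_,
    fun φ => ?_⟩
  · simp only [Finset.mul_sum]
    exact integrable_finsetSum _ fun j hj => hint j (Finset.mem_range.1 hj) i l hl
  · exact Finset.sum_eq_zero fun j _ => by rw [(hq j i).eq_zero x hx, zero_mul]
  · have hφ := TestFunction.contDiff_infty φ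
    have hint' : ∀ j ∈ Finset.range N, ∀ i,
        Integrable fun x : ℝ => q j i x * t j x * powDeriv i φ x := by
      intro j hj i
      have hc := (contDiff_powDeriv hφ i).continuous
      obtain ⟨B, hB⟩ := hc.bounded_above_of_compact_support
        (hasCompactSupport_powDeriv φ.hasCompactSupport i)
      exact (by simpa using hint j (Finset.mem_range.1 hj) i 0 (Nat.zero_le _) :
        Integrable fun x => q j i x * t j x).mul_bdd (c := B) hc.aestronglyMeasurable
        (ae_of_all _ hB)
    rw [hTκ, hTt]
    have h1 : ∀ j ∈ Finset.range N, ∫ x : ℝ, t j x *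
        (eulerTranspose^[j] (mulTest (fun x => 1 - ρ x) (contDiff_const.sub hρ) φ)) x =
        ∑ i ∈ Finset.range N, ∫ x : ℝ, q j i x * t j x * powDeriv i φ x := by
      intro j hj
      rw [← integral_finsetSum _ fun i _ => hint' j hj i]
      refine integral_congr_ae (ae_of_all _ fun x => ?_)
      change t j x * (eulerTranspose^[j] fun x => (1 - ρ x) * φ x) x = _
      rw [hqe j φ hφ N (Finset.mem_range.1 hj) x, Finset.mul_sum]
      refine Finset.sum_congr rfl fun i _ => ?_
      ring
    rw [Finset.sum_congr rfl h1, Finset.sum_comm]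
    refine Finset.sum_congr rfl fun i _ => ?_
    rw [← integral_finsetSum _ fun j hj => hint' j hj i]
    simp only [Finset.sum_mul]

end Representation

/-! ### Convolution as the transpose of the operator on test functions. -/

section Convolution

variable {T : Dist 𝕜 V}

/-- Eigenvectors must be nonzero; `x ^ n` is nonzero almost everywhere and a nonempty open set has
positive measure. -/
theorem monomial_ne_zero (hU : (U : Set ℝ).Nonempty) (n : ℕ) : monomial 𝕜 U n ≠ 0 := by
  intro h
  have h1 := U.isOpen.ae_eq_zero_of_integral_contDiff_smul_eq_zero (μ := volume)
    (f := fun x : ℝ => (x : 𝕜) ^ n)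
    ((RCLike.continuous_ofReal.pow n).locallyIntegrable.locallyIntegrableOn _)
    (fun g hg hgs hgU => by
      have h2 := monomial_apply (𝕜 := 𝕜) U n (mkTest U (fun x => (g x : 𝕜))
        ((contDiff_ofReal 𝕜).comp hg) hgs hgU
        ((Function.support_comp_subset (RCLike.ofReal_zero) g).trans (subset_tsupport g)))
      rw [h] at h2
      rw [← show (0 : Dist 𝕜 U) _ = (0 : 𝕜) from rfl, h2]
      refine integral_congr_ae (ae_of_all _ fun x => ?_)
      change g x • ((x : 𝕜) ^ n) = (g x : 𝕜) * (x : 𝕜) ^ n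
      rw [RCLike.real_smul_eq_coe_mul])
  have h3 : volume (U : Set ℝ) = 0 := by
    have h4 : ∀ᵐ x : ℝ, x ≠ 0 := by simp [ae_iff]
    refine measure_eq_zero_iff_ae_notMem.2 ?_
    filter_upwards [h1, h4] with x hx hx0 hxU
    exact pow_ne_zero n (by simpa using hx0 : (x : 𝕜) ≠ 0) (hx hxU)
  exact (U.isOpen.measure_pos volume hU).ne' h3

theorem preservesMoments_of_transpose {A : Dist 𝕜 U →L[𝕜] Dist 𝕜 U}
    (hA : A ∈ hadamardOperators 𝕜 U) {M : 𝓓(U, 𝕜) →ₗ[𝕜] 𝓓(U, 𝕜)}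
    (hAM : ∀ S φ, A S φ = S (M φ)) : PreservesMoments M := by
  intro n
  obtain ⟨m, hm⟩ := hA n
  refine ⟨m, fun φ => ?_⟩
  have h1 : A (monomial 𝕜 U n) = m • monomial 𝕜 U n := hm.apply_eq_smul
  have h2 := hAM (monomial 𝕜 U n) φ
  rw [h1, monomial_apply] at h2
  rw [← h2, ← monomial_apply]
  rfl

theorem existsUnique_isMulConv {M : 𝓓(U, 𝕜) →L[𝕜] 𝓓(U, 𝕜)}
    (hM : ∀ φ, IsDualDilation T φ (M φ)) (S : Dist 𝕜 U) : ∃! R : Dist 𝕜 U, IsMulConv S T R := by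
  refine ⟨ContinuousLinearMap.toUniformConvergenceCLM _ _ _
    (((ContinuousLinearMap.toUniformConvergenceCLM _ _ _).symm S).comp M),
    fun φ => ⟨M φ, hM φ, rfl⟩, fun R hR => ?_⟩
  refine DFunLike.ext _ _ fun φ => ?_
  obtain ⟨ψ, h1, h2⟩ := hR φ
  rw [h2, h1.unique (hM φ)]
  rfl

theorem exists_hadamardOperator (hU : (U : Set ℝ).Nonempty) {M : 𝓓(U, 𝕜) →L[𝕜] 𝓓(U, 𝕜)}
    (hM : ∀ φ, IsDualDilation T φ (M φ)) (hm : PreservesMoments M.toLinearMap) :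
    ∃ A ∈ hadamardOperators 𝕜 U, ∀ S, IsMulConv S T (A S) := by
  refine ⟨M.precompCompactConvergenceCLM 𝕜, fun n => ?_, fun S φ => ⟨M φ, hM φ, rfl⟩⟩
  obtain ⟨m, h⟩ := hm n
  refine ⟨m, Module.End.mem_eigenspace_iff.2 (DFunLike.ext _ _ fun φ => ?_), monomial_ne_zero hU n⟩
  change monomial 𝕜 U n (M φ) = m * monomial 𝕜 U n φ
  rw [monomial_apply, monomial_apply]
  exact h φ

end Convolution

end HadamardOp

namespace HadamardOp

open Set Filter Topology
open scoped ContDiff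

variable {𝕜 : Type*} [RCLike 𝕜] {U V : Opens ℝ}

/-! ### A multiplicative partition of unity on the punctured line. -/

section Partition

/-- The numbers `± qⁿ`, `n ∈ ℤ`. -/
noncomputable def scale (q : ℝ) (n : ℕ) (b : Bool × Bool) : ℝ :=
  (if b.1 then 1 else -1) * (if b.2 then q ^ n else (q ^ (n + 1))⁻¹)

theorem scale_ne_zero {q : ℝ} (hq : 1 < q) (n : ℕ) (b : Bool × Bool) : scale q n b ≠ 0 := by
  have : q ≠ 0 := by positivity
  unfold scale
  split_ifs <;> simp [this]

theorem exists_scale_avoid {q : ℝ} (hq : 1 < q) {K : Set ℝ} (hK : IsCompact K) (h0 : (0 : ℝ) ∉ K) :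
    ∃ N : ℕ, ∀ n ≥ N, ∀ b, scale q n b ∉ K := by
  obtain ⟨r, hr⟩ := hK.isBounded.exists_norm_le
  obtain ⟨ε, hε, hball⟩ := Metric.isOpen_iff.1 hK.isClosed.isOpen_compl 0 h0
  obtain ⟨N₁, h1⟩ := pow_unbounded_of_one_lt r hq
  obtain ⟨N₂, h2⟩ := pow_unbounded_of_one_lt ε⁻¹ hq
  refine ⟨max N₁ N₂, fun n hn b hb => ?_⟩
  have hq0 : 0 < q := by linarith
  have h3 : r < q ^ n :=
    h1.trans_le (pow_le_pow_right₀ hq.le ((le_max_left _ _).trans hn))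
  have h4 : ε⁻¹ < q ^ (n + 1) :=
    h2.trans_le (pow_le_pow_right₀ hq.le (((le_max_right _ _).trans hn).trans (Nat.le_succ n)))
  have h5 : |scale q n b| = if b.2 then q ^ n else (q ^ (n + 1))⁻¹ := by
    unfold scale
    rw [abs_mul]
    split_ifs <;> simp [abs_of_pos hq0]
  by_cases hb2 : b.2
  · rw [if_pos hb2] at h5
    have := hr _ hb
    rw [Real.norm_eq_abs, h5] at this
    linarith
  · rw [if_neg hb2] at h5
    refine hball ?_ hb
    rw [mem_ball_zero_iff, Real.norm_eq_abs, h5]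
    exact inv_lt_of_inv_lt₀ hε h4

/-- A multiplicative partition of unity consisting of dilates of one function supported near a
given point. -/
theorem exists_partition (𝕜 : Type*) [RCLike 𝕜] {c : ℝ} (hc : c ≠ 0) (hcU : c ∈ U) :
    ∃ (q : ℝ) (ρ : 𝓓(U, 𝕜)), 1 < q ∧ ∀ K : Set ℝ, IsCompact K → (0 : ℝ) ∉ K →
      ∃ N₀ : ℕ, ∀ N ≥ N₀, ∀ x ∈ K, ∑ n ∈ Finset.range N, ∑ b, ρ (scale q n b * x) = 1 := by
  obtain ⟨q, hq, hqU⟩ : ∃ q : ℝ, 1 < q ∧ ∀ u ∈ Icc q⁻¹ q, c * u ∈ U := by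
    have h1 : (fun u : ℝ => c * u) ⁻¹' U ∈ 𝓝 (1 : ℝ) :=
      (U.isOpen.preimage (by fun_prop)).mem_nhds (by simpa using hcU)
    obtain ⟨ε, hε, hεU⟩ := Metric.nhds_basis_closedBall.mem_iff.1 h1
    refine ⟨1 + ε, by linarith, fun u hu => hεU ?_⟩
    rw [Metric.mem_closedBall, Real.dist_eq, abs_le]
    have h2 : 1 - ε ≤ (1 + ε)⁻¹ := by
      rw [← one_div, le_div_iff₀ (by positivity)]
      nlinarith
    exact ⟨by linarith [hu.1], by linarith [hu.2]⟩
  have hq0 : 0 < q := by linarith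
  have hq1 : 0 < q - 1 := by linarith
  -- A one-sided cutoff, equal to one also for all negative `u`. The differences `ζ u - ζ (q * u)`
  -- live in `[q⁻¹, q]` and telescope along the powers of `q` to one for `u > 0` and to zero for `u
  -- < 0`; the two signs in `scale` cover both half-lines.
  let ζ : ℝ → 𝕜 := fun u => ((1 - Real.smoothTransition ((u - 1) / (q - 1)) : ℝ) : 𝕜)
  have hζ : ContDiff ℝ ∞ ζ := (contDiff_ofReal 𝕜).comp
    (contDiff_const.sub (Real.smoothTransition.contDiff.comp
      ((contDiff_id.sub contDiff_const).div_const _)))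
  have hζ1 : ∀ u ≤ 1, ζ u = 1 := by
    intro u hu
    have : (u - 1) / (q - 1) ≤ 0 := div_nonpos_of_nonpos_of_nonneg (by linarith) hq1.le
    simp [ζ, Real.smoothTransition.zero_of_nonpos this]
  have hζ0 : ∀ u, q ≤ u → ζ u = 0 := by
    intro u hu
    have : 1 ≤ (u - 1) / (q - 1) := (one_le_div hq1).2 (by linarith)
    simp [ζ, Real.smoothTransition.one_of_one_le this]
  let ρ₀ : ℝ → 𝕜 := fun u => ζ u - ζ (q * u)
  have hρ₀ : ∀ u, ρ₀ u ≠ 0 → u ∈ Icc q⁻¹ q := by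
    intro u hu
    constructor
    · by_contra hlt
      have h1 : q * u ≤ 1 := by
        have h2 := mul_le_mul_of_nonneg_left (not_le.1 hlt).le hq0.le
        rwa [mul_inv_cancel₀ hq0.ne'] at h2
      have h3 : u ≤ 1 := (not_le.1 hlt).le.trans (inv_le_one_of_one_le₀ hq.le)
      exact hu (by simp only [ρ₀]; rw [hζ1 _ h1, hζ1 _ h3, sub_self])
    · by_contra hlt
      have h1 : q ≤ u := (not_le.1 hlt).le
      have h2 : q ≤ q * u := le_mul_of_one_le_right hq0.le (by linarith)
      exact hu (by simp only [ρ₀]; rw [hζ0 _ h1, hζ0 _ h2, sub_self])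
  let ρ : 𝓓(U, 𝕜) := mkTest U (fun x => ρ₀ (c⁻¹ * x))
    (contDiff_dilation (hζ.sub (contDiff_dilation hζ q)) c⁻¹)
    (isCompact_Icc.image (f := fun u => c * u) (by fun_prop))
    (by rintro _ ⟨u, hu, rfl⟩; exact hqU u hu)
    (fun x hx => ⟨c⁻¹ * x, hρ₀ _ hx, mul_inv_cancel_left₀ hc x⟩)
  refine ⟨q, ρ, hq, fun K hK hK0 => ?_⟩
  obtain ⟨r, hr⟩ := hK.isBounded.exists_norm_le
  obtain ⟨ε, hε, hball⟩ := Metric.isOpen_iff.1 hK.isClosed.isOpen_compl 0 hK0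
  obtain ⟨N₁, h1⟩ := pow_unbounded_of_one_lt (|c|⁻¹ * r) hq
  obtain ⟨N₂, h2⟩ := pow_unbounded_of_one_lt (q / (|c|⁻¹ * ε)) hq
  refine ⟨max N₁ N₂, fun N hN x hx => ?_⟩
  have hc' : 0 < |c|⁻¹ := inv_pos.2 (abs_pos.2 hc)
  set u : ℝ := c⁻¹ * x with hu
  have hu1 : |u| ≤ q ^ N := by
    rw [hu, abs_mul, abs_inv]
    calc |c|⁻¹ * |x| ≤ |c|⁻¹ * r := mul_le_mul_of_nonneg_left (hr x hx) hc'.le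
      _ ≤ q ^ N₁ := h1.le
      _ ≤ q ^ N := pow_le_pow_right₀ hq.le ((le_max_left _ _).trans hN)
  have hu2 : q ≤ q ^ N * |u| := by
    have h3 : ε ≤ |x| := by
      by_contra hlt
      exact hball (by simpa using hlt) hx
    have h4 : q / (|c|⁻¹ * ε) ≤ q ^ N :=
      h2.le.trans (pow_le_pow_right₀ hq.le ((le_max_right _ _).trans hN))
    rw [div_le_iff₀ (by positivity)] at h4
    refine h4.trans ?_
    rw [hu, abs_mul, abs_inv]
    gcongr
  have htel : ∀ v : ℝ, ∑ n ∈ Finset.range N, (ρ₀ (q ^ n * v) + ρ₀ ((q ^ (n + 1))⁻¹ * v)) =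
      ζ ((q ^ N)⁻¹ * v) - ζ (q ^ N * v) := by
    intro v
    have h3 : ∀ n, ρ₀ (q ^ n * v) = ζ (q ^ n * v) - ζ (q ^ (n + 1) * v) := by
      intro n
      simp only [ρ₀]
      rw [pow_succ']
      congr 2
      ring
    have h4 : ∀ n, ρ₀ ((q ^ (n + 1))⁻¹ * v) =
        ζ ((q ^ (n + 1))⁻¹ * v) - ζ ((q ^ n)⁻¹ * v) := by
      intro n
      simp only [ρ₀]
      rw [pow_succ, mul_inv]
      congr 2
      field_simp
    simp_rw [h3, h4]
    rw [Finset.sum_add_distrib, Finset.sum_range_sub' (fun n => ζ (q ^ n * v)),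
      Finset.sum_range_sub (fun n => ζ ((q ^ n)⁻¹ * v))]
    simp
  have hsplit : ∑ n ∈ Finset.range N, ∑ b, ρ (scale q n b * x) =
      (ζ ((q ^ N)⁻¹ * u) - ζ (q ^ N * u)) + (ζ ((q ^ N)⁻¹ * -u) - ζ (q ^ N * -u)) := by
    rw [← htel, ← htel, ← Finset.sum_add_distrib]
    refine Finset.sum_congr rfl fun n _ => ?_
    have h3 : ∀ b, ρ (scale q n b * x) = ρ₀ (scale q n b * u) := fun b => by
      change ρ₀ (c⁻¹ * (scale q n b * x)) = _
      congr 1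
      rw [hu]
      ring
    rw [Finset.sum_congr rfl fun b _ => h3 b]
    simp only [Fintype.sum_prod_type, Fintype.sum_bool, scale, if_true, one_mul, neg_mul, mul_neg,
      Bool.false_eq_true, if_false]
  have hqN : 0 < q ^ N := by positivity
  have h5 : ∀ v, |v| ≤ q ^ N → ζ ((q ^ N)⁻¹ * v) = 1 := fun v hv => by
    refine hζ1 _ ?_
    rw [inv_mul_le_iff₀ hqN, mul_one]
    exact (le_abs_self v).trans hv
  rw [hsplit, h5 u hu1, h5 (-u) (by rwa [abs_neg])]
  rcases le_total 0 u with h | h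
  · rw [abs_of_nonneg h] at hu2
    rw [hζ0 _ hu2, hζ1 (q ^ N * -u) (by nlinarith)]
    ring
  · rw [abs_of_nonpos h] at hu2
    rw [hζ0 _ hu2, hζ1 (q ^ N * u) (by nlinarith)]
    ring

end Partition

/-! ### Recovering `T` from `M` when `0 ∉ U`. -/

section Punctured

theorem sum_dist_apply {ι : Type*} (s : Finset ι) (t : ι → Dist 𝕜 U) (φ : 𝓓(U, 𝕜)) :
    (∑ i ∈ s, t i) φ = ∑ i ∈ s, t i φ := by
  classical
  induction s using Finset.induction_on with
  | empty => rfl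
  | insert i s hi ih =>
    rw [Finset.sum_insert hi, Finset.sum_insert hi, ← ih]
    rfl

theorem exists_mul_bound {κ : ℝ → 𝕜} (hκ : ContDiff ℝ ∞ κ) (hκs : HasCompactSupport κ) (m : ℕ) :
    ∃ C : ℝ, 0 ≤ C ∧ ∀ f : ℝ → 𝕜, ContDiff ℝ ∞ f → ∀ B : ℝ, DerivBound (m + 1) B f →
      DerivBound m (C * B) (fun x => κ x * f x) := by
  obtain ⟨C, hC, hloc⟩ := exists_localization_bound hκ hκs m
  refine ⟨C * ((m + 2) * volume.real (tsupport κ)), by positivity, fun f hf B hB => ?_⟩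
  refine (hloc f hf).mono le_rfl ?_
  rw [mul_assoc]
  refine mul_le_mul_of_nonneg_left ?_ hC
  have h4 : ∀ l ∈ Finset.range (m + 2),
      ∫ x in tsupport κ, ‖iteratedDeriv l f x‖ ≤ volume.real (tsupport κ) * B := by
    intro l hl
    rw [Finset.mem_range] at hl
    have h5 := norm_setIntegral_le_of_norm_le_const (μ := volume) (s := tsupport κ) (C := B)
      (f := fun x => ‖iteratedDeriv l f x‖) (IsCompact.measure_lt_top hκs) (fun x _ => by
        rw [norm_norm]
        exact hB _ (by omega) x)
    rw [mul_comm]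
    exact (le_abs_self _).trans h5
  refine (Finset.sum_le_sum h4).trans (le_of_eq ?_)
  rw [Finset.sum_const, Finset.card_range, nsmul_eq_mul]
  push_cast
  ring

/-- The distribution `φ ↦ M (ρ φ(·/η)) η`. -/
theorem exists_dist_of_scale {M : 𝓓(U, 𝕜) →ₗ[𝕜] 𝓓(U, 𝕜)} (hb : IsLocallyBounded M) (ρ : 𝓓(U, 𝕜))
    (η : ℝ) : ∃ t : Dist 𝕜 V, ∀ (φ : 𝓓(V, 𝕜)) (ψ : 𝓓(U, 𝕜)),
      (∀ x, ψ x = ρ x * φ (η⁻¹ * x)) → t φ = M ψ η := by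
  let R : 𝓓(V, 𝕜) → 𝓓(U, 𝕜) := fun φ => mkTest U (fun x => ρ x * φ (η⁻¹ * x))
    ((TestFunction.contDiff_infty ρ).mul (contDiff_dilation (TestFunction.contDiff_infty φ) _))
    ρ.hasCompactSupport ρ.tsupport_subset
    ((Function.support_mul_subset_left _ _).trans (subset_tsupport _))
  have hR : ∀ φ ψ, (∀ x, ψ x = ρ x * φ (η⁻¹ * x)) → ψ = R φ := fun φ ψ h => by
    ext x
    exact h x
  let t : 𝓓(V, 𝕜) →ₗ[𝕜] 𝕜 :=
    { toFun := fun φ => M (R φ) η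
      map_add' := fun φ ψ => by
        rw [← hR (φ + ψ) (R φ + R ψ) fun x => (mul_add (ρ x) _ _).symm, map_add]
        rfl
      map_smul' := fun c φ => by
        rw [← hR (c • φ) (c • R φ) fun x => mul_left_comm c (ρ x) (φ _), map_smul]
        rfl }
  refine ⟨mkDist t fun K _ _ => ?_, fun φ ψ h => by rw [hR φ ψ h]; rfl⟩
  obtain ⟨L, -, -, -, hL⟩ := hb _ ρ.hasCompactSupport ρ.tsupport_subset
  obtain ⟨m, C, hC⟩ := hL 0
  obtain ⟨C', hC', hmul⟩ := exists_mul_bound (TestFunction.contDiff_infty ρ) ρ.hasCompactSupport m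
  refine ⟨m + 1, C * (C' * (1 + |η⁻¹|) ^ (m + 1)), fun φ _ B hB => ?_⟩
  have h1 := hC (R φ) ((Function.support_mul_subset_left _ _).trans (subset_tsupport _)) _
    (hmul _ (contDiff_dilation (TestFunction.contDiff_infty φ) η⁻¹) _
      (hB.dilation (TestFunction.contDiff_infty φ) η⁻¹)) η
  rw [iteratedDeriv_zero] at h1
  rw [mul_assoc, mul_assoc]
  exact h1

/-- Formally `T φ = ∑ M(ρ φ(·/η))(η)` over `η = ± qⁿ`, `n ∈ ℤ`: each piece `ρ(η·) φ` is dilated into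
`U` separately. Membership of `(supp T)⁻¹` in `V_*(U)` comes from `exists_compact_of_supp` for
single points, the value zero being excluded since `0 ∉ U`. -/
theorem exists_dist_of_punctured (hU : (U : Set ℝ) ⊆ {0}ᶜ) (hne : (U : Set ℝ).Nonempty)
    {M : 𝓓(U, 𝕜) →ₗ[𝕜] 𝓓(U, 𝕜)} (hM : PreservesMoments M) (hb : IsLocallyBounded M) :
    ∃ T : Dist 𝕜 puncturedLine, HasCompactSupp T ∧ (supp T)⁻¹ ⊆ dilationSet U ∧
      ∀ φ : 𝓓(U, 𝕜), IsDualDilation T φ (M φ) := by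
  obtain ⟨c, hc⟩ := hne
  obtain ⟨q, ρ, hq, hpart⟩ := exists_partition 𝕜 (hU hc) hc
  obtain ⟨L, hL, hLU, hML, -⟩ := hb _ ρ.hasCompactSupport ρ.tsupport_subset
  -- All images `M(ρ φ(·/η))` are supported in `L`, so only finitely many `η` contribute and the sum
  -- defining `T` can be truncated.
  obtain ⟨N, hN⟩ := exists_scale_avoid hq hL fun h => hU (hLU h) rfl
  choose t ht using fun η => exists_dist_of_scale (V := puncturedLine) hb ρ η
  let T : Dist 𝕜 puncturedLine := ∑ n ∈ Finset.range N, ∑ b, t (scale q n b)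
  have hT : ∀ φ, T φ = ∑ n ∈ Finset.range N, ∑ b, t (scale q n b) φ := fun φ => by
    rw [sum_dist_apply]
    exact Finset.sum_congr rfl fun n _ => sum_dist_apply _ _ _
  have hdual : ∀ φ : 𝓓(U, 𝕜), IsDualDilation T φ (M φ) := by
    intro φ y hy
    obtain ⟨χ, hχ, -⟩ := exists_dilated_test (U := puncturedLine) φ φ.hasCompactSupport
      (subset_tsupport _) (inv_ne_zero hy) (by
        rintro _ ⟨x, hx, rfl⟩
        exact mul_ne_zero (inv_ne_zero hy) (hU (φ.tsupport_subset hx)))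
    rw [inv_inv] at hχ
    refine ⟨χ, fun x => by rw [hχ, mul_comm], ?_⟩
    let Bf : ℝ → 𝓓(U, 𝕜) := fun η => mulTest (fun x => ρ (η * y⁻¹ * x))
      (contDiff_dilation (TestFunction.contDiff_infty ρ) _) φ
    -- Commuting `M` with a dilation turns the `η`-term into the value at `y` of `M` on the piece
    -- `ρ(η y⁻¹ ·) φ`; these pieces add up to `φ`.
    have hterm : ∀ η ≠ 0, t η χ = M (Bf η) y ∧ (η ∉ L → t η χ = 0) := by
      intro η hη
      let A : 𝓓(U, 𝕜) := mulTest (fun x => χ (η⁻¹ * x))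
        (contDiff_dilation (TestFunction.contDiff_infty χ) _) ρ
      have h1 : t η χ = M A η := ht η χ A fun x => mul_comm _ _
      rw [h1]
      constructor
      · rw [hM.dilation (φ := Bf η) (φ' := A) (a := y * η⁻¹) (by positivity) fun x => by
          change χ (η⁻¹ * x) * ρ x = ρ (η * y⁻¹ * (y * η⁻¹ * x)) * φ (y * η⁻¹ * x)
          rw [hχ, mul_comm, mul_assoc y]
          congr 2
          field_simp]
        congr 1
        field_simp
      · intro hηL
        by_contra h
        refine hηL (hML A ?_ h)
        exact (Function.support_mul_subset_right _ _).trans (subset_tsupport _)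
    obtain ⟨N₀, hN₀⟩ := hpart ((fun x => y⁻¹ * x) '' tsupport φ)
      (φ.hasCompactSupport.isCompact.image (by fun_prop)) (by
        rintro ⟨x, hx, h⟩
        exact mul_ne_zero (inv_ne_zero hy) (hU (φ.tsupport_subset hx)) h)
    -- The cutoff `N` depends only on `M` and `ρ`, whereas reassembling `φ` may need the larger
    -- `N₀`; the additional terms vanish.
    have h2 : T χ = ∑ n ∈ Finset.range (max N N₀), ∑ b, t (scale q n b) χ := by
      rw [hT]
      refine Finset.sum_subset (Finset.range_mono (le_max_left _ _)) fun n _ hn => ?_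
      rw [Finset.mem_range, not_lt] at hn
      exact Finset.sum_eq_zero fun b _ => (hterm _ (scale_ne_zero hq n b)).2 (hN n hn b)
    have h3 : φ = ∑ n ∈ Finset.range (max N N₀), ∑ b, Bf (scale q n b) := by
      ext x
      rw [sum_test_apply]
      simp only [sum_test_apply]
      change φ x = ∑ n ∈ Finset.range (max N N₀), ∑ b, ρ (scale q n b * y⁻¹ * x) * φ x
      by_cases hx : φ x = 0
      · simp [hx]
      · simp_rw [← Finset.sum_mul, mul_assoc]
        rw [hN₀ _ (le_max_right _ _) _ ⟨x, subset_tsupport _ hx, rfl⟩, one_mul]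
    rw [h2]
    conv_lhs => rw [h3]
    rw [map_sum, sum_test_apply]
    refine Finset.sum_congr rfl fun n _ => ?_
    rw [map_sum, sum_test_apply]
    exact Finset.sum_congr rfl fun b _ => ((hterm _ (scale_ne_zero hq n b)).1).symm
  let Q : Set ℝ := ⋃ n ∈ Finset.range N, ⋃ b : Bool × Bool,
    (fun x => (scale q n b)⁻¹ * x) '' tsupport ρ
  have hQ : IsCompact Q := (Finset.range N).isCompact_biUnion fun n _ =>
    isCompact_iUnion fun b => ρ.hasCompactSupport.isCompact.image (by fun_prop)
  have hQ0 : Q ⊆ puncturedLine := by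
    intro x hx
    simp only [Q, mem_iUnion] at hx
    obtain ⟨n, -, b, z, hz, rfl⟩ := hx
    exact mul_ne_zero (inv_ne_zero (scale_ne_zero hq n b)) (hU (ρ.tsupport_subset hz))
  have hsupp : supp T ⊆ Q := by
    intro x hx
    by_contra hxQ
    refine (Distribution.notMem_dsupport_iff x).2 ⟨Qᶜ, fun χ hχ => ?_, hQ.isClosed.isOpen_compl,
      hxQ⟩ hx
    rw [hT]
    refine Finset.sum_eq_zero fun n hn => Finset.sum_eq_zero fun b _ => ?_
    rw [ht _ χ 0 fun z => ?_, map_zero]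
    · rfl
    · change (0 : 𝕜) = _
      by_contra hne
      have hne' := Ne.symm hne
      refine hχ (subset_tsupport _ (right_ne_zero_of_mul hne')) ?_
      simp only [Q, mem_iUnion]
      exact ⟨n, hn, b, z, subset_tsupport _ (left_ne_zero_of_mul hne'), rfl⟩
  refine ⟨T, ⟨hQ.of_isClosed_subset Distribution.isClosed_dsupport hsupp, hsupp.trans hQ0⟩,
    fun x hx => ?_, hdual⟩
  have hx0 : x⁻¹ ≠ 0 := hQ0 (hsupp hx)
  refine ⟨by simpa using hx0, fun k hk => ?_⟩
  obtain ⟨L', -, hLU', h⟩ := exists_compact_of_supp hdual hb (isCompact_singleton (x := k))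
    (singleton_subset_iff.2 hk)
  have h1 := h x⁻¹ hx k rfl
  rw [inv_inv] at h1
  refine hLU' (h1.resolve_right ?_)
  exact mul_ne_zero (by simpa using hx0) (hU hk)

end Punctured

end HadamardOp

theorem theorem6p1 {𝕜 : Type*} [RCLike 𝕜] (Ω : TopologicalSpace.Opens ℝ)
    (hΩ : (Ω : Set ℝ).Nonempty) :
    ((0 : ℝ) ∈ Ω →
      (∀ T : HadamardOp.Dist 𝕜 ⊤, HadamardOp.IsDH T → HadamardOp.SuppCondition T Ω →
        ∀ S : HadamardOp.Dist 𝕜 Ω, ∃! R : HadamardOp.Dist 𝕜 Ω, HadamardOp.IsMulConv S T R) ∧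
      ∀ L : HadamardOp.Dist 𝕜 Ω → HadamardOp.Dist 𝕜 Ω,
        (∃ A ∈ HadamardOp.hadamardOperators 𝕜 Ω, ⇑A = L) ↔
          ∃ T : HadamardOp.Dist 𝕜 ⊤, HadamardOp.IsDH T ∧ HadamardOp.SuppCondition T Ω ∧
            ∀ S : HadamardOp.Dist 𝕜 Ω, HadamardOp.IsMulConv S T (L S)) ∧
    ((Ω : Set ℝ) ⊆ {0}ᶜ →
      (∀ T : HadamardOp.Dist 𝕜 HadamardOp.puncturedLine, HadamardOp.HasCompactSupp T →
        (HadamardOp.supp T)⁻¹ ⊆ HadamardOp.dilationSet Ω →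
        ∀ S : HadamardOp.Dist 𝕜 Ω, ∃! R : HadamardOp.Dist 𝕜 Ω, HadamardOp.IsMulConv S T R) ∧
      ∀ L : HadamardOp.Dist 𝕜 Ω → HadamardOp.Dist 𝕜 Ω,
        (∃ A ∈ HadamardOp.hadamardOperators 𝕜 Ω, ⇑A = L) ↔
          ∃ T : HadamardOp.Dist 𝕜 HadamardOp.puncturedLine, HadamardOp.HasCompactSupp T ∧
            (HadamardOp.supp T)⁻¹ ⊆ HadamardOp.dilationSet Ω ∧
            ∀ S : HadamardOp.Dist 𝕜 Ω, HadamardOp.IsMulConv S T (L S)) := by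
  refine ⟨fun h0 => ?_, fun hsub => ?_⟩
  · have hop : ∀ T : HadamardOp.Dist 𝕜 ⊤, HadamardOp.IsDH T → HadamardOp.SuppCondition T Ω →
        ∃ M : 𝓓(Ω, 𝕜) →L[𝕜] 𝓓(Ω, 𝕜), (∀ φ, HadamardOp.IsDualDilation T φ (M φ)) ∧
          HadamardOp.PreservesMoments M.toLinearMap := by
      intro T hT hsupp
      obtain ⟨δ, hδ, hrep⟩ := HadamardOp.exists_isRep_of_isDH hT
      obtain ⟨-, ε, hε, hsε⟩ := hT
      refine HadamardOp.exists_operator hδ hrep (fun φ y hy => ?_)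
        (HadamardOp.dilationProper_of_suppCondition (fun h => ?_) hsupp)
      · obtain ⟨χ, hχ, -⟩ := HadamardOp.exists_dilated_test (U := ⊤) φ φ.hasCompactSupport
          (subset_tsupport _) (inv_ne_zero hy) (fun _ _ => trivial)
        exact ⟨χ, fun x => by rw [hχ, inv_inv, mul_comm]⟩
      · have := hsε 0 h
        rw [abs_zero] at this
        linarith
    refine ⟨fun T hT hsupp S => ?_, fun L => ⟨?_, ?_⟩⟩
    · obtain ⟨M, hM, -⟩ := hop T hT hsupp
      exact HadamardOp.existsUnique_isMulConv hM S
    · rintro ⟨A, hA, rfl⟩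
      obtain ⟨M, hAM⟩ := HadamardOp.exists_transpose A
      have hm := HadamardOp.preservesMoments_of_transpose hA hAM
      have hb := HadamardOp.isLocallyBounded_of_transpose A M hAM
      obtain ⟨T, hT⟩ := HadamardOp.exists_dist_of_zero_mem h0 hm hb
      have hdual := HadamardOp.isDualDilation_of_dist hT
      exact ⟨T, HadamardOp.isDH_of_dualDilation h0 hm hb hdual,
        HadamardOp.suppCondition_of_zero_mem h0 hdual hb, fun S φ => ⟨M φ, hdual φ, hAM S φ⟩⟩
    · rintro ⟨T, hT, hsupp, hL⟩
      obtain ⟨M, hM, hm⟩ := hop T hT hsupp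
      obtain ⟨A, hA, hAS⟩ := HadamardOp.exists_hadamardOperator hΩ hM hm
      -- `L` is a bare map here; uniqueness of the convolution identifies it with the continuous
      -- operator `A`.
      exact ⟨A, hA, funext fun S =>
        (HadamardOp.existsUnique_isMulConv hM S).unique (hAS S) (hL S)⟩
  · have hop : ∀ T : HadamardOp.Dist 𝕜 HadamardOp.puncturedLine, HadamardOp.HasCompactSupp T →
        (HadamardOp.supp T)⁻¹ ⊆ HadamardOp.dilationSet Ω →
        ∃ M : 𝓓(Ω, 𝕜) →L[𝕜] 𝓓(Ω, 𝕜), (∀ φ, HadamardOp.IsDualDilation T φ (M φ)) ∧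
          HadamardOp.PreservesMoments M.toLinearMap := by
      intro T hT hsupp
      obtain ⟨δ, hδ, hrep⟩ := HadamardOp.exists_isRep_of_hasCompactSupp hT
      refine HadamardOp.exists_operator hδ hrep (fun φ y hy => ?_)
        (HadamardOp.dilationProper_of_hasCompactSupp hT hsupp)
      obtain ⟨χ, hχ, -⟩ := HadamardOp.exists_dilated_test (U := HadamardOp.puncturedLine) φ
        φ.hasCompactSupport (subset_tsupport _) (inv_ne_zero hy) (by
          rintro _ ⟨x, hx, rfl⟩
          exact mul_ne_zero (inv_ne_zero hy) (hsub (φ.tsupport_subset hx)))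
      exact ⟨χ, fun x => by rw [hχ, inv_inv, mul_comm]⟩
    refine ⟨fun T hT hsupp S => ?_, fun L => ⟨?_, ?_⟩⟩
    · obtain ⟨M, hM, -⟩ := hop T hT hsupp
      exact HadamardOp.existsUnique_isMulConv hM S
    · rintro ⟨A, hA, rfl⟩
      obtain ⟨M, hAM⟩ := HadamardOp.exists_transpose A
      have hm := HadamardOp.preservesMoments_of_transpose hA hAM
      have hb := HadamardOp.isLocallyBounded_of_transpose A M hAM
      obtain ⟨T, hT, hsupp, hdual⟩ := HadamardOp.exists_dist_of_punctured hsub hΩ hm hb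
      exact ⟨T, hT, hsupp, fun S φ => ⟨M φ, hdual φ, hAM S φ⟩⟩
    · rintro ⟨T, hT, hsupp, hL⟩
      obtain ⟨M, hM, hm⟩ := hop T hT hsupp
      obtain ⟨A, hA, hAS⟩ := HadamardOp.exists_hadamardOperator hΩ hM hm
      exact ⟨A, hA, funext fun S =>
        (HadamardOp.existsUnique_isMulConv hM S).unique (hAS S) (hL S)⟩
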